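/- Let $N \ge 1$, let $\mathcal G$ be an $N$-dimensional connected abelian Lie group with Lie algebra $\mathfrak g$, and let $B$ be a connected smooth surface without boundary. Let $\pi : M \to B$ be the smooth fiber bundle with fiber $\mathcal G$ associated to a principal $\mathcal G \rtimes \operatorname{Aut}(\mathcal G)_\delta$-bundle ($\delta$: discrete topology), i.e. $\pi$ has local trivializations with transition functions $x \mapsto s(b) + \varphi(x)$, with $s$ a smooth $\mathcal G$-valued function and $\varphi \in \operatorname{Aut}(\mathcal G)$ locally constant. Let $e \to B$ be the associated flat vector bundle with fiber $\mathfrak g$; assume that its holonomy lies in $\det^{-1}(\pm 1) \subset \operatorname{GL}(N,\mathbb R)$. Let $\overline g$ be a Riemannian metric on $M$ for which the local $\mathcal G$-actions are isometric; in adapted local coordinates $$\overline g = \sum_{I,J} G_{IJ}\,(dx^I + A^I)(dx^J + A^J) + \sum_{\alpha,\beta} g_{\alpha\beta}\, db^\alpha db^\beta ,$$ where $(G_{IJ})$ is the induced inner product on $e$ and $g_B = (g_{\alpha\beta})$ is the induced Riemannian metric on $B$. Computed in locally flat frames of $e$ related by matrices of determinant $\pm 1$, $\det G$ is a function on $B$.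 Suppose that * $\operatorname{Ric}(\overline g) = \lambda \overline g$ for a constant $\lambda \le 0$, * $(B, g_B)$ is parabolic: every nonnegative $C^2$ function $f$ on $B$ that is bounded above and satisfies $\triangle f \ge 0$ is constant, * $\det G$ is bounded above on $B$. Let $p : \widetilde B \to B$ be the universal cover. Writing $G$ in a global flat frame of $p^*e$ and scaling the resulting positive definite matrix to have determinant one gives a map $$\widetilde G : \widetilde B \to \operatorname{SL}(N,\mathbb R)/\operatorname{SO}(N),$$ where $h \operatorname{SO}(N)$ is identified with the positive definite matrix $h h^T$; it is equivariant with respect to the holonomy representation of $e$. Give $\operatorname{SL}(N,\mathbb R)/\operatorname{SO}(N)$ the invariant Riemannian metric $\langle S, T\rangle_P = \operatorname{tr}(P^{-1} S P^{-1} T)$. Then $\widetilde G$ is smooth, and there is a smooth function $f \ge 0$ on $B$ with $$\widetilde G^{*} g_{\operatorname{SL}(N,\mathbb R)/\operatorname{SO}(N)} = p^*(f\, g_B),$$ so that $\widetilde G$ is (weakly) conformal. Moreover, with respect to any locally flat frame of $e$, $$G^{IJ} G_{JK,\alpha} G^{KL} G_{LI,\beta} = 2 R\, g_{\alpha\beta},$$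 where $R$ is the scalar curvature of $g_B$. -/

import Mathlib

open scoped Manifold ContDiff Topology Matrix

noncomputable section

namespace EinsteinCollapse

/-! ### Riemannian geometry in coordinates

A chart takes values in `EuclideanSpace ℝ ι`; the coordinates are indexed by the finite type `ι`. -/

section Coordinates

variable {ι : Type*} [Fintype ι] [DecidableEq ι]

/-- The partial derivative `∂_i f` of a function of the coordinates. -/
def partialDeriv (i : ι) (f : EuclideanSpace ℝ ι → ℝ) (y : EuclideanSpace ℝ ι) : ℝ :=
  fderiv ℝ f y (EuclideanSpace.single i 1)

/-- The Christoffel symbols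
`Γ^k_{ij} = 1/2 g^{kl} (∂_i g_{jl} + ∂_j g_{il} - ∂_l g_{ij})` of the metric `g_{ij}`. -/
def christoffel (g : EuclideanSpace ℝ ι → Matrix ι ι ℝ) (k i j : ι)
    (y : EuclideanSpace ℝ ι) : ℝ :=
  (1 / 2 : ℝ) * ∑ l, (g y)⁻¹ k l *
    (partialDeriv i (fun z => g z j l) y + partialDeriv j (fun z => g z i l) y
      - partialDeriv l (fun z => g z i j) y)

/-- The Ricci tensor
`R_{jk} = ∂_i Γ^i_{jk} - ∂_j Γ^i_{ik} + Γ^i_{il} Γ^l_{jk} - Γ^i_{jl} Γ^l_{ik}`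
(the sign for which round spheres have positive Ricci curvature). -/
def ricci (g : EuclideanSpace ℝ ι → Matrix ι ι ℝ) (j k : ι) (y : EuclideanSpace ℝ ι) : ℝ :=
  ∑ i, partialDeriv i (christoffel g i j k) y - ∑ i, partialDeriv j (christoffel g i i k) y
    + ∑ i, ∑ l, (christoffel g i i l y * christoffel g l j k y
      - christoffel g i j l y * christoffel g l i k y)

/-- The scalar curvature `R = g^{jk} R_{jk}`. -/
def scalar (g : EuclideanSpace ℝ ι → Matrix ι ι ℝ) (y : EuclideanSpace ℝ ι) : ℝ :=
  ∑ j, ∑ k, (g y)⁻¹ j k * ricci g j k y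

/-- The Laplacian `Δ f = g^{ij} (∂_i ∂_j f - Γ^k_{ij} ∂_k f)`. -/
def coordLaplacian (g : EuclideanSpace ℝ ι → Matrix ι ι ℝ) (f : EuclideanSpace ℝ ι → ℝ)
    (y : EuclideanSpace ℝ ι) : ℝ :=
  ∑ i, ∑ j, (g y)⁻¹ i j *
    (partialDeriv i (partialDeriv j f) y - ∑ k, christoffel g k i j y * partialDeriv k f y)

end Coordinates

/-! ### Riemannian manifolds -/

section Riemannian

variable {ι : Type*} [Fintype ι] [DecidableEq ι]
variable {X : Type*} [TopologicalSpace X] [ChartedSpace (EuclideanSpace ℝ ι) X]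
  [IsManifold 𝓘(ℝ, EuclideanSpace ℝ ι) ∞ X]

variable (ι X) in
/-- Smooth Riemannian metrics on a smooth manifold `X` with charts in `EuclideanSpace ℝ ι`. -/
abbrev RiemannianMetric : Type _ :=
  Bundle.ContMDiffRiemannianMetric (B := X) 𝓘(ℝ, EuclideanSpace ℝ ι) ∞ (EuclideanSpace ℝ ι)
    (fun x : X => TangentSpace 𝓘(ℝ, EuclideanSpace ℝ ι) x)

/-- The coordinate vector field `∂_i` of the chart `φ`, at the point with coordinates `y`. -/
def coordVector (φ : OpenPartialHomeomorph X (EuclideanSpace ℝ ι)) (y : EuclideanSpace ℝ ι)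
    (i : ι) : TangentSpace 𝓘(ℝ, EuclideanSpace ℝ ι) (φ.symm y) :=
  mfderiv 𝓘(ℝ, EuclideanSpace ℝ ι) 𝓘(ℝ, EuclideanSpace ℝ ι) φ.symm y
    (EuclideanSpace.single i (1 : ℝ) : EuclideanSpace ℝ ι)

/-- The matrix `g_{ij}` of the metric in the chart `φ`. -/
def metricMatrix (g : RiemannianMetric ι X) (φ : OpenPartialHomeomorph X (EuclideanSpace ℝ ι))
    (y : EuclideanSpace ℝ ι) : Matrix ι ι ℝ :=
  Matrix.of fun i j => g.inner (φ.symm y) (coordVector φ y i) (coordVector φ y j)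

/-- The Einstein equation `Ric(g) = lam g`, read in all smooth charts. -/
def IsEinstein (g : RiemannianMetric ι X) (lam : ℝ) : Prop :=
  ∀ φ ∈ IsManifold.maximalAtlas 𝓘(ℝ, EuclideanSpace ℝ ι) ∞ X, ∀ y ∈ φ.target, ∀ i j : ι,
    ricci (metricMatrix g φ) i j y = lam * metricMatrix g φ y i j

/-- The scalar curvature of `g` (its value does not depend on the chart; we use the preferred
chart at the point). -/
def scalarCurvature (g : RiemannianMetric ι X) (x : X) : ℝ :=
  scalar (metricMatrix g (chartAt (EuclideanSpace ℝ ι) x)) (chartAt (EuclideanSpace ℝ ι) x x)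

/-- The Laplacian of a function on `X` (its value does not depend on the chart; we use the
preferred chart at the point). -/
def laplacian (g : RiemannianMetric ι X) (f : X → ℝ) (x : X) : ℝ :=
  coordLaplacian (metricMatrix g (chartAt (EuclideanSpace ℝ ι) x))
    (f ∘ (chartAt (EuclideanSpace ℝ ι) x).symm) (chartAt (EuclideanSpace ℝ ι) x x)

/-- A (possibly incomplete) Riemannian manifold without boundary is parabolic if every nonnegative
`C²` function that is bounded above and satisfies `Δ f ≥ 0` is constant. -/
def IsParabolic (g : RiemannianMetric ι X) : Prop :=
  ∀ f : X → ℝ, ContMDiff 𝓘(ℝ, EuclideanSpace ℝ ι) 𝓘(ℝ, ℝ) 2 f → (∀ x, 0 ≤ f x) →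
    BddAbove (Set.range f) → (∀ x, 0 ≤ laplacian g f x) → ∃ c, ∀ x, f x = c

/-- `p : Y → X` is a (smooth) universal covering of `X`. -/
structure IsUniversalCover {Y : Type*} [TopologicalSpace Y]
    [ChartedSpace (EuclideanSpace ℝ ι) Y] [IsManifold 𝓘(ℝ, EuclideanSpace ℝ ι) ∞ Y]
    (p : Y → X) : Prop where
  simplyConnected : SimplyConnectedSpace Y
  isCoveringMap : IsCoveringMap p
  surjective : Function.Surjective p
  isLocalDiffeomorph :
    IsLocalDiffeomorph 𝓘(ℝ, EuclideanSpace ℝ ι) 𝓘(ℝ, EuclideanSpace ℝ ι) ∞ p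

end Riemannian

/-! ### The symmetric space `SL(N, ℝ) / SO(N)` -/

section SymmetricSpace

variable (N : ℕ)

/-- `SO(N)` as a subgroup of `SL(N, ℝ)`. -/
def SO : Subgroup (Matrix.SpecialLinearGroup (Fin N) ℝ) where
  carrier := {g | (g : Matrix (Fin N) (Fin N) ℝ) * (g : Matrix (Fin N) (Fin N) ℝ)ᵀ = 1}
  one_mem' := by simp
  mul_mem' {a b} ha hb := by
    simp only [Set.mem_ofPred_eq, Matrix.SpecialLinearGroup.coe_mul, Matrix.transpose_mul] at *
    rw [Matrix.mul_assoc, ← Matrix.mul_assoc (b : Matrix (Fin N) (Fin N) ℝ), hb, Matrix.one_mul, ha]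
  inv_mem' {a} ha := by
    have h : a⁻¹ = a.transpose := by
      rw [inv_eq_iff_mul_eq_one]
      apply Subtype.ext
      simpa using ha
    simp only [Set.mem_ofPred_eq] at *
    rw [h]
    simpa using mul_eq_one_comm.mp ha

/-- The symmetric space `SL(N, ℝ) / SO(N)`. -/
abbrev SymSpace : Type := Matrix.SpecialLinearGroup (Fin N) ℝ ⧸ SO N

/-- Positive definite symmetric matrices of determinant one. -/
abbrev PosOne : Type := {P : Matrix (Fin N) (Fin N) ℝ // P.PosDef ∧ P.det = 1}

variable {N}

/-- The action `g • P = g P gᵀ` of `SL(N, ℝ)` on positive definite matrices of determinant one. -/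
instance : MulAction (Matrix.SpecialLinearGroup (Fin N) ℝ) (PosOne N) where
  smul g P := ⟨(g : Matrix (Fin N) (Fin N) ℝ) * P.1 * (g : Matrix (Fin N) (Fin N) ℝ)ᵀ, by
    constructor
    · have := P.2.1.mul_mul_conjTranspose_same (B := (g : Matrix (Fin N) (Fin N) ℝ))
        (Matrix.vecMul_injective_of_isUnit (by
          rw [Matrix.isUnit_iff_isUnit_det]; simp))
      simpa using this
    · simp [Matrix.det_mul, P.2.2]⟩
  one_smul P := by ext1; change _ * _ * _ = _; simp
  mul_smul g h P := by
    ext1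
    change (((g * h : Matrix.SpecialLinearGroup (Fin N) ℝ)) : Matrix (Fin N) (Fin N) ℝ) * _ * _
      = (g : Matrix (Fin N) (Fin N) ℝ) * ((h : Matrix (Fin N) (Fin N) ℝ) * _ * _) * _
    simp [Matrix.mul_assoc]

/-- The base point of the space of positive definite matrices of determinant one. -/
def basePosOne : PosOne N := ⟨1, Matrix.PosDef.one, Matrix.det_one⟩

theorem smul_basePosOne (g : Matrix.SpecialLinearGroup (Fin N) ℝ) :
    (g • (basePosOne : PosOne N)).1
      = (g : Matrix (Fin N) (Fin N) ℝ) * (g : Matrix (Fin N) (Fin N) ℝ)ᵀ := by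
  change _ * (1 : Matrix (Fin N) (Fin N) ℝ) * _ = _
  simp

/-- The map `SL(N, ℝ) / SO(N) → {P > 0, det P = 1}`, `g SO(N) ↦ g gᵀ`. -/
def SymSpace.toPos : SymSpace N → PosOne N :=
  Quotient.lift (fun g => g • (basePosOne : PosOne N)) (by
    intro a b hab
    have h : (a⁻¹ * b) ∈ SO N := QuotientGroup.leftRel_apply.mp hab
    have h2 : (a⁻¹ * b) • (basePosOne : PosOne N) = basePosOne := by
      ext1; rw [smul_basePosOne]; exact h
    rw [mul_smul, inv_smul_eq_iff] at h2
    exact h2.symm)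

open scoped MatrixOrder in
theorem SymSpace.toPos_bijective : Function.Bijective (SymSpace.toPos (N := N)) := by
  constructor
  · intro x y
    refine Quotient.inductionOn₂ x y fun a b hab => ?_
    refine Quotient.sound (QuotientGroup.leftRel_apply.mpr ?_)
    have h2 : a • (basePosOne : PosOne N) = b • basePosOne := hab
    have h3 : (a⁻¹ * b) • (basePosOne : PosOne N) = basePosOne := by
      rw [mul_smul, inv_smul_eq_iff, h2]
    have h4 := congrArg Subtype.val h3
    rw [smul_basePosOne] at h4
    exact h4
  · rintro ⟨P, hP, hd⟩
    have hS : (CFC.sqrt P).PosSemidef := Matrix.nonneg_iff_posSemidef.mp (CFC.sqrt_nonneg P)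
    have hdet : (CFC.sqrt P).det = 1 := by
      rw [hP.posSemidef.det_sqrt, hd]; simp
    refine ⟨QuotientGroup.mk ⟨CFC.sqrt P, hdet⟩, ?_⟩
    refine Subtype.ext ((smul_basePosOne _).trans ?_)
    have ht : (CFC.sqrt P)ᵀ = CFC.sqrt P := by simpa using hS.1.eq
    change CFC.sqrt P * (CFC.sqrt P)ᵀ = P
    rw [ht]
    exact CFC.sqrt_mul_sqrt_self P hP.posSemidef.nonneg

/-- The identification of `SL(N, ℝ) / SO(N)` with the positive definite symmetric matrices of
determinant one, `g SO(N) ↦ g gᵀ`. -/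
def symSpaceEquiv : SymSpace N ≃ PosOne N :=
  Equiv.ofBijective SymSpace.toPos SymSpace.toPos_bijective

/-- The value `tr(P⁻¹ S P⁻¹ T)` on tangent vectors `S`, `T` at `P` of the invariant Riemannian
metric of `SL(N, ℝ) / SO(N) = {P > 0, det P = 1}`. -/
def symMetric (P S T : Matrix (Fin N) (Fin N) ℝ) : ℝ := (P⁻¹ * S * P⁻¹ * T).trace

variable {ι : Type*} [Fintype ι]
variable {X : Type*} [TopologicalSpace X] [ChartedSpace (EuclideanSpace ℝ ι) X]

/-- The derivative of a matrix valued function on `X` in the direction `v`, entry by entry. -/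
def matrixDeriv (P : X → Matrix (Fin N) (Fin N) ℝ) (x : X)
    (v : TangentSpace 𝓘(ℝ, EuclideanSpace ℝ ι) x) : Matrix (Fin N) (Fin N) ℝ :=
  Matrix.of fun I J =>
    (mfderiv 𝓘(ℝ, EuclideanSpace ℝ ι) 𝓘(ℝ, ℝ) (fun x' => P x' I J) x v : ℝ)

/-- A map to `SL(N, ℝ) / SO(N)` is smooth if all entries of the corresponding matrix are. -/
def IsSmoothToSymSpace (f : X → SymSpace N) : Prop :=
  ∀ I J, ContMDiff 𝓘(ℝ, EuclideanSpace ℝ ι) 𝓘(ℝ, ℝ) ∞ fun x => (symSpaceEquiv (f x)).1 I J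

/-- The pullback of the Riemannian metric of `SL(N, ℝ) / SO(N)` under a map `f`, evaluated on the
tangent vectors `v` and `w` at `x`. -/
def pullbackSymMetric (f : X → SymSpace N) (x : X)
    (v w : TangentSpace 𝓘(ℝ, EuclideanSpace ℝ ι) x) : ℝ :=
  symMetric (symSpaceEquiv (f x)).1
    (matrixDeriv (fun x' => (symSpaceEquiv (f x')).1) x v)
    (matrixDeriv (fun x' => (symSpaceEquiv (f x')).1) x w)

end SymmetricSpace

/-! ### Twisted principal bundles with abelian structure group -/

section TwistedBundles

variable {n N : ℕ}
variable {𝒢 : Type*} [AddCommGroup 𝒢] [TopologicalSpace 𝒢]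
  [ChartedSpace (EuclideanSpace ℝ (Fin N)) 𝒢]
variable {B : Type*} [TopologicalSpace B] [ChartedSpace (EuclideanSpace ℝ (Fin n)) B]
variable {M : Type*} [TopologicalSpace M] [ChartedSpace (EuclideanSpace ℝ (Fin N ⊕ Fin n)) M]

variable (n N 𝒢 B M) in
/-- A smooth fiber bundle `M → B` with fiber the abelian Lie group `𝒢`, associated to a principal
bundle with structure group `𝒢 ⋊ Aut(𝒢)_δ`: it has local trivializations, smooth in both
directions, whose transition functions are `x ↦ s + φ x` with a locally constant automorphism
`φ` of `𝒢` and a function `s` with values in `𝒢`. -/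
structure TwistedBundle where
  proj : M → B
  atlas : Set (Bundle.Trivialization 𝒢 proj)
  smooth_toFun : ∀ t ∈ atlas, ContMDiffOn 𝓘(ℝ, EuclideanSpace ℝ (Fin N ⊕ Fin n))
    (𝓘(ℝ, EuclideanSpace ℝ (Fin n)).prod 𝓘(ℝ, EuclideanSpace ℝ (Fin N))) ∞ t t.source
  smooth_invFun : ∀ t ∈ atlas, ContMDiffOn
    (𝓘(ℝ, EuclideanSpace ℝ (Fin n)).prod 𝓘(ℝ, EuclideanSpace ℝ (Fin N)))
    𝓘(ℝ, EuclideanSpace ℝ (Fin N ⊕ Fin n)) ∞ t.toOpenPartialHomeomorph.symm t.target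
  cover : ∀ b, ∃ t ∈ atlas, b ∈ t.baseSet
  transition : ∀ t ∈ atlas, ∀ t' ∈ atlas, ∀ b ∈ t.baseSet ∩ t'.baseSet,
    ∃ φ : 𝒢 ≃ₜ+ 𝒢, ∀ᶠ b' in 𝓝 b, ∃ s : 𝒢, ∀ x : 𝒢,
      t' (t.toOpenPartialHomeomorph.symm (b', x)) = (b', s + φ x)

namespace TwistedBundle

variable (P : TwistedBundle n N 𝒢 B M)

/-- A trivialization around `b`. -/
def trivAt (b : B) : Bundle.Trivialization 𝒢 P.proj := (P.cover b).choose

theorem trivAt_mem (b : B) : P.trivAt b ∈ P.atlas := (P.cover b).choose_spec.1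

theorem mem_baseSet_trivAt (b : B) : b ∈ (P.trivAt b).baseSet := (P.cover b).choose_spec.2

variable {P} in
/-- The local action on `M` of the element `a` of `𝒢`, in the trivialization `t`. -/
def translate (t : Bundle.Trivialization 𝒢 P.proj) (a : 𝒢) (m : M) : M :=
  t.toOpenPartialHomeomorph.symm ((t m).1, (t m).2 + a)

/-- The local actions of `𝒢` on `M` are isometric for `gbar`. -/
def IsInvariant [IsManifold 𝓘(ℝ, EuclideanSpace ℝ (Fin N ⊕ Fin n)) ∞ M]
    (gbar : RiemannianMetric (Fin N ⊕ Fin n) M) : Prop :=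
  ∀ t ∈ P.atlas, ∀ a : 𝒢, ∀ m ∈ t.source,
    ∀ v w : TangentSpace 𝓘(ℝ, EuclideanSpace ℝ (Fin N ⊕ Fin n)) m,
      gbar.inner (translate t a m)
        (mfderiv 𝓘(ℝ, EuclideanSpace ℝ (Fin N ⊕ Fin n)) 𝓘(ℝ, EuclideanSpace ℝ (Fin N ⊕ Fin n))
          (translate t a) m v)
        (mfderiv 𝓘(ℝ, EuclideanSpace ℝ (Fin N ⊕ Fin n)) 𝓘(ℝ, EuclideanSpace ℝ (Fin N ⊕ Fin n))
          (translate t a) m w)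
      = gbar.inner m v w

/-- The differential of the projection `M → B`. -/
def dproj (m : M) (v : TangentSpace 𝓘(ℝ, EuclideanSpace ℝ (Fin N ⊕ Fin n)) m) :
    TangentSpace 𝓘(ℝ, EuclideanSpace ℝ (Fin n)) (P.proj m) :=
  mfderiv 𝓘(ℝ, EuclideanSpace ℝ (Fin N ⊕ Fin n)) 𝓘(ℝ, EuclideanSpace ℝ (Fin n)) P.proj m v

/-- `g` is the metric on the base induced by `gbar`: on vectors orthogonal to the fibers, `gbar`
is the pullback of `g`. -/
def IsBaseMetric [IsManifold 𝓘(ℝ, EuclideanSpace ℝ (Fin N ⊕ Fin n)) ∞ M]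
    [IsManifold 𝓘(ℝ, EuclideanSpace ℝ (Fin n)) ∞ B]
    (gbar : RiemannianMetric (Fin N ⊕ Fin n) M) (g : RiemannianMetric (Fin n) B) : Prop :=
  ∀ (m : M) (v w : TangentSpace 𝓘(ℝ, EuclideanSpace ℝ (Fin N ⊕ Fin n)) m),
    (∀ u, P.dproj m u = 0 → gbar.inner m v u = 0) →
    (∀ u, P.dproj m u = 0 → gbar.inner m w u = 0) →
    gbar.inner m v w = g.inner (P.proj m) (P.dproj m v) (P.dproj m w)

variable (N 𝒢) in
/-- The Lie algebra of `𝒢`, as the tangent space at zero. -/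
abbrev LieAlg : Type := TangentSpace 𝓘(ℝ, EuclideanSpace ℝ (Fin N)) (0 : 𝒢)

variable {P}

/-- The value at the point `(b, 0)` of the trivialization `t` of the vertical vector field
on `M` generated by the element `ξ` of the Lie algebra. -/
def vertical (t : Bundle.Trivialization 𝒢 P.proj) (b : B) (ξ : LieAlg N 𝒢) :
    TangentSpace 𝓘(ℝ, EuclideanSpace ℝ (Fin N ⊕ Fin n)) (t.toOpenPartialHomeomorph.symm (b, 0)) :=
  mfderiv 𝓘(ℝ, EuclideanSpace ℝ (Fin N)) 𝓘(ℝ, EuclideanSpace ℝ (Fin N ⊕ Fin n))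
    (fun x : 𝒢 => t.toOpenPartialHomeomorph.symm (b, x)) 0 ξ

/-- The inner product on the fiber at `b` of the flat bundle `e`, read in the trivialization `t`,
which identifies this fiber with the Lie algebra. -/
def fiberInner [IsManifold 𝓘(ℝ, EuclideanSpace ℝ (Fin N ⊕ Fin n)) ∞ M]
    (gbar : RiemannianMetric (Fin N ⊕ Fin n) M) (t : Bundle.Trivialization 𝒢 P.proj) (b : B)
    (ξ η : LieAlg N 𝒢) : ℝ :=
  gbar.inner (t.toOpenPartialHomeomorph.symm (b, 0)) (vertical t b ξ) (vertical t b η)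

/-- The local expression `(G_{IJ})` of the inner product on `e` in the trivialization `t`. -/
def localG [IsManifold 𝓘(ℝ, EuclideanSpace ℝ (Fin N ⊕ Fin n)) ∞ M]
    (gbar : RiemannianMetric (Fin N ⊕ Fin n) M) (t : Bundle.Trivialization 𝒢 P.proj) (b : B) :
    Matrix (Fin N) (Fin N) ℝ :=
  Matrix.of fun I J => fiberInner gbar t b
    (EuclideanSpace.single I (1 : ℝ) : EuclideanSpace ℝ (Fin N))
    (EuclideanSpace.single J (1 : ℝ) : EuclideanSpace ℝ (Fin N))

/-- The differential at `x` of a map from `𝒢` to itself, in terms of the model space (for an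
automorphism of `𝒢` and `x = 0`, this is an endomorphism of the Lie algebra). -/
def groupDeriv (f : 𝒢 → 𝒢) (x : 𝒢) : EuclideanSpace ℝ (Fin N) →L[ℝ] EuclideanSpace ℝ (Fin N) :=
  mfderiv 𝓘(ℝ, EuclideanSpace ℝ (Fin N)) 𝓘(ℝ, EuclideanSpace ℝ (Fin N)) f x

/-- The coordinate change at `b`, from `t` to `t'`, of the flat vector bundle `e` with
fiber the Lie algebra of `𝒢`: the differential at `0` of the automorphism `φ` in the transition
function `x ↦ s + φ x`. -/
def coordChange (t t' : Bundle.Trivialization 𝒢 P.proj) (b : B) :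
    LieAlg N 𝒢 →L[ℝ] LieAlg N 𝒢 :=
  groupDeriv (fun x : 𝒢 => (t' (t.toOpenPartialHomeomorph.symm (b, x))).2
    - (t' (t.toOpenPartialHomeomorph.symm (b, 0))).2) 0

variable (P) in
/-- A global frame of flat (that is, locally constant) sections of the pullback `p^* e` of the flat
vector bundle `e`, where `p : Y → B`. The `I`-th section has at `y` the component
`frame t y I` in the trivialization `t`. -/
structure ParallelFrame {Y : Type*} [TopologicalSpace Y] (p : Y → B) where
  frame : Bundle.Trivialization 𝒢 P.proj → Y → Fin N → LieAlg N 𝒢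
  compatible : ∀ t ∈ P.atlas, ∀ t' ∈ P.atlas, ∀ y, p y ∈ t.baseSet ∩ t'.baseSet → ∀ I,
    frame t' y I = coordChange t t' (p y) (frame t y I)
  locallyConstant : ∀ t ∈ P.atlas, ∀ y, p y ∈ t.baseSet → ∀ᶠ y' in 𝓝 y, frame t y' = frame t y
  linearIndependent : ∀ t ∈ P.atlas, ∀ y, p y ∈ t.baseSet → LinearIndependent ℝ (frame t y)

theorem mem_target {t : Bundle.Trivialization 𝒢 P.proj} {b : B} (hb : b ∈ t.baseSet) (x : 𝒢) :
    (b, x) ∈ t.target := by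
  rw [t.target_eq]; exact ⟨hb, Set.mem_univ _⟩

theorem fiberInner_comb [IsManifold 𝓘(ℝ, EuclideanSpace ℝ (Fin N ⊕ Fin n)) ∞ M]
    (gbar : RiemannianMetric (Fin N ⊕ Fin n) M) (t : Bundle.Trivialization 𝒢 P.proj) (b : B)
    (a c : Fin N → ℝ) (u v : Fin N → LieAlg N 𝒢) :
    fiberInner gbar t b (∑ i, a i • u i) (∑ j, c j • v j)
      = ∑ i, ∑ j, a i * c j * fiberInner gbar t b (u i) (v j) := by
  simp only [fiberInner, vertical, map_sum, map_smul, _root_.sum_apply,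
    _root_.smul_apply, smul_eq_mul, Finset.mul_sum, mul_assoc]
  rw [Finset.sum_comm]
  exact Finset.sum_congr rfl fun i _ => Finset.sum_congr rfl fun j _ => by ring

theorem contMDiff_fiberIncl {t : Bundle.Trivialization 𝒢 P.proj} (ht : t ∈ P.atlas) {b : B}
    (hb : b ∈ t.baseSet) :
    ContMDiff 𝓘(ℝ, EuclideanSpace ℝ (Fin N)) 𝓘(ℝ, EuclideanSpace ℝ (Fin N ⊕ Fin n)) ∞
      (fun x : 𝒢 => t.toOpenPartialHomeomorph.symm (b, x)) := by
  have h2 : ContMDiff 𝓘(ℝ, EuclideanSpace ℝ (Fin N))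
      (𝓘(ℝ, EuclideanSpace ℝ (Fin n)).prod 𝓘(ℝ, EuclideanSpace ℝ (Fin N))) ∞
      (fun x : 𝒢 => (b, x)) := contMDiff_const.prodMk contMDiff_id
  have h3 := (P.smooth_invFun t ht).comp (s := Set.univ) h2.contMDiffOn
    (fun x _ => mem_target hb x)
  exact contMDiffOn_univ.mp h3

theorem contMDiff_fiberTransition {t t' : Bundle.Trivialization 𝒢 P.proj} (ht : t ∈ P.atlas)
    (ht' : t' ∈ P.atlas) {b : B} (hb : b ∈ t.baseSet) (hb' : b ∈ t'.baseSet) :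
    ContMDiff 𝓘(ℝ, EuclideanSpace ℝ (Fin N)) 𝓘(ℝ, EuclideanSpace ℝ (Fin N)) ∞
      (fun x : 𝒢 => (t' (t.toOpenPartialHomeomorph.symm (b, x))).2) := by
  have h3 := (P.smooth_toFun t' ht').comp (s := Set.univ) (contMDiff_fiberIncl ht hb).contMDiffOn
    (fun x _ => by
      rw [Set.mem_preimage, t'.mem_source, t.proj_symm_apply (mem_target hb x)]
      exact hb')
  exact (contMDiff_snd (I := 𝓘(ℝ, EuclideanSpace ℝ (Fin n)))).comp (contMDiffOn_univ.mp h3)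

theorem vertical_injective {t : Bundle.Trivialization 𝒢 P.proj} (ht : t ∈ P.atlas) {b : B}
    (hb : b ∈ t.baseSet) : Function.Injective (vertical (M := M) t b) := by
  have hj : MDifferentiableAt 𝓘(ℝ, EuclideanSpace ℝ (Fin N))
      𝓘(ℝ, EuclideanSpace ℝ (Fin N ⊕ Fin n))
      (fun x : 𝒢 => t.toOpenPartialHomeomorph.symm (b, x)) 0 :=
    (contMDiff_fiberIncl ht hb).mdifferentiable (by simp) 0
  have hs : t.toOpenPartialHomeomorph.symm (b, 0) ∈ t.source :=
    t.toOpenPartialHomeomorph.map_target (mem_target hb 0)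
  have hh : MDifferentiableAt 𝓘(ℝ, EuclideanSpace ℝ (Fin N ⊕ Fin n))
      𝓘(ℝ, EuclideanSpace ℝ (Fin N))
      (fun m : M => (t m).2) (t.toOpenPartialHomeomorph.symm (b, 0)) := by
    have h1 : ContMDiffAt 𝓘(ℝ, EuclideanSpace ℝ (Fin N ⊕ Fin n))
      (𝓘(ℝ, EuclideanSpace ℝ (Fin n)).prod 𝓘(ℝ, EuclideanSpace ℝ (Fin N))) ∞ t
      (t.toOpenPartialHomeomorph.symm (b, 0)) :=
      (P.smooth_toFun t ht).contMDiffAt (t.open_source.mem_nhds hs)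
    exact (h1.snd).mdifferentiableAt (by simp)
  have hc := mfderiv_comp (x := (0 : 𝒢)) (I'' := 𝓘(ℝ, EuclideanSpace ℝ (Fin N))) hh hj
  have hid : ((fun m : M => (t m).2) ∘ fun x : 𝒢 => t.toOpenPartialHomeomorph.symm (b, x)) = id := by
    funext x
    simp [t.apply_symm_apply (mem_target hb x)]
  rw [hid, mfderiv_id] at hc
  intro ξ η h
  have h1 := DFunLike.congr_fun hc ξ
  have h2 := DFunLike.congr_fun hc η
  have h3 := congrArg (mfderiv 𝓘(ℝ, EuclideanSpace ℝ (Fin N ⊕ Fin n))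
    𝓘(ℝ, EuclideanSpace ℝ (Fin N)) (fun m : M => (t m).2)
    (t.toOpenPartialHomeomorph.symm (b, 0))) h
  exact h1.trans (h3.trans h2.symm)

namespace ParallelFrame

variable {Y : Type*} [TopologicalSpace Y] {p : Y → B} (τ : P.ParallelFrame p)

/-- The matrix `(G_{IJ})` of the inner product of `p^* e` in a parallel frame. -/
def gram [IsManifold 𝓘(ℝ, EuclideanSpace ℝ (Fin N ⊕ Fin n)) ∞ M]
    (gbar : RiemannianMetric (Fin N ⊕ Fin n) M) (y : Y) : Matrix (Fin N) (Fin N) ℝ :=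
  Matrix.of fun I J => fiberInner gbar (P.trivAt (p y)) (p y)
    (τ.frame (P.trivAt (p y)) y I) (τ.frame (P.trivAt (p y)) y J)

/-- A parallel frame at `y`, as a basis of the Lie algebra (with which the fiber of `e` at `p y` is
identified by a trivialization). -/
def basisAt [NeZero N] (y : Y) : Module.Basis (Fin N) ℝ (LieAlg N 𝒢) :=
  basisOfLinearIndependentOfCardEqFinrank
    (τ.linearIndependent _ (P.trivAt_mem (p y)) y (P.mem_baseSet_trivAt (p y)))
    (by change _ = Module.finrank ℝ (EuclideanSpace ℝ (Fin N)); simp)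

/-- For `p y = p y'`, the holonomy of `e` along the image under `p` of a path from `y` to `y'`, as
a matrix in the basis `frame y`: parallel transport takes `frame y J` to `frame y' J`. -/
def holonomy [NeZero N] (y y' : Y) : Matrix (Fin N) (Fin N) ℝ :=
  (τ.basisAt y).toMatrix (τ.frame (P.trivAt (p y)) y')

/-- The holonomy of the flat bundle `e` lies in `det⁻¹(±1)`, where `p` is a universal
covering. -/
def HasUnimodularHolonomy [NeZero N] : Prop :=
  ∀ y y', p y = p y' → (τ.holonomy y y').det = 1 ∨ (τ.holonomy y y').det = -1

theorem gram_posDef [IsManifold 𝓘(ℝ, EuclideanSpace ℝ (Fin N ⊕ Fin n)) ∞ M]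
    (gbar : RiemannianMetric (Fin N ⊕ Fin n) M) (y : Y) : (τ.gram gbar y).PosDef := by
  have hli := τ.linearIndependent _ (P.trivAt_mem (p y)) y (P.mem_baseSet_trivAt (p y))
  have hv := vertical_injective (P.trivAt_mem (p y)) (P.mem_baseSet_trivAt (p y))
  refine Matrix.PosDef.of_dotProduct_mulVec_pos ?_ ?_
  · ext I J
    simp only [gram, fiberInner, Matrix.conjTranspose_apply, Matrix.of_apply, star_trivial]
    exact gbar.symm _ _ _
  · intro c hc
    have key : star c ⬝ᵥ (τ.gram gbar y).mulVec c
        = fiberInner gbar (P.trivAt (p y)) (p y)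
          (∑ i, c i • τ.frame (P.trivAt (p y)) y i) (∑ i, c i • τ.frame (P.trivAt (p y)) y i) := by
      rw [fiberInner_comb]
      simp only [dotProduct, Matrix.mulVec, gram, Matrix.of_apply, Finset.mul_sum, star_trivial]
      refine Finset.sum_congr rfl fun i _ => Finset.sum_congr rfl fun j _ => by ring
    rw [key]
    refine gbar.pos _ _ fun h0 => hc ?_
    have h1 : (∑ i, c i • τ.frame (P.trivAt (p y)) y i) = 0 := by
      apply hv
      rw [h0]
      simp [vertical]
    funext i
    exact Fintype.linearIndependent_iff.mp hli c h1 i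

theorem normalized_mem [NeZero N] {A : Matrix (Fin N) (Fin N) ℝ} (hA : A.PosDef) :
    ((A.det ^ (-(1 / N : ℝ))) • A).PosDef ∧ ((A.det ^ (-(1 / N : ℝ))) • A).det = 1 := by
  have hd := hA.det_pos
  refine ⟨hA.smul (Real.rpow_pos_of_pos hd _), ?_⟩
  have hN : (N : ℝ) ≠ 0 := Nat.cast_ne_zero.mpr (NeZero.ne N)
  rw [Matrix.det_smul, Fintype.card_fin, ← Real.rpow_natCast, ← Real.rpow_mul hd.le]
  have : -(1 / N : ℝ) * N = -1 := by field_simp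
  rw [this, Real.rpow_neg_one, inv_mul_cancel₀ hd.ne']

/-- The map `Y → SL(N, ℝ) / SO(N)` defined by the inner product `G` of `e`: the matrix of `G` in
a parallel frame on the universal cover, normalized to have determinant one. -/
def developingMap [NeZero N] [IsManifold 𝓘(ℝ, EuclideanSpace ℝ (Fin N ⊕ Fin n)) ∞ M]
    (gbar : RiemannianMetric (Fin N ⊕ Fin n) M) (y : Y) : SymSpace N :=
  symSpaceEquiv.symm ⟨((τ.gram gbar y).det ^ (-(1 / N : ℝ))) • τ.gram gbar y,
    normalized_mem (τ.gram_posDef gbar y)⟩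

/-- Equivariance of the matrix of `G` under the holonomy. -/
theorem gram_equivariant [NeZero N] [IsManifold 𝓘(ℝ, EuclideanSpace ℝ (Fin N ⊕ Fin n)) ∞ M]
    (gbar : RiemannianMetric (Fin N ⊕ Fin n) M) {y y' : Y} (h : p y = p y') :
    τ.gram gbar y' = (τ.holonomy y y')ᵀ * τ.gram gbar y * τ.holonomy y y' := by
  have hb : ∀ J, τ.frame (P.trivAt (p y)) y' J
      = ∑ I, τ.holonomy y y' I J • τ.frame (P.trivAt (p y)) y I := by
    intro J
    have := (τ.basisAt y).sum_toMatrix_smul_self (τ.frame (P.trivAt (p y)) y') J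
    simpa [holonomy, basisAt] using this.symm
  ext I J
  have : τ.gram gbar y' I J = fiberInner gbar (P.trivAt (p y)) (p y)
      (τ.frame (P.trivAt (p y)) y' I) (τ.frame (P.trivAt (p y)) y' J) := by
    simp only [gram, Matrix.of_apply]
    rw [h]
  rw [this, hb I, hb J, fiberInner_comb]
  simp only [Matrix.mul_apply, Matrix.transpose_apply, gram, Matrix.of_apply, Finset.sum_mul]
  rw [Finset.sum_comm]
  refine Finset.sum_congr rfl fun i _ => Finset.sum_congr rfl fun j _ => by ring

end ParallelFrame

theorem coordChange_eq {t t' : Bundle.Trivialization 𝒢 P.proj} {b : B} {φ : 𝒢 ≃ₜ+ 𝒢} {s : 𝒢}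
    (h : ∀ x : 𝒢, t' (t.toOpenPartialHomeomorph.symm (b, x)) = (b, s + φ x)) :
    coordChange t t' b = groupDeriv φ 0 := by
  have h2 : (fun x : 𝒢 => (t' (t.toOpenPartialHomeomorph.symm (b, x))).2
      - (t' (t.toOpenPartialHomeomorph.symm (b, 0))).2) = φ := by
    funext x
    simp [h]
  exact congrArg (fun f : 𝒢 → 𝒢 => groupDeriv f 0) h2

theorem eventually_coordChange_eq {t t' : Bundle.Trivialization 𝒢 P.proj} (ht : t ∈ P.atlas)
    (ht' : t' ∈ P.atlas) {b : B} (hb : b ∈ t.baseSet ∩ t'.baseSet) :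
    ∀ᶠ b' in 𝓝 b, coordChange t t' b' = coordChange t t' b := by
  obtain ⟨φ, hφ⟩ := P.transition t ht t' ht' b hb
  obtain ⟨s, hs⟩ := hφ.self_of_nhds
  filter_upwards [hφ] with b' ⟨s', hs'⟩
  rw [coordChange_eq hs, coordChange_eq hs']

theorem coordChange_self {t : Bundle.Trivialization 𝒢 P.proj} {b : B} (hb : b ∈ t.baseSet)
    (v : LieAlg N 𝒢) : coordChange t t b v = v := by
  rw [coordChange_eq (φ := ContinuousAddEquiv.refl 𝒢) (s := 0)]
  · change mfderiv _ _ (id : 𝒢 → 𝒢) 0 v = v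
    rw [mfderiv_id]; rfl
  · intro x
    rw [t.apply_symm_apply (mem_target hb x)]
    simp

theorem coordChange_comp [LieAddGroup 𝓘(ℝ, EuclideanSpace ℝ (Fin N)) ∞ 𝒢]
    {t t' t'' : Bundle.Trivialization 𝒢 P.proj} (ht : t ∈ P.atlas) (ht' : t' ∈ P.atlas)
    (ht'' : t'' ∈ P.atlas) {b : B} (hb : b ∈ t.baseSet) (hb' : b ∈ t'.baseSet)
    (hb'' : b ∈ t''.baseSet) (v : LieAlg N 𝒢) :
    coordChange t' t'' b (coordChange t t' b v) = coordChange t t'' b v := by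
  obtain ⟨φ₁, h₁⟩ := P.transition t ht t' ht' b ⟨hb, hb'⟩
  obtain ⟨φ₂, h₂⟩ := P.transition t' ht' t'' ht'' b ⟨hb', hb''⟩
  obtain ⟨φ₃, h₃⟩ := P.transition t ht t'' ht'' b ⟨hb, hb''⟩
  obtain ⟨s₁, h₁⟩ := h₁.self_of_nhds
  obtain ⟨s₂, h₂⟩ := h₂.self_of_nhds
  obtain ⟨s₃, h₃⟩ := h₃.self_of_nhds
  have hx : ∀ x, s₃ + φ₃ x = s₂ + φ₂ (s₁ + φ₁ x) := by
    intro x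
    have e1 : t'.toOpenPartialHomeomorph.symm (b, s₁ + φ₁ x)
        = t.toOpenPartialHomeomorph.symm (b, x) := by
      rw [← h₁ x]
      refine t'.toOpenPartialHomeomorph.left_inv ?_
      rw [t'.mem_source, t.proj_symm_apply (mem_target hb x)]
      exact hb'
    have e2 := h₂ (s₁ + φ₁ x)
    rw [e1, h₃ x] at e2
    exact congrArg Prod.snd e2
  have hfun : (φ₃ : 𝒢 → 𝒢) = φ₂ ∘ φ₁ := by
    funext x
    have h0 := hx 0
    have hx' := hx x
    simp only [map_zero, map_add, add_zero] at h0 hx'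
    rw [h0] at hx'
    simpa [add_assoc] using hx'
  have smooth : ∀ {u u' : Bundle.Trivialization 𝒢 P.proj} {φ : 𝒢 ≃ₜ+ 𝒢} {s : 𝒢}, u ∈ P.atlas →
      u' ∈ P.atlas → b ∈ u.baseSet → b ∈ u'.baseSet →
      (∀ x : 𝒢, u' (u.toOpenPartialHomeomorph.symm (b, x)) = (b, s + φ x)) →
      MDifferentiable 𝓘(ℝ, EuclideanSpace ℝ (Fin N)) 𝓘(ℝ, EuclideanSpace ℝ (Fin N)) φ := by
    intro u u' φ s hu hu' hbu hbu' h
    have := (contMDiff_fiberTransition hu hu' hbu hbu').sub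
      (contMDiff_const (c := s) (I := 𝓘(ℝ, EuclideanSpace ℝ (Fin N))))
    have e : (fun x : 𝒢 => (u' (u.toOpenPartialHomeomorph.symm (b, x))).2 - s) = φ := by
      funext x; simp [h]
    rw [e] at this
    exact this.mdifferentiable (by simp)
  have d1 := smooth ht ht' hb hb' h₁
  have d2 := smooth ht' ht'' hb' hb'' h₂
  rw [coordChange_eq h₁, coordChange_eq h₂, coordChange_eq h₃]
  have hc := mfderiv_comp (x := (0 : 𝒢)) (d2 _) (d1 0)
  have h4 := congrArg (fun f : 𝒢 → 𝒢 => (groupDeriv f 0 :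
    EuclideanSpace ℝ (Fin N) →L[ℝ] EuclideanSpace ℝ (Fin N)) v) hfun
  have h5 := congrArg (fun x : 𝒢 => (groupDeriv φ₂ x :
    EuclideanSpace ℝ (Fin N) →L[ℝ] EuclideanSpace ℝ (Fin N))) (map_zero φ₁)
  refine Eq.trans ?_ h4.symm
  refine Eq.trans ?_ (DFunLike.congr_fun hc v).symm
  exact (DFunLike.congr_fun h5 _).symm

/-- Parallel frames exist over simply connected spaces. -/
theorem exists_parallelFrame [LieAddGroup 𝓘(ℝ, EuclideanSpace ℝ (Fin N)) ∞ 𝒢]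
    {Y : Type*} [TopologicalSpace Y] [SimplyConnectedSpace Y] [LocallyPathConnectedSpace Y]
    {p : Y → B} (hp : Continuous p) : Nonempty (P.ParallelFrame p) := by
  classical
  let F : Type := {u : Fin N → LieAlg N 𝒢 // LinearIndependent ℝ u}
  let _ : TopologicalSpace F := ⊥
  have : DiscreteTopology F := ⟨rfl⟩
  have inj : ∀ (i j : P.atlas) (y : Y), p y ∈ i.1.baseSet → p y ∈ j.1.baseSet →
      LinearMap.ker (coordChange i.1 j.1 (p y)).toLinearMap = ⊥ := by
    intro i j y hi hj
    refine LinearMap.ker_eq_bot.mpr (Function.LeftInverse.injective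
      (g := coordChange j.1 i.1 (p y)) fun v => ?_)
    change coordChange j.1 i.1 (p y) (coordChange i.1 j.1 (p y) v) = v
    rw [coordChange_comp i.2 j.2 i.2 hi hj hi, coordChange_self hi]
  let cc : P.atlas → P.atlas → Y → F → F := fun i j y u =>
    if h : LinearMap.ker (coordChange i.1 j.1 (p y)).toLinearMap = ⊥ then
      ⟨fun I => coordChange i.1 j.1 (p y) (u.1 I), u.2.map' _ h⟩ else u
  have cc_val : ∀ (i j : P.atlas) (y : Y), p y ∈ i.1.baseSet → p y ∈ j.1.baseSet → ∀ u I,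
      (cc i j y u).1 I = coordChange i.1 j.1 (p y) (u.1 I) := by
    intro i j y hi hj u I
    simp only [cc, dif_pos (inj i j y hi hj)]
  let Z : FiberBundleCore P.atlas Y F :=
    { baseSet := fun i => p ⁻¹' i.1.baseSet
      isOpen_baseSet := fun i => i.1.open_baseSet.preimage hp
      indexAt := fun y => ⟨P.trivAt (p y), P.trivAt_mem (p y)⟩
      mem_baseSet_at := fun y => P.mem_baseSet_trivAt (p y)
      coordChange := cc
      coordChange_self := by
        intro i y hy u
        ext1; funext I
        rw [cc_val i i y hy hy, coordChange_self hy]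
      continuousOn_coordChange := by
        intro i j
        rintro ⟨y, u⟩ ⟨⟨hi, hj⟩, -⟩
        refine ContinuousAt.continuousWithinAt ?_
        have e1 : ∀ᶠ y' in 𝓝 y, coordChange i.1 j.1 (p y') = coordChange i.1 j.1 (p y) :=
          hp.continuousAt.eventually (eventually_coordChange_eq i.2 j.2 ⟨hi, hj⟩)
        have e2 : ∀ᶠ q : Y × F in 𝓝 (y, u), cc i j q.1 q.2 = cc i j y u := by
          have e3 : ∀ᶠ q : Y × F in 𝓝 (y, u), q.2 = u :=
            continuousAt_snd.eventually (f := Prod.snd) (p := fun w => w = u)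
              (by simp)
          filter_upwards [continuousAt_fst.eventually e1, e3] with q hq hu
          simp only [cc, hu, hq]
        exact (continuousAt_const (y := cc i j y u)).congr (e2.mono fun _ h => h.symm)
      coordChange_comp := by
        rintro i j k y ⟨⟨hi, hj⟩, hk⟩ u
        ext1; funext I
        rw [cc_val j k y hj hk, cc_val i j y hi hj, cc_val i k y hi hk,
          coordChange_comp i.2 j.2 k.2 hi hj hk] }
  have hcov : IsCoveringMap (Bundle.TotalSpace.proj : Bundle.TotalSpace F Z.Fiber → Y) :=
    FiberBundle.isCoveringMap
  obtain ⟨y₀⟩ : Nonempty Y := inferInstance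
  let u₀ : F := ⟨fun I => (EuclideanSpace.single I (1 : ℝ) : EuclideanSpace ℝ (Fin N)), by
    have h := (EuclideanSpace.basisFun (Fin N) ℝ).toBasis.linearIndependent
    have e : ((EuclideanSpace.basisFun (Fin N) ℝ).toBasis : Fin N → EuclideanSpace ℝ (Fin N))
        = fun I => EuclideanSpace.single I (1 : ℝ) := by
      funext I; simp
    rw [e] at h
    exact h⟩
  obtain ⟨σ, ⟨-, hσ⟩, -⟩ := hcov.existsUnique_continuousMap_lifts (ContinuousMap.id Y) y₀
    (⟨y₀, u₀⟩ : Bundle.TotalSpace F Z.Fiber) rfl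
  have hσ' : ∀ y, (σ y).proj = y := fun y => congrFun hσ y
  let comp : P.atlas → Y → F := fun i y => (Z.localTriv i (σ y)).2
  let w : Y → F := fun y => (σ y).2
  have hcomp : ∀ (i : P.atlas) (y : Y), p y ∈ i.1.baseSet → ∀ I,
      (comp i y).1 I = coordChange (P.trivAt (p y)) i.1 (p y) ((w y).1 I) := by
    intro i y hy I
    have e : comp i y = cc ⟨P.trivAt (p (σ y).proj), P.trivAt_mem _⟩ i (σ y).proj (w y) := rfl
    rw [e, cc_val]
    · rw [hσ' y]
    · exact P.mem_baseSet_trivAt _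
    · rw [hσ' y]; exact hy
  refine ⟨⟨fun t y => if h : t ∈ P.atlas then (comp ⟨t, h⟩ y).1 else 0, ?_, ?_, ?_⟩⟩
  · intro t ht t' ht' y hy I
    simp only [dif_pos ht, dif_pos ht']
    rw [hcomp ⟨t, ht⟩ y hy.1, hcomp ⟨t', ht'⟩ y hy.2,
      coordChange_comp (P.trivAt_mem (p y)) ht ht' (P.mem_baseSet_trivAt (p y)) hy.1 hy.2]
  · intro t ht y hy
    have hcont : ContinuousAt (comp ⟨t, ht⟩) y := by
      have hs : σ y ∈ (Z.localTriv ⟨t, ht⟩).source := by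
        rw [(Z.localTriv ⟨t, ht⟩).mem_source]
        change p (σ y).proj ∈ t.baseSet
        rw [hσ' y]; exact hy
      exact continuousAt_snd.comp
        (((Z.localTriv ⟨t, ht⟩).continuousAt hs).comp σ.continuous.continuousAt)
    have h2 : ∀ᶠ y' in 𝓝 y, comp ⟨t, ht⟩ y' = comp ⟨t, ht⟩ y :=
      hcont.eventually (p := fun w => w = comp ⟨t, ht⟩ y) (by simp)
    filter_upwards [h2] with y' hy'
    simp only [dif_pos ht, hy']
  · intro t ht y _
    simp only [dif_pos ht]
    exact (comp ⟨t, ht⟩ y).2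

end TwistedBundle

end TwistedBundles

end EinsteinCollapse

set_option linter.unusedSectionVars false

/-! The volume density `√(det G)` of the fibers is shown to be constant; this is the equality case
of an inequality, and in that case the base part of the Einstein equation is the assertion.

In coordinates made of a local trivialization, a chart of `B` and a canonical chart of the group
(one adapted to the invariant vector fields), invariance makes the coefficients `G`, `A`, `g`
functions of the base point alone (`exists_canonicalChart`, `pullInner_adaptedChart`,
`localEinstein_connMatrix`). Tracing the Einstein equation over the fiber directions gives Δ√det G =
√det G · (-Nλ + |F|²), where |F|² ≥ 0 is a suitably normalized square of the curvature of the
connection `A` (`laplacian_sqrt_det_surface`). For λ ≤ 0 the right side is nonnegative. Unimodular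
holonomy lets √det G descend to `B`, where it is bounded, nonnegative and subharmonic, hence
constant by parabolicity (`exists_volumeDensity_eq_const`).

Constancy forces λ = 0 and F = 0 (`eq_zero_of_laplacian_eq_zero`). Locally A = dq, so translating
the fiber coordinates by q removes `A`, and the Einstein equation along the base reads 0 = Ric(g) -
(1/4) tr(G⁻¹ ∂G G⁻¹ ∂G) (`ricci_base`). On a surface Ric = (R/2) g (`SmoothMetricOn.ricci_surface`),
so the trace equals 2R g (`trace_eq_scalar`).

Since det G is constant, the normalized matrix is locally a constant congruence of G, under which
the symmetric space metric is invariant. The pullback metric is therefore 2R p*g, and f = 2R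
(`pullbackSymMetric_developingMap`). The same equation shows R ≥ 0, the left side being a squared
norm, as well as the smoothness of R and its independence of the chart. -/

namespace EinsteinCollapse

/-! ### Partial derivatives of matrix valued functions. -/

section Calculus

variable {ι : Type*} [Fintype ι] [DecidableEq ι]
variable {f f' : EuclideanSpace ℝ ι → ℝ} {y : EuclideanSpace ℝ ι}

theorem partialDeriv_congr (h : f =ᶠ[𝓝 y] f') (i : ι) :
    partialDeriv i f y = partialDeriv i f' y := by
  simp only [partialDeriv, h.fderiv_eq]

theorem eventuallyEq_partialDeriv (h : f =ᶠ[𝓝 y] f') (i : ι) :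
    partialDeriv i f =ᶠ[𝓝 y] partialDeriv i f' :=
  h.eventuallyEq_nhds.mono fun _ hz => partialDeriv_congr hz i

@[simp] theorem partialDeriv_const (c : ℝ) (i : ι) : partialDeriv i (fun _ => c) y = 0 := by
  simp [partialDeriv]

theorem partialDeriv_add (hf : DifferentiableAt ℝ f y) (hf' : DifferentiableAt ℝ f' y) (i : ι) :
    partialDeriv i (fun z => f z + f' z) y = partialDeriv i f y + partialDeriv i f' y := by
  simp [partialDeriv, fderiv_fun_add hf hf']

theorem partialDeriv_sub (hf : DifferentiableAt ℝ f y) (hf' : DifferentiableAt ℝ f' y) (i : ι) :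
    partialDeriv i (fun z => f z - f' z) y = partialDeriv i f y - partialDeriv i f' y := by
  simp [partialDeriv, fderiv_fun_sub hf hf']

theorem partialDeriv_mul (hf : DifferentiableAt ℝ f y) (hf' : DifferentiableAt ℝ f' y) (i : ι) :
    partialDeriv i (fun z => f z * f' z) y
      = partialDeriv i f y * f' y + f y * partialDeriv i f' y := by
  simp [partialDeriv, fderiv_fun_mul hf hf']; ring

theorem partialDeriv_const_mul (c : ℝ) (hf : DifferentiableAt ℝ f y) (i : ι) :
    partialDeriv i (fun z => c * f z) y = c * partialDeriv i f y := by
  simp [partialDeriv, fderiv_const_mul hf]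

theorem partialDeriv_sum {α : Type*} {s : Finset α} {F : α → EuclideanSpace ℝ ι → ℝ}
    (hF : ∀ a ∈ s, DifferentiableAt ℝ (F a) y) (i : ι) :
    partialDeriv i (fun z => ∑ a ∈ s, F a z) y = ∑ a ∈ s, partialDeriv i (F a) y := by
  simp [partialDeriv, fderiv_fun_sum hF]

theorem partialDeriv_comm (hf : ContDiffAt ℝ 2 f y) (i j : ι) :
    partialDeriv i (partialDeriv j f) y = partialDeriv j (partialDeriv i f) y := by
  have hd : DifferentiableAt ℝ (fderiv ℝ f) y :=
    (hf.fderiv_right (m := 1) (by norm_num)).differentiableAt one_ne_zero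
  have key : ∀ i j : ι, partialDeriv i (partialDeriv j f) y
      = fderiv ℝ (fderiv ℝ f) y (EuclideanSpace.single i 1) (EuclideanSpace.single j 1) := by
    intro i j
    change fderiv ℝ (fun z => fderiv ℝ f z (EuclideanSpace.single j 1)) y _ = _
    rw [fderiv_clm_apply hd (differentiableAt_const _)]
    simp
  rw [key, key]
  exact (hf.isSymmSndFDerivAt (by simp)) _ _

theorem contDiffOn_partialDeriv {V : Set (EuclideanSpace ℝ ι)} (hV : IsOpen V)
    (hf : ContDiffOn ℝ ∞ f V) (i : ι) : ContDiffOn ℝ ∞ (partialDeriv i f) V :=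
  (hf.fderiv_of_isOpen hV (m := ∞) (by simp)).clm_apply contDiffOn_const

theorem differentiableAt_of_contDiffOn {V : Set (EuclideanSpace ℝ ι)} (hV : IsOpen V)
    (hf : ContDiffOn ℝ ∞ f V) (hy : y ∈ V) : DifferentiableAt ℝ f y :=
  (hf.contDiffAt (hV.mem_nhds hy)).differentiableAt (by simp)

theorem partialDeriv_comm_of_contDiffOn {V : Set (EuclideanSpace ℝ ι)} (hV : IsOpen V)
    (hf : ContDiffOn ℝ ∞ f V) (hy : y ∈ V) (i j : ι) :
    partialDeriv i (partialDeriv j f) y = partialDeriv j (partialDeriv i f) y :=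
  partialDeriv_comm ((hf.contDiffAt (hV.mem_nhds hy)).of_le (by norm_cast)) i j

variable {m : Type*} [Fintype m] [DecidableEq m]

theorem contDiffOn_det {E : Type*} [NormedAddCommGroup E] [NormedSpace ℝ E] {V : Set E}
    {A : E → Matrix m m ℝ} {k : ℕ∞ω} (hA : ∀ a b, ContDiffOn ℝ k (fun z => A z a b) V) :
    ContDiffOn ℝ k (fun z => (A z).det) V := by
  simp only [Matrix.det_apply]
  refine ContDiffOn.sum fun σ _ => ContDiffOn.const_smul _ ?_
  exact contDiffOn_prod fun a _ => hA _ _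

/-- Cramer's rule: the entries of the inverse are cofactors, again determinants, divided by the
determinant. -/
theorem contDiffOn_matrix_inv {E : Type*} [NormedAddCommGroup E] [NormedSpace ℝ E] {V : Set E}
    {A : E → Matrix m m ℝ} {k : ℕ∞ω} (hA : ∀ a b, ContDiffOn ℝ k (fun z => A z a b) V)
    (hdet : ∀ z ∈ V, (A z).det ≠ 0) (a b : m) : ContDiffOn ℝ k (fun z => (A z)⁻¹ a b) V := by
  have h : (fun z => (A z)⁻¹ a b) = fun z => (A z).det⁻¹ * (A z).adjugate a b := by
    funext z
    rw [Matrix.inv_def]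
    simp
  rw [h]
  refine ((contDiffOn_det hA).inv hdet).mul ?_
  simp only [Matrix.adjugate_apply]
  refine contDiffOn_det fun c d => ?_
  by_cases hc : c = b
  · subst hc; simpa using contDiffOn_const
  · simpa [Matrix.updateRow_ne hc] using hA c d

theorem contDiffOn_matrix_mul {E : Type*} [NormedAddCommGroup E] [NormedSpace ℝ E] {V : Set E}
    {l n : Type*} {A : E → Matrix l m ℝ} {A' : E → Matrix m n ℝ} {k : ℕ∞ω}
    (hA : ∀ a b, ContDiffOn ℝ k (fun z => A z a b) V)
    (hA' : ∀ a b, ContDiffOn ℝ k (fun z => A' z a b) V) (a : l) (b : n) :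
    ContDiffOn ℝ k (fun z => (A z * A' z) a b) V := by
  simp only [Matrix.mul_apply]
  exact ContDiffOn.sum fun c _ => (hA _ _).mul (hA' _ _)

/-- The matrix of partial derivatives of the entries of a matrix valued function. -/
def matPartial {l n : Type*} (i : ι) (A : EuclideanSpace ℝ ι → Matrix l n ℝ)
    (y : EuclideanSpace ℝ ι) : Matrix l n ℝ :=
  Matrix.of fun a b => partialDeriv i (fun z => A z a b) y

theorem matPartial_mul {l n : Type*} {A : EuclideanSpace ℝ ι → Matrix l m ℝ}
    {A' : EuclideanSpace ℝ ι → Matrix m n ℝ}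
    (hA : ∀ a b, DifferentiableAt ℝ (fun z => A z a b) y)
    (hA' : ∀ a b, DifferentiableAt ℝ (fun z => A' z a b) y) (i : ι) :
    matPartial i (fun z => A z * A' z) y = matPartial i A y * A' y + A y * matPartial i A' y := by
  ext a b
  simp only [matPartial, Matrix.of_apply, Matrix.mul_apply, Matrix.add_apply]
  rw [partialDeriv_sum (F := fun c z => A z a c * A' z c b) fun c _ => (hA _ _).mul (hA' _ _),
    ← Finset.sum_add_distrib]
  exact Finset.sum_congr rfl fun c _ => partialDeriv_mul (hA _ _) (hA' _ _) i

theorem matPartial_congr {l n : Type*} {A A' : EuclideanSpace ℝ ι → Matrix l n ℝ}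
    (h : A =ᶠ[𝓝 y] A') (i : ι) : matPartial i A y = matPartial i A' y := by
  ext a b
  exact partialDeriv_congr (h.mono fun z hz => by rw [hz]) i

theorem matPartial_const {l n : Type*} (A : Matrix l n ℝ) (i : ι) :
    matPartial i (fun _ => A) y = 0 := by
  ext a b
  simp [matPartial]

/-- Obtained by differentiating A⁻¹A = 1, which holds on all of `V`. -/
theorem matPartial_inv {V : Set (EuclideanSpace ℝ ι)} (hV : IsOpen V)
    {A : EuclideanSpace ℝ ι → Matrix m m ℝ} (hA : ∀ a b, ContDiffOn ℝ ∞ (fun z => A z a b) V)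
    (hdet : ∀ z ∈ V, (A z).det ≠ 0) (hy : y ∈ V) (i : ι) :
    matPartial i (fun z => (A z)⁻¹) y = - ((A y)⁻¹ * matPartial i A y * (A y)⁻¹) := by
  have h1 : matPartial i (fun z => (A z)⁻¹ * A z) y = 0 := by
    rw [matPartial_congr (A' := fun _ => 1), matPartial_const]
    filter_upwards [hV.mem_nhds hy] with z hz
    exact Matrix.nonsing_inv_mul _ (hdet z hz).isUnit
  rw [matPartial_mul
    (fun a b => differentiableAt_of_contDiffOn hV (contDiffOn_matrix_inv hA hdet a b) hy)
    (fun a b => differentiableAt_of_contDiffOn hV (hA a b) hy)] at h1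
  have h2 := congrArg (· * (A y)⁻¹) (eq_neg_of_add_eq_zero_left h1)
  simpa [Matrix.mul_assoc, Matrix.mul_nonsing_inv _ (hdet y hy).isUnit] using h2

/-- Jacobi's formula. -/
theorem partialDeriv_det {V : Set (EuclideanSpace ℝ ι)} (hV : IsOpen V)
    {A : EuclideanSpace ℝ ι → Matrix m m ℝ} (hA : ∀ a b, ContDiffOn ℝ ∞ (fun z => A z a b) V)
    (hdet : ∀ z ∈ V, (A z).det ≠ 0) (hy : y ∈ V) (i : ι) :
    partialDeriv i (fun z => (A z).det) y
      = (A y).det * ((A y)⁻¹ * matPartial i A y).trace := by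
  -- The determinant is regarded as a function on the normed space `m → m → ℝ`, so that the chain
  -- rule applies.
  let D : (m → m → ℝ) → ℝ := fun M => (Matrix.of M).det
  have hD : ContDiff ℝ ∞ D := by
    rw [← contDiffOn_univ]
    exact contDiffOn_det fun a b => (contDiff_apply_apply ℝ ℝ a b).contDiffOn
  let F : EuclideanSpace ℝ ι → m → m → ℝ := fun z a b => A z a b
  have hF : DifferentiableAt ℝ F y := by
    refine differentiableAt_pi.2 fun a => differentiableAt_pi.2 fun b => ?_
    exact differentiableAt_of_contDiffOn hV (hA a b) hy
  have hDd : Differentiable ℝ D := hD.differentiable (by simp)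
  have hc : fderiv ℝ (fun z => (A z).det) y = (fderiv ℝ D (F y)).comp (fderiv ℝ F y) :=
    fderiv_comp y (hDd _) hF
  have hFv : fderiv ℝ F y (EuclideanSpace.single i 1) = fun a b => matPartial i A y a b := by
    funext a b
    rw [fderiv_pi (fun a => (differentiableAt_pi.1 hF a))]
    change fderiv ℝ (fun z => F z a) y (EuclideanSpace.single i 1) b = _
    rw [fderiv_pi (fun b => differentiableAt_pi.1 (differentiableAt_pi.1 hF a) b)]
    rfl
  -- The derivative of det is found on the lines A + tX: factoring out A leaves det(1 + tA⁻¹X) = 1 +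
  -- t tr(A⁻¹X) + O(t²).
  have hline : ∀ X : m → m → ℝ, fderiv ℝ D (F y) X = (A y).det * ((A y)⁻¹ * Matrix.of X).trace := by
    intro X
    have h1 : HasDerivAt (fun t : ℝ => D (F y + t • X)) (fderiv ℝ D (F y) X) 0 := by
      have h2 : HasDerivAt (fun t : ℝ => F y + t • X) X 0 := by
        simpa using ((hasDerivAt_id (0 : ℝ)).smul_const X).const_add (F y)
      have h3 : HasFDerivAt D (fderiv ℝ D (F y)) (F y + (0 : ℝ) • X) := by
        simpa using (hDd (F y)).hasFDerivAt
      exact h3.comp_hasDerivAt (0 : ℝ) h2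
    have h4 : (fun t : ℝ => D (F y + t • X)) = fun t => (A y).det *
        (1 + ((A y)⁻¹ * Matrix.of X).trace * t
        + (Matrix.det (1 + (Polynomial.X : Polynomial ℝ) •
            ((A y)⁻¹ * Matrix.of X).map Polynomial.C)).divX.divX.eval t * t ^ 2) := by
      funext t
      rw [← Matrix.det_one_add_smul, ← Matrix.det_mul]
      change Matrix.det (A y + t • Matrix.of X) = _
      congr 1
      rw [Matrix.mul_add, Matrix.mul_one, Matrix.mul_smul, ← Matrix.mul_assoc,
        Matrix.mul_nonsing_inv _ (hdet y hy).isUnit, Matrix.one_mul]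
    rw [h4] at h1
    refine h1.unique ?_
    have h5 := (((hasDerivAt_id (0 : ℝ)).const_mul ((A y)⁻¹ * Matrix.of X).trace).const_add 1).add
      (((Matrix.det (1 + (Polynomial.X : Polynomial ℝ) •
            ((A y)⁻¹ * Matrix.of X).map Polynomial.C)).divX.divX.hasDerivAt 0).mul
            ((hasDerivAt_id (0 : ℝ)).pow 2))
    simpa using h5.const_mul (A y).det
  change fderiv ℝ (fun z => (A z).det) y (EuclideanSpace.single i 1) = _
  rw [hc, ContinuousLinearMap.comp_apply, hline, hFv]
  rfl

end Calculus

/-! ### Christoffel symbols and the symmetries of the curvature tensor. -/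

section Curvature

variable {ι : Type*} [Fintype ι] [DecidableEq ι]
variable {g g' : EuclideanSpace ℝ ι → Matrix ι ι ℝ} {y : EuclideanSpace ℝ ι}

/-- The Christoffel symbols of the first kind. -/
def christoffelLower (g : EuclideanSpace ℝ ι → Matrix ι ι ℝ) (l i j : ι)
    (y : EuclideanSpace ℝ ι) : ℝ :=
  (1 / 2 : ℝ) * (partialDeriv i (fun z => g z j l) y + partialDeriv j (fun z => g z i l) y
      - partialDeriv l (fun z => g z i j) y)

theorem christoffel_eq_sum (k i j : ι) :
    christoffel g k i j y = ∑ l, (g y)⁻¹ k l * christoffelLower g l i j y := by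
  simp only [christoffel, christoffelLower, Finset.mul_sum]
  exact Finset.sum_congr rfl fun l _ => by ring

theorem christoffel_congr (h : g =ᶠ[𝓝 y] g') (k i j : ι) :
    christoffel g k i j y = christoffel g' k i j y := by
  have h1 : ∀ i j l, partialDeriv l (fun z => g z i j) y = partialDeriv l (fun z => g' z i j) y :=
    fun i j l => partialDeriv_congr (h.mono fun z hz => by rw [hz]) l
  simp only [christoffel, h1, h.eq_of_nhds]

theorem eventuallyEq_christoffel (h : g =ᶠ[𝓝 y] g') (k i j : ι) :
    christoffel g k i j =ᶠ[𝓝 y] christoffel g' k i j :=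
  h.eventuallyEq_nhds.mono fun _ hz => christoffel_congr hz k i j

/-- Only the germ of the metric matters, so an explicit formula for the metric matrix valid near one
point suffices. -/
theorem ricci_congr (h : g =ᶠ[𝓝 y] g') (j k : ι) : ricci g j k y = ricci g' j k y := by
  have h1 : ∀ a i j k, partialDeriv a (christoffel g i j k) y
      = partialDeriv a (christoffel g' i j k) y :=
    fun a i j k => partialDeriv_congr (eventuallyEq_christoffel h i j k) a
  simp only [ricci, h1, fun i j k => christoffel_congr h i j k]

variable {V : Set (EuclideanSpace ℝ ι)}

/-- A smooth field of invertible symmetric matrices on an open set. -/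
structure SmoothMetricOn (g : EuclideanSpace ℝ ι → Matrix ι ι ℝ)
    (V : Set (EuclideanSpace ℝ ι)) : Prop where
  isOpen : IsOpen V
  contDiffOn : ∀ i j, ContDiffOn ℝ ∞ (fun z => g z i j) V
  symm : ∀ z ∈ V, ∀ i j, g z i j = g z j i
  det_ne_zero : ∀ z ∈ V, (g z).det ≠ 0

namespace SmoothMetricOn

variable (hg : SmoothMetricOn g V)
include hg

theorem contDiffOn_inv (i j : ι) : ContDiffOn ℝ ∞ (fun z => (g z)⁻¹ i j) V :=
  contDiffOn_matrix_inv hg.contDiffOn hg.det_ne_zero i j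

theorem inv_symm (hy : y ∈ V) (i j : ι) : (g y)⁻¹ i j = (g y)⁻¹ j i := by
  have h : (g y)ᵀ = g y := by ext i j; exact hg.symm y hy j i
  calc (g y)⁻¹ i j = ((g y)ᵀ)⁻¹ i j := by rw [h]
    _ = (g y)⁻¹ j i := by rw [← Matrix.transpose_nonsing_inv]; rfl

theorem contDiffOn_christoffelLower (k i j : ι) :
    ContDiffOn ℝ ∞ (christoffelLower g k i j) V :=
  contDiffOn_const.mul (((contDiffOn_partialDeriv hg.isOpen (hg.contDiffOn _ _) _).add
    (contDiffOn_partialDeriv hg.isOpen (hg.contDiffOn _ _) _)).sub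
    (contDiffOn_partialDeriv hg.isOpen (hg.contDiffOn _ _) _))

theorem contDiffOn_christoffel (k i j : ι) : ContDiffOn ℝ ∞ (christoffel g k i j) V := by
  have h : christoffel g k i j = fun z => ∑ l, (g z)⁻¹ k l * christoffelLower g l i j z := by
    funext z; exact christoffel_eq_sum k i j
  rw [h]
  exact ContDiffOn.sum fun l _ => (hg.contDiffOn_inv k l).mul
    (hg.contDiffOn_christoffelLower l i j)

theorem partialDeriv_symm (hy : y ∈ V) (i j k : ι) :
    partialDeriv i (fun z => g z j k) y = partialDeriv i (fun z => g z k j) y :=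
  partialDeriv_congr (by
    filter_upwards [hg.isOpen.mem_nhds hy] with z hz using hg.symm z hz j k) i

theorem christoffelLower_symm (hy : y ∈ V) (k i j : ι) :
    christoffelLower g k i j y = christoffelLower g k j i y := by
  simp only [christoffelLower, hg.partialDeriv_symm hy k i j]
  ring

theorem christoffel_symm (hy : y ∈ V) (k i j : ι) :
    christoffel g k i j y = christoffel g k j i y := by
  simp only [christoffel_eq_sum, hg.christoffelLower_symm hy _ i j]

/-- Compatibility of the Levi-Civita connection with the metric: ∇g = 0 in coordinates. -/
theorem christoffelLower_add (hy : y ∈ V) (i l m : ι) :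
    christoffelLower g l i m y + christoffelLower g m i l y
      = partialDeriv i (fun z => g z l m) y := by
  simp only [christoffelLower, hg.partialDeriv_symm hy _ l m]
  rw [hg.partialDeriv_symm hy l i m, hg.partialDeriv_symm hy m i l,
    hg.partialDeriv_symm hy m l i, hg.partialDeriv_symm hy l m i]
  ring

theorem sum_mul_christoffel (hy : y ∈ V) (l i j : ι) :
    ∑ m, g y l m * christoffel g m i j y = christoffelLower g l i j y := by
  have h : g y *ᵥ ((g y)⁻¹ *ᵥ fun m => christoffelLower g m i j y)
      = fun m => christoffelLower g m i j y := by
    rw [Matrix.mulVec_mulVec, Matrix.mul_nonsing_inv _ (hg.det_ne_zero y hy).isUnit,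
      Matrix.one_mulVec]
  have h2 := congrFun h l
  simpa [Matrix.mulVec, dotProduct, christoffel_eq_sum] using h2

/-- Differentiating the relation between `g` times the Christoffel symbols and the lowered symbols,
then solving, avoids the derivative of the inverse matrix. -/
theorem partialDeriv_christoffel (hy : y ∈ V) (a k i j : ι) :
    partialDeriv a (christoffel g k i j) y
      = ∑ l, (g y)⁻¹ k l * (partialDeriv a (christoffelLower g l i j) y
        - ∑ m, partialDeriv a (fun z => g z l m) y * christoffel g m i j y) := by
  have h1 : ∀ l, ∑ m, (partialDeriv a (fun z => g z l m) y * christoffel g m i j y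
      + g y l m * partialDeriv a (christoffel g m i j) y)
      = partialDeriv a (christoffelLower g l i j) y := by
    intro l
    have h2 : (fun z => ∑ m, g z l m * christoffel g m i j z)
        =ᶠ[𝓝 y] christoffelLower g l i j := by
      filter_upwards [hg.isOpen.mem_nhds hy] with z hz using hg.sum_mul_christoffel hz l i j
    rw [← partialDeriv_congr h2 a, partialDeriv_sum]
    · exact Finset.sum_congr rfl fun m _ => (partialDeriv_mul
        (differentiableAt_of_contDiffOn hg.isOpen (hg.contDiffOn l m) hy)
        (differentiableAt_of_contDiffOn hg.isOpen (hg.contDiffOn_christoffel m i j) hy) a).symm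
    · exact fun m _ => (differentiableAt_of_contDiffOn hg.isOpen (hg.contDiffOn l m) hy).mul
        (differentiableAt_of_contDiffOn hg.isOpen (hg.contDiffOn_christoffel m i j) hy)
  have h3 : (g y)⁻¹ *ᵥ (g y *ᵥ fun m => partialDeriv a (christoffel g m i j) y)
      = fun m => partialDeriv a (christoffel g m i j) y := by
    rw [Matrix.mulVec_mulVec, Matrix.nonsing_inv_mul _ (hg.det_ne_zero y hy).isUnit,
      Matrix.one_mulVec]
  have h4 := congrFun h3 k
  simp only [Matrix.mulVec, dotProduct] at h4
  rw [← h4]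
  refine Finset.sum_congr rfl fun l _ => ?_
  rw [← h1 l, Finset.sum_add_distrib]
  ring

omit hg in
/-- The curvature tensor with all indices lowered, up to the order of the indices. -/
def _root_.EinsteinCollapse.curvatureLower (g : EuclideanSpace ℝ ι → Matrix ι ι ℝ)
    (l i j k : ι) (y : EuclideanSpace ℝ ι) : ℝ :=
  partialDeriv i (christoffelLower g l j k) y - partialDeriv j (christoffelLower g l i k) y
    - ∑ m, christoffelLower g m i l y * christoffel g m j k y
    + ∑ m, christoffelLower g m j l y * christoffel g m i k y

/-- The derivatives of `g` produced by lowering the index split into two lowered symbols by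
`christoffelLower_add`; one of them cancels the quadratic terms of the Ricci tensor. The lowered
form makes the antisymmetries available. -/
theorem ricci_eq_sum (hy : y ∈ V) (j k : ι) :
    ricci g j k y = ∑ i, ∑ l, (g y)⁻¹ i l * curvatureLower g l i j k y := by
  have h0 : ∀ a b i j k : ι, ∑ l, christoffel g a b l y * christoffel g l j k y
      = ∑ l, (g y)⁻¹ a l * ∑ m, christoffelLower g l b m y * christoffel g m j k y := by
    intro a b i j k
    simp only [christoffel_eq_sum (g := g) a, Finset.sum_mul, Finset.mul_sum]
    rw [Finset.sum_comm]
    exact Finset.sum_congr rfl fun _ _ => Finset.sum_congr rfl fun _ _ => by ring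
  have h1 : ricci g j k y = ∑ i, (partialDeriv i (christoffel g i j k) y
      - partialDeriv j (christoffel g i i k) y
      + (∑ l, christoffel g i i l y * christoffel g l j k y
        - ∑ l, christoffel g i j l y * christoffel g l i k y)) := by
    simp only [ricci, Finset.sum_add_distrib, Finset.sum_sub_distrib]
  rw [h1]
  refine Finset.sum_congr rfl fun i _ => ?_
  rw [hg.partialDeriv_christoffel hy, hg.partialDeriv_christoffel hy, h0 i i i j k, h0 i j i i k,
    ← Finset.sum_sub_distrib, ← Finset.sum_sub_distrib, ← Finset.sum_add_distrib]
  refine Finset.sum_congr rfl fun l _ => ?_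
  simp only [← hg.christoffelLower_add hy, add_mul, Finset.sum_add_distrib, curvatureLower]
  ring

theorem curvatureLower_antisymm_mid (l i j k : ι) :
    curvatureLower g l i j k y = - curvatureLower g l j i k y := by
  simp only [curvatureLower]; ring

/-- In the second order part the terms ∂ᵢ∂ⱼg cancel because partial derivatives commute, and the
rest is visibly antisymmetric. The two quadratic terms are exchanged because g⁻¹ is symmetric. -/
theorem curvatureLower_antisymm_outer (hy : y ∈ V) (l i j k : ι) :
    curvatureLower g l i j k y = - curvatureLower g k i j l y := by
  have hs : ∀ l k i j, ∑ m, christoffelLower g m i l y * christoffel g m j k y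
      = ∑ m, christoffelLower g m j k y * christoffel g m i l y := by
    intro l k i j
    simp only [christoffel_eq_sum, Finset.mul_sum]
    rw [Finset.sum_comm]
    refine Finset.sum_congr rfl fun _ _ => Finset.sum_congr rfl fun _ _ => ?_
    rw [hg.inv_symm hy]
    ring
  have hd : ∀ i l j k, partialDeriv i (christoffelLower g l j k) y
      = (1 / 2 : ℝ) * (partialDeriv i (partialDeriv j fun z => g z k l) y
        + partialDeriv i (partialDeriv k fun z => g z j l) y
        - partialDeriv i (partialDeriv l fun z => g z j k) y) := by
    intro i l j k
    have d : ∀ a b c, DifferentiableAt ℝ (partialDeriv a fun z => g z b c) y := fun a b c =>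
      differentiableAt_of_contDiffOn hg.isOpen
        (contDiffOn_partialDeriv hg.isOpen (hg.contDiffOn b c) a) hy
    change partialDeriv i (fun y => (1 / 2 : ℝ) * (partialDeriv j (fun z => g z k l) y
      + partialDeriv k (fun z => g z j l) y - partialDeriv l (fun z => g z j k) y)) y = _
    rw [partialDeriv_const_mul _ (((d _ _ _).fun_add (d _ _ _)).fun_sub (d _ _ _)),
      partialDeriv_sub ((d _ _ _).fun_add (d _ _ _)) (d _ _ _),
      partialDeriv_add (d _ _ _) (d _ _ _)]
  have hc : ∀ i j a b, partialDeriv i (partialDeriv j fun z => g z a b) y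
      = partialDeriv j (partialDeriv i fun z => g z a b) y := fun i j a b =>
    partialDeriv_comm_of_contDiffOn hg.isOpen (hg.contDiffOn a b) hy i j
  have a1 := hc i j k l
  have a2 := hc i j l k
  have a3 := hs l k i j
  have a4 := hs l k j i
  simp only [curvatureLower, hd]
  linarith

end SmoothMetricOn
end Curvature

/-! ### Ricci curvature in dimension two. -/

section Surface

variable {g : EuclideanSpace ℝ (Fin 2) → Matrix (Fin 2) (Fin 2) ℝ}
  {V : Set (EuclideanSpace ℝ (Fin 2))} {y : EuclideanSpace ℝ (Fin 2)}

/-- On a surface, the Ricci tensor is half the scalar curvature times the metric. -/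
theorem SmoothMetricOn.ricci_surface (hg : SmoothMetricOn g V) (hy : y ∈ V) (j k : Fin 2) :
    ricci g j k y = scalar g y / 2 * g y j k := by
  have hz : ∀ l i k, curvatureLower g l i i k y = 0 := fun l i k => by
    have := hg.curvatureLower_antisymm_mid (y := y) l i i k; linarith
  have hz' : ∀ l i j, curvatureLower g l i j l y = 0 := fun l i j => by
    have := hg.curvatureLower_antisymm_outer hy l i j l; linarith
  -- Components with a repeated index in an antisymmetric pair vanish, and up to sign the remaining
  -- ones all equal `curvatureLower g 0 0 1 1`.
  have e1 := hg.curvatureLower_antisymm_mid (y := y) 0 1 0 1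
  have e2 := hg.curvatureLower_antisymm_outer hy 0 0 1 1
  have e3 := hg.curvatureLower_antisymm_outer hy 0 1 0 1
  have hd := hg.det_ne_zero y hy
  have h10 := hg.symm y hy 1 0
  have hinv : (g y)⁻¹ = (g y).det⁻¹ • !![g y 1 1, -g y 0 1; -g y 1 0, g y 0 0] := by
    rw [Matrix.inv_def, Matrix.adjugate_fin_two, Ring.inverse_eq_inv']
  -- The factor is the Gauss curvature; its double is the scalar curvature, the trace of `g` being
  -- 2.
  have key : ∀ j k, ricci g j k y = curvatureLower g 0 0 1 1 y / (g y).det * g y j k := by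
    intro j k
    rw [hg.ricci_eq_sum hy, hinv]
    fin_cases j <;> fin_cases k <;>
      simp [Fin.sum_univ_two, hz, hz', h10] <;> grind
  have hs : scalar g y = 2 * (curvatureLower g 0 0 1 1 y / (g y).det) := by
    simp only [scalar, key, hinv]
    have h3 : (g y).det = g y 0 0 * g y 1 1 - g y 0 1 * g y 0 1 := by
      rw [Matrix.det_fin_two, h10]
    generalize (g y).det = d at *
    simp only [Fin.sum_univ_two, h10, Matrix.smul_apply, Matrix.of_apply, Matrix.cons_val',
      Matrix.cons_val_zero, Matrix.cons_val_one, smul_eq_mul, Matrix.cons_val_fin_one]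
    field_simp
    rw [h3]
    ring
  rw [key, hs]
  ring

end Surface

/-! ### Invariant metrics in adapted coordinates and their Christoffel symbols. -/

section Adapted

variable {κ ι : Type*} [Fintype κ] [DecidableEq κ] [Fintype ι] [DecidableEq ι]

/-- The projection to the base coordinates. -/
def baseProj : EuclideanSpace ℝ (κ ⊕ ι) →L[ℝ] EuclideanSpace ℝ ι :=
  LinearMap.toContinuousLinearMap
    { toFun := fun y => WithLp.toLp 2 fun i => y (Sum.inr i)
      map_add' := fun _ _ => rfl
      map_smul' := fun _ _ => rfl }

@[simp] theorem baseProj_apply (y : EuclideanSpace ℝ (κ ⊕ ι)) (i : ι) :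
    baseProj y i = y (Sum.inr i) := rfl

@[simp] theorem baseProj_single_inl (k : κ) (c : ℝ) :
    baseProj (EuclideanSpace.single (Sum.inl k : κ ⊕ ι) c) = 0 := by
  ext i; simp

@[simp] theorem baseProj_single_inr (i : ι) (c : ℝ) :
    baseProj (EuclideanSpace.single (Sum.inr i : κ ⊕ ι) c) = EuclideanSpace.single i c := by
  ext j
  by_cases h : j = i <;> simp [h]

theorem partialDeriv_inr_comp {f : EuclideanSpace ℝ ι → ℝ} {y : EuclideanSpace ℝ (κ ⊕ ι)}
    (hf : DifferentiableAt ℝ f (baseProj y)) (i : ι) :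
    partialDeriv (Sum.inr i) (fun x => f (baseProj x)) y = partialDeriv i f (baseProj y) := by
  have h := fderiv_comp y hf (baseProj : EuclideanSpace ℝ (κ ⊕ ι) →L[ℝ] _).differentiableAt
  simp only [partialDeriv]
  change fderiv ℝ (f ∘ baseProj) y _ = _
  rw [h]
  simp

/-- Functions of the base coordinates only. -/
def IsBaseFunction (F : EuclideanSpace ℝ (κ ⊕ ι) → ℝ) : Prop :=
  ∀ y v, baseProj v = 0 → F (y + v) = F y

theorem isBaseFunction_comp (f : EuclideanSpace ℝ ι → ℝ) :
    IsBaseFunction (κ := κ) (fun y => f (baseProj y)) := fun y v hv => by simp [hv]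

theorem IsBaseFunction.partialDeriv {F : EuclideanSpace ℝ (κ ⊕ ι) → ℝ} (hF : IsBaseFunction F)
    (i : κ ⊕ ι) : IsBaseFunction (partialDeriv i F) := by
  intro y v hv
  have h : (fun x => F (x + v)) = F := funext fun x => hF x v hv
  have h2 := fderiv_comp_add_right (𝕜 := ℝ) (f := F) (x := y) v
  rw [h] at h2
  simp only [EinsteinCollapse.partialDeriv, ← h2]

/-- Differentiability is not required: where it fails, `fderiv` is zero by convention. -/
theorem IsBaseFunction.partialDeriv_inl {F : EuclideanSpace ℝ (κ ⊕ ι) → ℝ}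
    (hF : IsBaseFunction F) (k : κ) (y : EuclideanSpace ℝ (κ ⊕ ι)) :
    EinsteinCollapse.partialDeriv (Sum.inl k) F y = 0 := by
  simp only [EinsteinCollapse.partialDeriv]
  by_cases hd : DifferentiableAt ℝ F y
  · rw [← hd.lineDeriv_eq_fderiv, lineDeriv]
    have : (fun t : ℝ => F (y + t • EuclideanSpace.single (Sum.inl k) 1)) = fun _ => F y :=
      funext fun t => hF _ _ (by rw [map_smul, baseProj_single_inl, smul_zero])
    rw [this, deriv_const]
  · rw [fderiv_zero_of_not_differentiableAt hd]; simp

theorem isBaseFunction_christoffel (h : EuclideanSpace ℝ ι → Matrix (κ ⊕ ι) (κ ⊕ ι) ℝ)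
    (k i j : κ ⊕ ι) : IsBaseFunction (christoffel (fun y => h (baseProj y)) k i j) := by
  intro y v hv
  have h1 : ∀ l a b, partialDeriv l (fun z : EuclideanSpace ℝ (κ ⊕ ι) => h (baseProj z) a b) (y + v)
      = partialDeriv l (fun z => h (baseProj z) a b) y := fun l a b =>
    (isBaseFunction_comp fun z => h z a b).partialDeriv l y v hv
  simp only [christoffel, h1, map_add, hv, add_zero]

/-- The matrix of the metric `G_{IJ} (dx^I + A^I) (dx^J + A^J) + g_{αβ} db^α db^β`. -/
def adaptedMetric (G : Matrix κ κ ℝ) (A : Matrix κ ι ℝ) (g : Matrix ι ι ℝ) :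
    Matrix (κ ⊕ ι) (κ ⊕ ι) ℝ :=
  Matrix.fromBlocks G (G * A) (Aᵀ * G) (g + Aᵀ * G * A)

/-- The metric is LᵀDL with D = diag(G, g) and L the block unitriangular matrix with upper right
block A. The inverse is therefore L⁻¹D⁻¹L⁻ᵀ, where L⁻¹ has the block -A. -/
theorem adaptedMetric_mul_inv {G : Matrix κ κ ℝ} {A : Matrix κ ι ℝ} {g : Matrix ι ι ℝ}
    (hG : G.det ≠ 0) (hg : g.det ≠ 0) :
    adaptedMetric G A g * Matrix.fromBlocks (G⁻¹ + A * g⁻¹ * Aᵀ) (-(A * g⁻¹)) (-(g⁻¹ * Aᵀ)) g⁻¹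
      = 1 := by
  have hG' := Matrix.mul_nonsing_inv G hG.isUnit
  have hg' := Matrix.mul_nonsing_inv g hg.isUnit
  rw [adaptedMetric, Matrix.fromBlocks_multiply, ← Matrix.fromBlocks_one]
  congr 1
  · rw [Matrix.mul_add, hG']; simp [Matrix.mul_assoc]
  · simp [Matrix.mul_assoc]
  · rw [Matrix.mul_add, Matrix.mul_assoc, hG', Matrix.mul_neg, Matrix.add_mul,
      ← Matrix.mul_assoc g, hg']
    simp [Matrix.mul_assoc]
  · rw [Matrix.add_mul, hg']; simp [Matrix.mul_assoc]

theorem adaptedMetric_inv {G : Matrix κ κ ℝ} {A : Matrix κ ι ℝ} {g : Matrix ι ι ℝ}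
    (hG : G.det ≠ 0) (hg : g.det ≠ 0) :
    (adaptedMetric G A g)⁻¹
      = Matrix.fromBlocks (G⁻¹ + A * g⁻¹ * Aᵀ) (-(A * g⁻¹)) (-(g⁻¹ * Aᵀ)) g⁻¹ :=
  Matrix.inv_eq_right_inv (adaptedMetric_mul_inv hG hg)

/-- The coefficients on the base of a smooth invariant metric. -/
structure AdaptedOn (G : EuclideanSpace ℝ ι → Matrix κ κ ℝ) (A : EuclideanSpace ℝ ι → Matrix κ ι ℝ)
    (g : EuclideanSpace ℝ ι → Matrix ι ι ℝ) (V : Set (EuclideanSpace ℝ ι)) : Prop where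
  base : SmoothMetricOn g V
  smooth_fiber : ∀ i j, ContDiffOn ℝ ∞ (fun z => G z i j) V
  smooth_conn : ∀ i j, ContDiffOn ℝ ∞ (fun z => A z i j) V
  posDef : ∀ z ∈ V, (G z).PosDef

variable {G : EuclideanSpace ℝ ι → Matrix κ κ ℝ} {A : EuclideanSpace ℝ ι → Matrix κ ι ℝ}
  {g : EuclideanSpace ℝ ι → Matrix ι ι ℝ} {V : Set (EuclideanSpace ℝ ι)}

namespace AdaptedOn

variable (H : AdaptedOn G A g V)
include H

theorem det_ne_zero {z : EuclideanSpace ℝ ι} (hz : z ∈ V) : (G z).det ≠ 0 :=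
  (H.posDef z hz).det_pos.ne'

theorem symm {z : EuclideanSpace ℝ ι} (hz : z ∈ V) (i j : κ) : G z i j = G z j i := by
  simpa using (H.posDef z hz).1.apply j i

theorem transpose_eq {z : EuclideanSpace ℝ ι} (hz : z ∈ V) : (G z)ᵀ = G z := by
  ext i j; exact H.symm hz j i

theorem smooth_adapted (i j : κ ⊕ ι) :
    ContDiffOn ℝ ∞ (fun z => adaptedMetric (G z) (A z) (g z) i j) V := by
  have hGA := contDiffOn_matrix_mul H.smooth_fiber H.smooth_conn
  have hAG := contDiffOn_matrix_mul (A := fun z => (A z)ᵀ) (fun a b => H.smooth_conn b a)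
    H.smooth_fiber
  have hAGA := contDiffOn_matrix_mul hAG H.smooth_conn
  rcases i with i | i <;> rcases j with j | j
  · exact H.smooth_fiber i j
  · exact hGA i j
  · exact hAG i j
  · exact (H.base.contDiffOn i j).add (hAGA i j)

theorem isSymm_adapted {z : EuclideanSpace ℝ ι} (hz : z ∈ V) :
    (adaptedMetric (G z) (A z) (g z))ᵀ = adaptedMetric (G z) (A z) (g z) := by
  have hg : (g z)ᵀ = g z := by ext i j; exact H.base.symm z hz j i
  simp [adaptedMetric, Matrix.fromBlocks_transpose, Matrix.transpose_mul, H.transpose_eq hz, hg,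
    Matrix.mul_assoc]

theorem smoothMetricOn :
    SmoothMetricOn (fun y => adaptedMetric (G (baseProj y)) (A (baseProj y)) (g (baseProj y)))
      (baseProj (κ := κ) ⁻¹' V) where
  isOpen := H.base.isOpen.preimage baseProj.continuous
  contDiffOn i j := (H.smooth_adapted i j).comp (t := V)
    (ContinuousLinearMap.contDiff (n := ∞) (baseProj (κ := κ) (ι := ι))).contDiffOn fun _ hy => hy
  symm y hy i j := congrFun (congrFun (H.isSymm_adapted hy) j) i
  det_ne_zero y hy := by
    intro h0
    have h := congrArg Matrix.det (adaptedMetric_mul_inv (A := A (baseProj y))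
      (H.det_ne_zero hy) (H.base.det_ne_zero _ hy))
    rw [Matrix.det_mul, h0] at h
    simp at h

variable {y : EuclideanSpace ℝ (κ ⊕ ι)} (hy : baseProj y ∈ V)
include hy

omit H hy in
theorem partialDeriv_adapted_inl (k : κ) (i j : κ ⊕ ι) :
    partialDeriv (Sum.inl k) (fun x : EuclideanSpace ℝ (κ ⊕ ι) => adaptedMetric (G (baseProj x))
      (A (baseProj x)) (g (baseProj x)) i j) y = 0 :=
  (isBaseFunction_comp fun z => adaptedMetric (G z) (A z) (g z) i j).partialDeriv_inl k y

theorem partialDeriv_adapted_inr (a : ι) (i j : κ ⊕ ι) :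
    partialDeriv (Sum.inr a) (fun x : EuclideanSpace ℝ (κ ⊕ ι) => adaptedMetric (G (baseProj x))
      (A (baseProj x)) (g (baseProj x)) i j) y
      = partialDeriv a (fun z => adaptedMetric (G z) (A z) (g z) i j) (baseProj y) :=
  partialDeriv_inr_comp (f := fun z => adaptedMetric (G z) (A z) (g z) i j)
    (differentiableAt_of_contDiffOn H.base.isOpen (H.smooth_adapted i j) hy) a

/-- In the names of these lemmas `f` marks a fiber index and `b` a base index; the first letter
belongs to the first (for `christoffel`, upper) index. -/
theorem lower_fff (l i j : κ) :
    christoffelLower (fun y => adaptedMetric (G (baseProj y)) (A (baseProj y)) (g (baseProj y)))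
      (Sum.inl l) (Sum.inl i) (Sum.inl j) y = 0 := by
  simp [christoffelLower, partialDeriv_adapted_inl]

theorem lower_bff (c : ι) (i j : κ) :
    christoffelLower (fun y => adaptedMetric (G (baseProj y)) (A (baseProj y)) (g (baseProj y)))
      (Sum.inr c) (Sum.inl i) (Sum.inl j) y
      = - (1 / 2) * partialDeriv c (fun z => G z i j) (baseProj y) := by
  simp only [christoffelLower, partialDeriv_adapted_inl, H.partialDeriv_adapted_inr hy]
  simp [adaptedMetric]

theorem lower_ffb (l i : κ) (b : ι) :
    christoffelLower (fun y => adaptedMetric (G (baseProj y)) (A (baseProj y)) (g (baseProj y)))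
      (Sum.inl l) (Sum.inl i) (Sum.inr b) y
      = (1 / 2) * partialDeriv b (fun z => G z i l) (baseProj y) := by
  simp only [christoffelLower, partialDeriv_adapted_inl, H.partialDeriv_adapted_inr hy]
  simp [adaptedMetric]

theorem lower_bfb (c : ι) (i : κ) (b : ι) :
    christoffelLower (fun y => adaptedMetric (G (baseProj y)) (A (baseProj y)) (g (baseProj y)))
      (Sum.inr c) (Sum.inl i) (Sum.inr b) y
      = (1 / 2) * (partialDeriv b (fun z => (G z * A z) i c) (baseProj y)
          - partialDeriv c (fun z => (G z * A z) i b) (baseProj y)) := by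
  simp only [christoffelLower, partialDeriv_adapted_inl, H.partialDeriv_adapted_inr hy]
  simp [adaptedMetric]

theorem lower_bbb (c a b : ι) :
    christoffelLower (fun y => adaptedMetric (G (baseProj y)) (A (baseProj y)) (g (baseProj y)))
      (Sum.inr c) (Sum.inr a) (Sum.inr b) y
      = christoffelLower (fun z => g z + (A z)ᵀ * G z * A z) c a b (baseProj y) := by
  simp only [christoffelLower, H.partialDeriv_adapted_inr hy]
  simp [adaptedMetric]

/-- No condition on A at the point is needed, since the symbols with three fiber indices vanish.
This matters because this component has to be differentiated in the Ricci tensor. -/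
theorem christoffel_bff (c : ι) (i j : κ) :
    christoffel (fun y => adaptedMetric (G (baseProj y)) (A (baseProj y)) (g (baseProj y)))
      (Sum.inr c) (Sum.inl i) (Sum.inl j) y
      = - (1 / 2) * ∑ d, (g (baseProj y))⁻¹ c d * partialDeriv d (fun z => G z i j) (baseProj y) := by
  rw [christoffel_eq_sum, Fintype.sum_sum_type]
  simp only [H.lower_fff hy, H.lower_bff hy, mul_zero, Finset.sum_const_zero, zero_add,
    adaptedMetric_inv (H.det_ne_zero hy) (H.base.det_ne_zero _ hy), Matrix.fromBlocks_apply₂₂,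
    Finset.mul_sum]
  exact Finset.sum_congr rfl fun _ _ => by ring

section Gauge

variable (hA : A (baseProj y) = 0)
include hA

/-- The gauge condition A = 0 concerns one point only. It makes the metric block diagonal there,
while the derivatives of A survive and form the curvature of the connection. -/
theorem inv_of_gauge :
    (adaptedMetric (G (baseProj y)) (A (baseProj y)) (g (baseProj y)))⁻¹
      = Matrix.fromBlocks (G (baseProj y))⁻¹ 0 0 (g (baseProj y))⁻¹ := by
  rw [adaptedMetric_inv (H.det_ne_zero hy) (H.base.det_ne_zero _ hy), hA]
  simp

theorem christoffel_fff (l i j : κ) :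
    christoffel (fun y => adaptedMetric (G (baseProj y)) (A (baseProj y)) (g (baseProj y)))
      (Sum.inl l) (Sum.inl i) (Sum.inl j) y = 0 := by
  rw [christoffel_eq_sum, Fintype.sum_sum_type, H.inv_of_gauge hy hA]
  simp [H.lower_fff hy]

theorem christoffel_ffb (l i : κ) (b : ι) :
    christoffel (fun y => adaptedMetric (G (baseProj y)) (A (baseProj y)) (g (baseProj y)))
      (Sum.inl l) (Sum.inl i) (Sum.inr b) y
      = (1 / 2) * ((G (baseProj y))⁻¹ * matPartial b G (baseProj y)) l i := by
  rw [christoffel_eq_sum, Fintype.sum_sum_type, H.inv_of_gauge hy hA]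
  have hs : ∀ l, partialDeriv b (fun z => G z i l) (baseProj y)
      = partialDeriv b (fun z => G z l i) (baseProj y) := fun l =>
    partialDeriv_congr (by
      filter_upwards [H.base.isOpen.mem_nhds hy] with z hz using H.symm hz i l) b
  simp only [H.lower_ffb hy, hs]
  simp only [Matrix.fromBlocks_apply₁₁, Matrix.fromBlocks_apply₁₂, Matrix.zero_apply, zero_mul,
    Finset.sum_const_zero, add_zero, Matrix.mul_apply, matPartial, Matrix.of_apply, Finset.mul_sum]
  exact Finset.sum_congr rfl fun _ _ => by ring

omit H hy hA in
/-- The curvature of the connection `A`, lowered with `G`, in a gauge with `A = 0` at the point. -/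
def _root_.EinsteinCollapse.connCurvature (G : EuclideanSpace ℝ ι → Matrix κ κ ℝ)
    (A : EuclideanSpace ℝ ι → Matrix κ ι ℝ) (z : EuclideanSpace ℝ ι) (i : κ) : Matrix ι ι ℝ :=
  Matrix.of fun c b => (1 / 2) * (G z * (Matrix.of fun k (_ : Unit) =>
    partialDeriv b (fun z => A z k c) z - partialDeriv c (fun z => A z k b) z)) i ()

/-- The Leibniz term containing ∂G drops out because A = 0 at the point, so only the antisymmetrized
derivative of A remains. -/
theorem christoffel_bfb (c : ι) (i : κ) (b : ι) :
    christoffel (fun y => adaptedMetric (G (baseProj y)) (A (baseProj y)) (g (baseProj y)))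
      (Sum.inr c) (Sum.inl i) (Sum.inr b) y
      = ((g (baseProj y))⁻¹ * connCurvature G A (baseProj y) i) c b := by
  rw [christoffel_eq_sum, Fintype.sum_sum_type, H.inv_of_gauge hy hA]
  have hd : ∀ b c, partialDeriv b (fun z => (G z * A z) i c) (baseProj y)
      = ∑ k, G (baseProj y) i k * partialDeriv b (fun z => A z k c) (baseProj y) := by
    intro b c
    have h := matPartial_mul (y := baseProj y) (A := G) (A' := A)
      (fun a b => differentiableAt_of_contDiffOn H.base.isOpen (H.smooth_fiber a b) hy)
      (fun a b => differentiableAt_of_contDiffOn H.base.isOpen (H.smooth_conn a b) hy) b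
    rw [hA, Matrix.mul_zero, zero_add] at h
    exact congrFun (congrFun h i) c
  simp only [H.lower_bfb hy, hd]
  simp only [Matrix.fromBlocks_apply₂₁, Matrix.fromBlocks_apply₂₂, Matrix.zero_apply, zero_mul,
    Finset.sum_const_zero, zero_add, Matrix.mul_apply, connCurvature, Matrix.of_apply, mul_sub,
    Finset.sum_sub_distrib]

/-- The contribution AᵀGA is quadratic in A, so its first derivatives vanish wherever A does. -/
theorem christoffel_bbb (c a b : ι) :
    christoffel (fun y => adaptedMetric (G (baseProj y)) (A (baseProj y)) (g (baseProj y)))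
      (Sum.inr c) (Sum.inr a) (Sum.inr b) y = christoffel g c a b (baseProj y) := by
  rw [christoffel_eq_sum, christoffel_eq_sum, Fintype.sum_sum_type, H.inv_of_gauge hy hA]
  have dG := fun a b => differentiableAt_of_contDiffOn H.base.isOpen (H.smooth_fiber a b) hy
  have dA := fun a b => differentiableAt_of_contDiffOn H.base.isOpen (H.smooth_conn a b) hy
  have dg := fun a b => differentiableAt_of_contDiffOn H.base.isOpen (H.base.contDiffOn a b) hy
  have dAG : ∀ i j, DifferentiableAt ℝ (fun z => ((A z)ᵀ * G z) i j) (baseProj y) := fun i j =>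
    differentiableAt_of_contDiffOn H.base.isOpen (contDiffOn_matrix_mul (A := fun z => (A z)ᵀ)
      (fun a b => H.smooth_conn b a) H.smooth_fiber i j) hy
  have dAGA : ∀ i j, DifferentiableAt ℝ (fun z => ((A z)ᵀ * G z * A z) i j) (baseProj y) :=
    fun i j => differentiableAt_of_contDiffOn H.base.isOpen (contDiffOn_matrix_mul
      (contDiffOn_matrix_mul (A := fun z => (A z)ᵀ)
      (fun a b => H.smooth_conn b a) H.smooth_fiber) H.smooth_conn i j) hy
  have h0 : ∀ a, matPartial a (fun z => (A z)ᵀ * G z * A z) (baseProj y) = 0 := by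
    intro a
    rw [matPartial_mul dAG dA, matPartial_mul (A := fun z => (A z)ᵀ) (fun a b => dA b a) dG, hA]
    simp
  have hd : ∀ a i j, partialDeriv a (fun z => (g z + (A z)ᵀ * G z * A z) i j) (baseProj y)
      = partialDeriv a (fun z => g z i j) (baseProj y) := by
    intro a i j
    simp only [Matrix.add_apply]
    rw [partialDeriv_add (dg i j) (dAGA i j)]
    have := congrFun (congrFun (h0 a) i) j
    simp only [matPartial, Matrix.of_apply, Matrix.zero_apply] at this
    rw [this, add_zero]
  have hl : ∀ c, christoffelLower (fun z => g z + (A z)ᵀ * G z * A z) c a b (baseProj y)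
      = christoffelLower g c a b (baseProj y) := by
    intro c
    simp only [christoffelLower, hd]
  simp [H.lower_bbb hy, hl]

end Gauge
end AdaptedOn
end Adapted

/-! ### The Laplacian as a divergence. -/

section Laplacian

variable {ι : Type*} [Fintype ι] [DecidableEq ι] {g : EuclideanSpace ℝ ι → Matrix ι ι ℝ}
  {V : Set (EuclideanSpace ℝ ι)} {z : EuclideanSpace ℝ ι}

/-- The divergence form of the Laplacian. -/
theorem SmoothMetricOn.laplacian_eq_div (hg : SmoothMetricOn g V) (hz : z ∈ V)
    {f : EuclideanSpace ℝ ι → ℝ} (hf : ContDiffOn ℝ ∞ f V) :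
    ∑ a, partialDeriv a (fun w => ∑ b, (g w)⁻¹ a b * partialDeriv b f w) z
      + ∑ c, ∑ b, (∑ a, christoffel g a a c z) * ((g z)⁻¹ c b * partialDeriv b f z)
      = coordLaplacian g f z := by
  have di := fun a b => differentiableAt_of_contDiffOn hg.isOpen (hg.contDiffOn_inv a b) hz
  have df := fun b => differentiableAt_of_contDiffOn hg.isOpen
    (contDiffOn_partialDeriv hg.isOpen hf b) hz
  have h1 : ∀ a, partialDeriv a (fun w => ∑ b, (g w)⁻¹ a b * partialDeriv b f w) z
      = ∑ b, (partialDeriv a (fun w => (g w)⁻¹ a b) z * partialDeriv b f z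
        + (g z)⁻¹ a b * partialDeriv a (partialDeriv b f) z) := by
    intro a
    rw [partialDeriv_sum (F := fun b w => (g w)⁻¹ a b * partialDeriv b f w)
      fun b _ => (di a b).mul (df b)]
    exact Finset.sum_congr rfl fun b _ => partialDeriv_mul (di a b) (df b) a
  have hinv : ∀ a b c, partialDeriv a (fun w => (g w)⁻¹ b c) z
      = - ∑ i, ∑ j, (g z)⁻¹ b i * partialDeriv a (fun w => g w i j) z * (g z)⁻¹ j c := by
    intro a b c
    have h := congrFun (congrFun (matPartial_inv hg.isOpen hg.contDiffOn hg.det_ne_zero hz a) b) c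
    rw [matPartial, Matrix.of_apply] at h
    rw [h]
    simp only [Matrix.neg_apply, Matrix.mul_apply, Finset.sum_mul, matPartial, Matrix.of_apply]
    rw [Finset.sum_comm]
  -- the divergence of the inverse metric
  have key : ∀ b, ∑ a, partialDeriv a (fun w => (g w)⁻¹ a b) z
      + ∑ c, (∑ a, christoffel g a a c z) * (g z)⁻¹ c b
      = - ∑ i, ∑ j, (g z)⁻¹ i j * christoffel g b i j z := by
    intro b
    -- Metric compatibility splits ∂g into two lowered symbols: the first is cancelled by the trace
    -- term `e2`, the second gives the right side through `e3`.
    have e1 : ∑ a, partialDeriv a (fun w => (g w)⁻¹ a b) z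
        = - ∑ a, ∑ i, ∑ j, (g z)⁻¹ a i * (g z)⁻¹ j b *
          (christoffelLower g i a j z + christoffelLower g j a i z) := by
      simp only [hinv, Finset.sum_neg_distrib, hg.christoffelLower_add hz]
      congr 1
      exact Finset.sum_congr rfl fun a _ => Finset.sum_congr rfl fun i _ =>
        Finset.sum_congr rfl fun j _ => by ring
    have e2 : ∑ c, (∑ a, christoffel g a a c z) * (g z)⁻¹ c b
        = ∑ a, ∑ i, ∑ j, (g z)⁻¹ a i * (g z)⁻¹ j b * christoffelLower g i a j z := by
      simp only [christoffel_eq_sum, Finset.sum_mul]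
      rw [Finset.sum_comm]
      refine Finset.sum_congr rfl fun a _ => ?_
      rw [Finset.sum_comm]
      exact Finset.sum_congr rfl fun i _ => Finset.sum_congr rfl fun j _ => by ring
    have e3 : ∑ i, ∑ j, (g z)⁻¹ i j * christoffel g b i j z
        = ∑ a, ∑ i, ∑ j, (g z)⁻¹ a i * (g z)⁻¹ j b * christoffelLower g j a i z := by
      simp only [christoffel_eq_sum, Finset.mul_sum]
      refine Finset.sum_congr rfl fun a _ => Finset.sum_congr rfl fun i _ =>
        Finset.sum_congr rfl fun j _ => ?_
      rw [hg.inv_symm hz b j]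
      ring
    rw [e1, e2, e3]
    simp only [mul_add, Finset.sum_add_distrib]
    ring
  have e4 : coordLaplacian g f z
      = ∑ a, ∑ b, (g z)⁻¹ a b * partialDeriv a (partialDeriv b f) z
        + ∑ b, (- ∑ i, ∑ j, (g z)⁻¹ i j * christoffel g b i j z) * partialDeriv b f z := by
    simp only [coordLaplacian, mul_sub, Finset.sum_sub_distrib, neg_mul, Finset.sum_neg_distrib,
      Finset.mul_sum, Finset.sum_mul]
    rw [sub_eq_add_neg]
    congr 2
    calc _ = ∑ i, ∑ b, ∑ j, (g z)⁻¹ i j * (christoffel g b i j z * partialDeriv b f z) :=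
          Finset.sum_congr rfl fun i _ => Finset.sum_comm
      _ = _ := by
          rw [Finset.sum_comm]
          exact Finset.sum_congr rfl fun b _ => Finset.sum_congr rfl fun i _ =>
            Finset.sum_congr rfl fun j _ => by ring
  rw [e4]
  simp only [h1, Finset.sum_add_distrib, ← key, add_mul, Finset.sum_mul]
  rw [Finset.sum_comm (f := fun a b => partialDeriv a (fun w => (g w)⁻¹ a b) z * _)]
  have e5 : ∑ c, ∑ b, ∑ a, christoffel g a a c z * ((g z)⁻¹ c b * partialDeriv b f z)
      = ∑ b, ∑ c, ∑ a, christoffel g a a c z * (g z)⁻¹ c b * partialDeriv b f z := by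
    rw [Finset.sum_comm]
    exact Finset.sum_congr rfl fun b _ => Finset.sum_congr rfl fun i _ =>
            Finset.sum_congr rfl fun j _ => by ring
  rw [e5]
  ring

end Laplacian

/-! ### Ricci curvature along the fibers and the equation for the volume density. -/

section FiberRicci

variable {κ ι : Type*} [Fintype κ] [DecidableEq κ] [Fintype ι] [DecidableEq ι]
variable {G : EuclideanSpace ℝ ι → Matrix κ κ ℝ} {A : EuclideanSpace ℝ ι → Matrix κ ι ℝ}
  {g : EuclideanSpace ℝ ι → Matrix ι ι ℝ} {V : Set (EuclideanSpace ℝ ι)}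

/-- Half the logarithmic derivative of `det G`. -/
def halfLogDeriv (G : EuclideanSpace ℝ ι → Matrix κ κ ℝ) (a : ι) (z : EuclideanSpace ℝ ι) : ℝ :=
  (1 / 2) * ((G z)⁻¹ * matPartial a G z).trace

namespace AdaptedOn

variable (H : AdaptedOn G A g V)
include H

theorem contDiffOn_matPartial (a : ι) (i j : κ) :
    ContDiffOn ℝ ∞ (fun z => matPartial a G z i j) V :=
  contDiffOn_partialDeriv H.base.isOpen (H.smooth_fiber i j) a

theorem contDiffOn_inv_fiber (i j : κ) : ContDiffOn ℝ ∞ (fun z => (G z)⁻¹ i j) V :=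
  contDiffOn_matrix_inv H.smooth_fiber (fun _ hz => H.det_ne_zero hz) i j

theorem contDiffOn_halfLogDeriv (a : ι) : ContDiffOn ℝ ∞ (halfLogDeriv G a) V :=
  contDiffOn_const.mul (ContDiffOn.sum fun i _ =>
    contDiffOn_matrix_mul H.contDiffOn_inv_fiber (H.contDiffOn_matPartial a) i i)

/-- The Ricci curvature in the direction of the fibers. -/
theorem ricci_fiber {y : EuclideanSpace ℝ (κ ⊕ ι)} (hy : baseProj y ∈ V)
    (hA : A (baseProj y) = 0) (i j : κ) :
    ricci (fun y => adaptedMetric (G (baseProj y)) (A (baseProj y)) (g (baseProj y)))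
      (Sum.inl i) (Sum.inl j) y
      = - (1 / 2) * coordLaplacian g (fun z => G z i j) (baseProj y)
        - (1 / 2) * ∑ a, ∑ b, halfLogDeriv G a (baseProj y) * ((g (baseProj y))⁻¹ a b
          * matPartial b G (baseProj y) i j)
        + (1 / 2) * ∑ a, ∑ b, (g (baseProj y))⁻¹ a b
          * (matPartial a G (baseProj y) * (G (baseProj y))⁻¹ * matPartial b G (baseProj y)) i j
        - ((g (baseProj y))⁻¹ * connCurvature G A (baseProj y) i
          * ((g (baseProj y))⁻¹ * connCurvature G A (baseProj y) j)).trace := by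
  set h := fun y : EuclideanSpace ℝ (κ ⊕ ι) =>
    adaptedMetric (G (baseProj y)) (A (baseProj y)) (g (baseProj y)) with hh
  have hsm : SmoothMetricOn h (baseProj ⁻¹' V) := H.smoothMetricOn
  -- All coefficients depend on the base point only, so every derivative along the fiber vanishes.
  have t1 : ∀ k i j : κ ⊕ ι, ∀ l : κ, partialDeriv (Sum.inl l) (christoffel h k i j) y = 0 :=
    fun k i j l => (isBaseFunction_christoffel (κ := κ)
      (fun z => adaptedMetric (G z) (A z) (g z)) k i j).partialDeriv_inl l y
  have t2 : ∀ a, partialDeriv (Sum.inr a) (christoffel h (Sum.inr a) (Sum.inl i) (Sum.inl j)) y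
      = - (1 / 2) * partialDeriv a (fun w => ∑ b, (g w)⁻¹ a b
        * partialDeriv b (fun z => G z i j) w) (baseProj y) := by
    intro a
    have d : DifferentiableAt ℝ (fun w => ∑ b, (g w)⁻¹ a b
        * partialDeriv b (fun z => G z i j) w) (baseProj y) :=
      differentiableAt_of_contDiffOn H.base.isOpen (ContDiffOn.sum fun b _ =>
        (H.base.contDiffOn_inv a b).mul (H.contDiffOn_matPartial b i j)) hy
    rw [← partialDeriv_const_mul _ d, ← partialDeriv_inr_comp (κ := κ) (d.const_mul _)]
    refine partialDeriv_congr ?_ _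
    filter_upwards [hsm.isOpen.mem_nhds hy] with x hx using H.christoffel_bff hx a i j
  have s1 := fun k i b => hsm.christoffel_symm hy k (Sum.inr b) (Sum.inl i)
  have e1 := H.christoffel_fff hy hA
  have e2 := H.christoffel_ffb hy hA
  have e3 := H.christoffel_bfb hy hA
  have e4 := H.christoffel_bff hy
  have e5 := H.christoffel_bbb hy hA
  rw [← hh] at e1 e2 e3 e4 e5
  simp only [ricci, Fintype.sum_sum_type, t1, t2, e1, e2, e3, e4, e5, s1]
  -- The divergence of the symbols with upper base index and lower fiber indices, together with the
  -- base trace term `p4`, is -1/2 times the Laplacian of the entry of G.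
  rw [← H.base.laplacian_eq_div hy (H.smooth_fiber i j)]
  generalize baseProj y = z at *
  simp only [Finset.sum_const_zero, zero_add, sub_zero, mul_zero, add_zero]
  have hgs := H.base.inv_symm hy
  have hGs : ∀ a, (matPartial a G z)ᵀ = matPartial a G z := by
    intro a
    ext i j
    exact partialDeriv_congr (by
      filter_upwards [H.base.isOpen.mem_nhds hy] with w hw using H.symm hw j i) a
  have hGi : ((G z)⁻¹)ᵀ = (G z)⁻¹ := by rw [Matrix.transpose_nonsing_inv, H.transpose_eq hy]
  have hflip : ∀ a x i, ((G z)⁻¹ * matPartial a G z) x i = (matPartial a G z * (G z)⁻¹) i x := by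
    intro a x i
    rw [← Matrix.transpose_apply (matPartial a G z * (G z)⁻¹), Matrix.transpose_mul, hGs, hGi]
  -- `p1` is the fiber trace, a logarithmic derivative of det G. The mixed products `p2` and `p3`
  -- are equal and combine to the term ∂G G⁻¹ ∂G; `p5` is the curvature term.
  have p1 : ∑ x, ∑ c, 1 / 2 * ((G z)⁻¹ * matPartial c G z) x x *
      (-(1 / 2) * ∑ d, (g z)⁻¹ c d * partialDeriv d (fun z => G z i j) z)
      = - (1 / 2) * ∑ a, ∑ b, halfLogDeriv G a z * ((g z)⁻¹ a b * matPartial b G z i j) := by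
    rw [Finset.sum_comm, Finset.mul_sum]
    refine Finset.sum_congr rfl fun a _ => ?_
    rw [← Finset.sum_mul, ← Finset.mul_sum, ← Finset.mul_sum]
    simp only [halfLogDeriv, Matrix.trace, Matrix.diag, matPartial, Matrix.of_apply]
    ring
  have p2 : ∑ x, ∑ c, 1 / 2 * ((G z)⁻¹ * matPartial c G z) x i *
      (-(1 / 2) * ∑ d, (g z)⁻¹ c d * partialDeriv d (fun z => G z x j) z)
      = - (1 / 4) * ∑ a, ∑ b, (g z)⁻¹ a b
        * (matPartial a G z * (G z)⁻¹ * matPartial b G z) i j := by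
    rw [Finset.sum_comm, Finset.mul_sum]
    refine Finset.sum_congr rfl fun a _ => ?_
    simp only [hflip, Finset.mul_sum]
    rw [Finset.sum_comm]
    refine Finset.sum_congr rfl fun b _ => ?_
    rw [Matrix.mul_apply (M := matPartial a G z * (G z)⁻¹), Finset.mul_sum, Finset.mul_sum]
    refine Finset.sum_congr rfl fun x _ => ?_
    simp only [matPartial, Matrix.of_apply]
    ring
  have p3 : ∑ c, ∑ x, -(1 / 2) * (∑ d, (g z)⁻¹ c d * partialDeriv d (fun z => G z i x) z) *
      (1 / 2 * ((G z)⁻¹ * matPartial c G z) x j)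
      = - (1 / 4) * ∑ a, ∑ b, (g z)⁻¹ a b
        * (matPartial a G z * (G z)⁻¹ * matPartial b G z) i j := by
    rw [Finset.sum_comm (f := fun a b => (g z)⁻¹ a b * _), Finset.mul_sum]
    refine Finset.sum_congr rfl fun c _ => ?_
    simp only [Finset.mul_sum, Finset.sum_mul]
    rw [Finset.sum_comm]
    refine Finset.sum_congr rfl fun d _ => ?_
    rw [Matrix.mul_assoc, Matrix.mul_apply (M := matPartial d G z), Finset.mul_sum, Finset.mul_sum]
    refine Finset.sum_congr rfl fun x _ => ?_
    rw [hgs d c]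
    simp only [matPartial, Matrix.of_apply]
    ring
  have p4 : ∑ x, ∑ c, christoffel g x x c z *
      (-(1 / 2) * ∑ d, (g z)⁻¹ c d * partialDeriv d (fun z => G z i j) z)
      = - (1 / 2) * ∑ c, ∑ b, (∑ a, christoffel g a a c z)
        * ((g z)⁻¹ c b * partialDeriv b (fun z => G z i j) z) := by
    rw [Finset.sum_comm, Finset.mul_sum]
    refine Finset.sum_congr rfl fun c _ => ?_
    rw [← Finset.sum_mul, ← Finset.mul_sum]
    ring
  have p5 : ∑ x, ∑ c, ((g z)⁻¹ * connCurvature G A z i) x c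
      * ((g z)⁻¹ * connCurvature G A z j) c x
      = ((g z)⁻¹ * connCurvature G A z i * ((g z)⁻¹ * connCurvature G A z j)).trace := by
    simp only [Matrix.trace, Matrix.diag]
    exact Finset.sum_congr rfl fun x _ => (Matrix.mul_apply ..).symm
  simp only [Finset.sum_sub_distrib, Finset.sum_add_distrib, zero_sub, Finset.sum_neg_distrib, p1,
    p2, p3, p4, p5, ← Finset.mul_sum]
  ring

theorem partialDeriv_sqrt_det {z : EuclideanSpace ℝ ι} (hz : z ∈ V) (a : ι) :
    partialDeriv a (fun w => √(G w).det) z = √(G z).det * halfLogDeriv G a z := by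
  have hpos := (H.posDef z hz).det_pos
  have hd : DifferentiableAt ℝ (fun w => (G w).det) z :=
    differentiableAt_of_contDiffOn H.base.isOpen (contDiffOn_det H.smooth_fiber) hz
  have h := hd.hasFDerivAt.sqrt hpos.ne'
  have hj := partialDeriv_det H.base.isOpen H.smooth_fiber (fun _ hw => H.det_ne_zero hw) hz a
  simp only [partialDeriv] at hj ⊢
  rw [h.fderiv, _root_.smul_apply, hj, halfLogDeriv, smul_eq_mul]
  have hs := Real.mul_self_sqrt hpos.le
  have hs0 := (Real.sqrt_pos.2 hpos).ne'
  field_simp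
  rw [sq, hs]

theorem contDiffOn_sqrt_det : ContDiffOn ℝ ∞ (fun w => √(G w).det) V :=
  (contDiffOn_det H.smooth_fiber).sqrt fun _ hz => H.det_ne_zero hz

theorem partialDeriv_halfLogDeriv {z : EuclideanSpace ℝ ι} (hz : z ∈ V) (a b : ι) :
    partialDeriv b (halfLogDeriv G a) z
      = (1 / 2) * ((G z)⁻¹ * matPartial b (matPartial a G) z).trace
        - (1 / 2) * ((G z)⁻¹ * matPartial b G z * (G z)⁻¹ * matPartial a G z).trace := by
  have h := matPartial_mul (y := z) (A := fun w => (G w)⁻¹) (A' := matPartial a G)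
    (fun i j => differentiableAt_of_contDiffOn H.base.isOpen (H.contDiffOn_inv_fiber i j) hz)
    (fun i j => differentiableAt_of_contDiffOn H.base.isOpen (H.contDiffOn_matPartial a i j) hz) b
  rw [matPartial_inv H.base.isOpen H.smooth_fiber (fun _ hw => H.det_ne_zero hw) hz] at h
  have hd : ∀ i, DifferentiableAt ℝ (fun w => ((G w)⁻¹ * matPartial a G w) i i) z := fun i =>
    differentiableAt_of_contDiffOn H.base.isOpen (contDiffOn_matrix_mul H.contDiffOn_inv_fiber
      (H.contDiffOn_matPartial a) i i) hz
  have h2 : partialDeriv b (halfLogDeriv G a) z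
      = (1 / 2) * (matPartial b (fun w => (G w)⁻¹ * matPartial a G w) z).trace := by
    change partialDeriv b (fun w => (1 / 2 : ℝ) * ∑ i, ((G w)⁻¹ * matPartial a G w) i i) z = _
    rw [partialDeriv_const_mul _ (DifferentiableAt.fun_sum fun i _ => hd i),
      partialDeriv_sum fun i _ => hd i]
    rfl
  rw [h2, h, Matrix.trace_add, Matrix.neg_mul, Matrix.trace_neg]
  ring

/-- With h the half logarithmic derivative, the second derivatives of √det G are √det G (h h + ∂h).
Here ∂h contains tr(G⁻¹∂∂G), which the Christoffel terms complete to tr(G⁻¹ΔG), and a term quadratic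
in ∂G. -/
theorem laplacian_sqrt_det {z : EuclideanSpace ℝ ι} (hz : z ∈ V) :
    coordLaplacian g (fun w => √(G w).det) z
      = √(G z).det * ((1 / 2) * ∑ i, ∑ j, (G z)⁻¹ i j * coordLaplacian g (fun w => G w j i) z
        + ∑ a, ∑ b, (g z)⁻¹ a b * (halfLogDeriv G a z * halfLogDeriv G b z
          - (1 / 2) * ((G z)⁻¹ * matPartial a G z * (G z)⁻¹ * matPartial b G z).trace)) := by
  have h1 : ∀ a b, partialDeriv a (partialDeriv b fun w => √(G w).det) z
      = √(G z).det * (halfLogDeriv G a z * halfLogDeriv G b z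
        + partialDeriv a (halfLogDeriv G b) z) := by
    intro a b
    have h2 : partialDeriv b (fun w => √(G w).det) =ᶠ[𝓝 z]
        fun w => √(G w).det * halfLogDeriv G b w := by
      filter_upwards [H.base.isOpen.mem_nhds hz] with w hw using H.partialDeriv_sqrt_det hw b
    rw [partialDeriv_congr h2, partialDeriv_mul
      (differentiableAt_of_contDiffOn H.base.isOpen H.contDiffOn_sqrt_det hz)
      (differentiableAt_of_contDiffOn H.base.isOpen (H.contDiffOn_halfLogDeriv b) hz),
      H.partialDeriv_sqrt_det hz]
    ring
  have h3 : ∑ i, ∑ j, (G z)⁻¹ i j * coordLaplacian g (fun w => G w j i) z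
      = ∑ a, ∑ b, (g z)⁻¹ a b * (((G z)⁻¹ * matPartial a (matPartial b G) z).trace
        - ∑ c, christoffel g c a b z * (2 * halfLogDeriv G c z)) := by
    have h4 : ∀ c, 2 * halfLogDeriv G c z = ((G z)⁻¹ * matPartial c G z).trace := fun c => by
      rw [halfLogDeriv]; ring
    have h5 : ∀ i j, (G z)⁻¹ i j * coordLaplacian g (fun w => G w j i) z
        = ∑ a, ∑ b, (g z)⁻¹ a b * ((G z)⁻¹ i j * matPartial a (matPartial b G) z j i
          - ∑ c, christoffel g c a b z * ((G z)⁻¹ i j * matPartial c G z j i)) := by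
      intro i j
      simp only [coordLaplacian, Finset.mul_sum, mul_sub, matPartial, Matrix.of_apply]
      refine Finset.sum_congr rfl fun a _ => Finset.sum_congr rfl fun b _ => ?_
      congr 1
      · ring
      · exact Finset.sum_congr rfl fun c _ => by ring
    simp only [h4, h5]
    simp only [Matrix.trace, Matrix.diag, Matrix.mul_apply]
    rw [Finset.sum_congr rfl fun i _ => Finset.sum_comm, Finset.sum_comm]
    refine Finset.sum_congr rfl fun a _ => ?_
    rw [Finset.sum_congr rfl fun i _ => Finset.sum_comm, Finset.sum_comm]
    refine Finset.sum_congr rfl fun b _ => ?_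
    simp only [← Finset.mul_sum, Finset.sum_sub_distrib]
    congr 2
    rw [Finset.sum_congr rfl fun i _ => Finset.sum_comm, Finset.sum_comm]
    simp only [← Finset.mul_sum]
  rw [h3, Finset.mul_sum, ← Finset.sum_add_distrib, coordLaplacian, Finset.mul_sum]
  refine Finset.sum_congr rfl fun a _ => ?_
  rw [Finset.mul_sum, ← Finset.sum_add_distrib, Finset.mul_sum]
  refine Finset.sum_congr rfl fun b _ => ?_
  have h6 : ∑ c, christoffel g c a b z * partialDeriv c (fun w => √(G w).det) z
      = √(G z).det * ∑ c, christoffel g c a b z * halfLogDeriv G c z := by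
    rw [Finset.mul_sum]
    refine Finset.sum_congr rfl fun c _ => ?_
    rw [H.partialDeriv_sqrt_det hz]; ring
  have h7 : ∑ c, christoffel g c a b z * (2 * halfLogDeriv G c z)
      = 2 * ∑ c, christoffel g c a b z * halfLogDeriv G c z := by
    rw [Finset.mul_sum]
    exact Finset.sum_congr rfl fun c _ => by ring
  rw [h1, h6, h7, H.partialDeriv_halfLogDeriv hz]
  ring

/-- The trace of the Ricci curvature along the fibers. -/
theorem laplacian_sqrt_det_eq {y : EuclideanSpace ℝ (κ ⊕ ι)} (hy : baseProj y ∈ V)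
    (hA : A (baseProj y) = 0) :
    coordLaplacian g (fun w => √(G w).det) (baseProj y)
      = - √(G (baseProj y)).det * ∑ i, ∑ j, (G (baseProj y))⁻¹ i j *
        (ricci (fun y => adaptedMetric (G (baseProj y)) (A (baseProj y)) (g (baseProj y)))
          (Sum.inl j) (Sum.inl i) y
        + ((g (baseProj y))⁻¹ * connCurvature G A (baseProj y) j
          * ((g (baseProj y))⁻¹ * connCurvature G A (baseProj y) i)).trace) := by
  rw [H.laplacian_sqrt_det hy]
  simp only [H.ricci_fiber hy hA]
  generalize baseProj y = z at *
  -- Traced against G⁻¹, the terms of `ricci_fiber` quadratic in ∂G match those of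
  -- `laplacian_sqrt_det`. All of them cancel, leaving only the Ricci and curvature terms.
  have q1 : ∑ i, ∑ j, (G z)⁻¹ i j * ∑ a, ∑ b, halfLogDeriv G a z * ((g z)⁻¹ a b
      * matPartial b G z j i)
      = 2 * ∑ a, ∑ b, (g z)⁻¹ a b * (halfLogDeriv G a z * halfLogDeriv G b z) := by
    simp only [Finset.mul_sum]
    rw [Finset.sum_congr rfl fun i _ => Finset.sum_comm, Finset.sum_comm]
    refine Finset.sum_congr rfl fun a _ => ?_
    rw [Finset.sum_congr rfl fun i _ => Finset.sum_comm, Finset.sum_comm]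
    refine Finset.sum_congr rfl fun b _ => ?_
    rw [halfLogDeriv.eq_def G b]
    simp only [Matrix.trace, Matrix.diag, Matrix.mul_apply, Finset.mul_sum]
    exact Finset.sum_congr rfl fun i _ => Finset.sum_congr rfl fun j _ => by ring
  have q2 : ∑ i, ∑ j, (G z)⁻¹ i j * ∑ a, ∑ b, (g z)⁻¹ a b
      * (matPartial a G z * (G z)⁻¹ * matPartial b G z) j i
      = ∑ a, ∑ b, (g z)⁻¹ a b
        * ((G z)⁻¹ * matPartial a G z * (G z)⁻¹ * matPartial b G z).trace := by
    simp only [Finset.mul_sum]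
    rw [Finset.sum_congr rfl fun i _ => Finset.sum_comm, Finset.sum_comm]
    refine Finset.sum_congr rfl fun a _ => ?_
    rw [Finset.sum_congr rfl fun i _ => Finset.sum_comm, Finset.sum_comm]
    refine Finset.sum_congr rfl fun b _ => ?_
    have q0 : (G z)⁻¹ * matPartial a G z * (G z)⁻¹ * matPartial b G z
        = (G z)⁻¹ * (matPartial a G z * (G z)⁻¹ * matPartial b G z) := by
      simp only [Matrix.mul_assoc]
    rw [q0]
    simp only [Matrix.trace, Matrix.diag,
      Matrix.mul_apply (M := (G z)⁻¹) (N := matPartial a G z * (G z)⁻¹ * matPartial b G z),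
      Finset.mul_sum]
    exact Finset.sum_congr rfl fun i _ => Finset.sum_congr rfl fun j _ => by ring
  have q3 : ∀ i j, (G z)⁻¹ i j * (-(1 / 2) * coordLaplacian g (fun w => G w j i) z
      - (1 / 2) * ∑ a, ∑ b, halfLogDeriv G a z * ((g z)⁻¹ a b * matPartial b G z j i)
      + (1 / 2) * ∑ a, ∑ b, (g z)⁻¹ a b
        * (matPartial a G z * (G z)⁻¹ * matPartial b G z) j i
      - ((g z)⁻¹ * connCurvature G A z j * ((g z)⁻¹ * connCurvature G A z i)).trace
      + ((g z)⁻¹ * connCurvature G A z j * ((g z)⁻¹ * connCurvature G A z i)).trace)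
      = -(1 / 2) * ((G z)⁻¹ i j * coordLaplacian g (fun w => G w j i) z)
      - (1 / 2) * ((G z)⁻¹ i j * ∑ a, ∑ b, halfLogDeriv G a z * ((g z)⁻¹ a b
        * matPartial b G z j i))
      + (1 / 2) * ((G z)⁻¹ i j * ∑ a, ∑ b, (g z)⁻¹ a b
        * (matPartial a G z * (G z)⁻¹ * matPartial b G z) j i) := fun i j => by ring
  have q5 : ∀ X Y Z : κ → κ → ℝ, ∑ i, ∑ j, (-(1 / 2) * X i j - (1 / 2) * Y i j + (1 / 2) * Z i j)
      = -(1 / 2) * (∑ i, ∑ j, X i j) - (1 / 2) * (∑ i, ∑ j, Y i j)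
        + (1 / 2) * ∑ i, ∑ j, Z i j := fun X Y Z => by
    simp only [Finset.sum_add_distrib, Finset.sum_sub_distrib, Finset.mul_sum]
  simp only [q3]
  rw [q5, q1, q2]
  simp only [mul_sub, Finset.sum_sub_distrib]
  have q4 : ∑ a, ∑ b, (g z)⁻¹ a b
      * (1 / 2 * ((G z)⁻¹ * matPartial a G z * (G z)⁻¹ * matPartial b G z).trace)
      = 1 / 2 * ∑ a, ∑ b, (g z)⁻¹ a b
        * ((G z)⁻¹ * matPartial a G z * (G z)⁻¹ * matPartial b G z).trace := by
    simp only [Finset.mul_sum]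
    exact Finset.sum_congr rfl fun i _ => Finset.sum_congr rfl fun j _ => by ring
  rw [q4]
  ring

end AdaptedOn
end FiberRicci

/-! ### Ricci curvature along the base, and changes of gauge. -/

section BaseRicci

variable {κ ι : Type*} [Fintype κ] [DecidableEq κ] [Fintype ι] [DecidableEq ι]
variable {G : EuclideanSpace ℝ ι → Matrix κ κ ℝ} {A : EuclideanSpace ℝ ι → Matrix κ ι ℝ}
  {g : EuclideanSpace ℝ ι → Matrix ι ι ℝ} {V : Set (EuclideanSpace ℝ ι)}

namespace AdaptedOn

variable (H : AdaptedOn G A g V)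
include H

/-- The Ricci curvature in the direction of the base, if the connection is flat and `det G` is
constant. -/
theorem ricci_base {y : EuclideanSpace ℝ (κ ⊕ ι)} (hy : baseProj y ∈ V)
    (hA : ∀ z ∈ V, A z = 0) (hdet : ∀ z ∈ V, ∀ a, halfLogDeriv G a z = 0) (a b : ι) :
    ricci (fun y => adaptedMetric (G (baseProj y)) (A (baseProj y)) (g (baseProj y)))
      (Sum.inr a) (Sum.inr b) y
      = ricci g a b (baseProj y)
        - (1 / 4) * ((G (baseProj y))⁻¹ * matPartial a G (baseProj y) * (G (baseProj y))⁻¹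
          * matPartial b G (baseProj y)).trace := by
  set h := fun y : EuclideanSpace ℝ (κ ⊕ ι) =>
    adaptedMetric (G (baseProj y)) (A (baseProj y)) (g (baseProj y)) with hh
  have hsm : SmoothMetricOn h (baseProj ⁻¹' V) := H.smoothMetricOn
  have hA0 : ∀ k c a, partialDeriv a (fun z => A z k c) (baseProj y) = 0 := fun k c a => by
    rw [← partialDeriv_const (y := baseProj y) 0 a]
    exact partialDeriv_congr (by
      filter_upwards [H.base.isOpen.mem_nhds hy] with z hz using by rw [hA z hz]; rfl) a
  have hcurv : ∀ i, connCurvature G A (baseProj y) i = 0 := by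
    intro i
    ext c b
    simp [connCurvature, hA0, Matrix.mul_apply]
  have t1 : ∀ k i j : κ ⊕ ι, ∀ l : κ, partialDeriv (Sum.inl l) (christoffel h k i j) y = 0 :=
    fun k i j l => (isBaseFunction_christoffel (κ := κ)
      (fun z => adaptedMetric (G z) (A z) (g z)) k i j).partialDeriv_inl l y
  have t2 : ∀ a c d e, partialDeriv (Sum.inr a) (christoffel h (Sum.inr c) (Sum.inr d) (Sum.inr e)) y
      = partialDeriv a (christoffel g c d e) (baseProj y) := by
    intro a c d e
    have dd : DifferentiableAt ℝ (christoffel g c d e) (baseProj y) :=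
      differentiableAt_of_contDiffOn H.base.isOpen (H.base.contDiffOn_christoffel c d e) hy
    rw [← partialDeriv_inr_comp (κ := κ) dd]
    refine partialDeriv_congr ?_ _
    filter_upwards [hsm.isOpen.mem_nhds hy] with x hx using
      H.christoffel_bbb hx (hA _ hx) c d e
  -- The sum over the fiber indices is the half logarithmic derivative of det G, which vanishes near
  -- the point and hence has zero derivative; the individual summands need not vanish.
  have t3 : ∑ k : κ, partialDeriv (Sum.inr a) (christoffel h (Sum.inl k) (Sum.inl k) (Sum.inr b)) y
      = 0 := by
    rw [← partialDeriv_sum fun k _ => differentiableAt_of_contDiffOn hsm.isOpen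
      (hsm.contDiffOn_christoffel _ _ _) hy, ← partialDeriv_const (y := y) 0 (Sum.inr a)]
    refine partialDeriv_congr ?_ _
    filter_upwards [hsm.isOpen.mem_nhds hy] with x hx
    simp only [hh, H.christoffel_ffb hx (hA _ hx)]
    rw [← Finset.mul_sum]
    exact hdet _ hx b
  -- The mixed entries of the metric vanish identically near the point, so their derivatives do as
  -- well.
  have t4 : ∀ (l : κ) (a b : ι), christoffel h (Sum.inl l) (Sum.inr a) (Sum.inr b) y = 0 := by
    intro l a b
    rw [christoffel_eq_sum, Fintype.sum_sum_type, hh]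
    simp only [H.inv_of_gauge hy (hA _ hy)]
    have t5 : ∀ a b l, partialDeriv (Sum.inr a) (fun x : EuclideanSpace ℝ (κ ⊕ ι) =>
        adaptedMetric (G (baseProj x)) (A (baseProj x)) (g (baseProj x)) (Sum.inr b) (Sum.inl l)) y
        = 0 := by
      intro a b l
      rw [← partialDeriv_const (y := y) 0 (Sum.inr a)]
      refine partialDeriv_congr ?_ _
      filter_upwards [hsm.isOpen.mem_nhds hy] with x hx
      rw [hA _ hx]
      simp [adaptedMetric]
    simp [christoffelLower, t5, partialDeriv_adapted_inl]
  have s1 := fun k i b => hsm.christoffel_symm hy k (Sum.inr b) (Sum.inl i)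
  have e2 := H.christoffel_ffb hy (hA _ hy)
  have e3 := H.christoffel_bfb hy (hA _ hy)
  have e5 := H.christoffel_bbb hy (hA _ hy)
  have e6 : ∀ c, ∑ k : κ, (1 / 2) * ((G (baseProj y))⁻¹ * matPartial c G (baseProj y)) k k = 0 := by
    intro c
    rw [← Finset.mul_sum]
    exact hdet _ hy c
  rw [← hh] at e2 e3 e5
  simp only [hcurv] at e3
  simp only [ricci, Fintype.sum_sum_type, t1, t2, t3, t4, e2, e3, e5, s1]
  generalize baseProj y = z at *
  simp only [Finset.sum_const_zero, zero_add, sub_zero, mul_zero, Matrix.zero_apply, Finset.sum_sub_distrib, Finset.sum_add_distrib, zero_sub,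
    Finset.sum_neg_distrib]
  rw [Finset.sum_comm (f := fun (x : κ) (c : ι) => 1 / 2 * ((G z)⁻¹ * matPartial c G z) x x * _)]
  simp only [← Finset.sum_mul, e6]
  have e7 : ((G z)⁻¹ * matPartial a G z * (G z)⁻¹ * matPartial b G z).trace
      = ∑ x, ∑ l, ((G z)⁻¹ * matPartial a G z) x l * ((G z)⁻¹ * matPartial b G z) l x := by
    rw [Matrix.mul_assoc ((G z)⁻¹ * matPartial a G z)]
    rfl
  -- The fiber contributes only this product of two symbols, each of them half of G⁻¹∂G; hence the
  -- factor 1/4.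
  have e8 : ∑ x, ∑ l, 1 / 2 * ((G z)⁻¹ * matPartial a G z) x l
      * (1 / 2 * ((G z)⁻¹ * matPartial b G z) l x)
      = 1 / 4 * ((G z)⁻¹ * matPartial a G z * (G z)⁻¹ * matPartial b G z).trace := by
    rw [e7]
    simp only [Finset.mul_sum]
    exact Finset.sum_congr rfl fun i _ => Finset.sum_congr rfl fun j _ => by ring
  rw [e8]
  simp
  ring

end AdaptedOn

/-- The metric with coefficients `G`, `A`, `g` is Einstein. This is formulated in all gauges
`x ↦ x + q`. -/
structure LocalEinstein (G : EuclideanSpace ℝ ι → Matrix κ κ ℝ)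
    (A : EuclideanSpace ℝ ι → Matrix κ ι ℝ) (g : EuclideanSpace ℝ ι → Matrix ι ι ℝ)
    (V : Set (EuclideanSpace ℝ ι)) (lam : ℝ) : Prop extends AdaptedOn G A g V where
  base_posDef : ∀ z ∈ V, (g z).PosDef
  einstein : ∀ V' ⊆ V, IsOpen V' → ∀ q : κ → EuclideanSpace ℝ ι → ℝ,
    (∀ k, ContDiffOn ℝ ∞ (q k) V') → ∀ z ∈ V', (∀ k, q k z = 0) →
    ∃ y : EuclideanSpace ℝ (κ ⊕ ι), baseProj y = z ∧ ∀ i j,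
      ricci (fun y => adaptedMetric (G (baseProj y)) (A (baseProj y)
        - Matrix.of fun k a => partialDeriv a (q k) (baseProj y)) (g (baseProj y))) i j y
      = lam * adaptedMetric (G z) (A z - Matrix.of fun k a => partialDeriv a (q k) z) (g z) i j

/-- In the coordinate x' = x + q(b), dx + A becomes dx' + (A - dq), while `G` and `g` do not change.
-/
theorem AdaptedOn.gauge (H : AdaptedOn G A g V) {V' : Set (EuclideanSpace ℝ ι)} (hV : V' ⊆ V)
    (hV' : IsOpen V') {q : κ → EuclideanSpace ℝ ι → ℝ} (hq : ∀ k, ContDiffOn ℝ ∞ (q k) V') :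
    AdaptedOn G (fun z => A z - Matrix.of fun k a => partialDeriv a (q k) z) g V' where
  base := ⟨hV', fun i j => (H.base.contDiffOn i j).mono hV, fun z hz => H.base.symm z (hV hz),
    fun z hz => H.base.det_ne_zero z (hV hz)⟩
  smooth_fiber i j := (H.smooth_fiber i j).mono hV
  smooth_conn k a := ((H.smooth_conn k a).mono hV).sub (contDiffOn_partialDeriv hV' (hq k) a)
  posDef z hz := H.posDef z (hV hz)

end BaseRicci

/-! ### The Einstein equation over a surface. -/

section Surface

variable {κ : Type*} [Fintype κ] [DecidableEq κ] {lam : ℝ}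
variable {G : EuclideanSpace ℝ (Fin 2) → Matrix κ κ ℝ}
  {A : EuclideanSpace ℝ (Fin 2) → Matrix κ (Fin 2) ℝ}
  {g : EuclideanSpace ℝ (Fin 2) → Matrix (Fin 2) (Fin 2) ℝ} {V : Set (EuclideanSpace ℝ (Fin 2))}

namespace LocalEinstein

variable (H : LocalEinstein G A g V lam)
include H

/-- On a surface the curvature of the connection is a two-form, so it amounts to one vector, its
component `0 1`. Tracing a product of two skew 2 × 2 matrices produces a minus sign, which is what
makes the curvature term nonnegative. -/
theorem laplacian_sqrt_det_surface {z : EuclideanSpace ℝ (Fin 2)} (hz : z ∈ V) :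
    coordLaplacian g (fun w => √(G w).det) z
      = √(G z).det * (- (Fintype.card κ * lam) + 2 * (g z)⁻¹.det *
        ((fun i => connCurvature G A z i 0 1) ⬝ᵥ (G z)⁻¹ *ᵥ
          (fun i => connCurvature G A z i 0 1))) := by
  -- An affine gauge vanishing at z whose differential is the constant matrix `A z`: it kills A at z
  -- without changing the derivatives of A, hence without changing the curvature.
  let q : κ → EuclideanSpace ℝ (Fin 2) → ℝ := fun k w => ∑ a, A z k a * (w a - z a)
  have hq : ∀ k, ContDiff ℝ ∞ (q k) := fun k => by
    refine ContDiff.sum fun a _ => contDiff_const.mul (ContDiff.sub ?_ contDiff_const)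
    exact contDiff_piLp_apply 2
  have hdq : ∀ k a w, partialDeriv a (q k) w = A z k a := by
    intro k a w
    have d : ∀ b, DifferentiableAt ℝ (fun w : EuclideanSpace ℝ (Fin 2) => w b - z b) w := fun b =>
      (EuclideanSpace.proj b : EuclideanSpace ℝ (Fin 2) →L[ℝ] ℝ).differentiableAt.sub_const _
    have d1 : ∀ b, partialDeriv a (fun w : EuclideanSpace ℝ (Fin 2) => w b - z b) w
        = if a = b then 1 else 0 := by
      intro b
      have : HasFDerivAt (fun w : EuclideanSpace ℝ (Fin 2) => w b - z b)
          (EuclideanSpace.proj b : EuclideanSpace ℝ (Fin 2) →L[ℝ] ℝ) w :=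
        (EuclideanSpace.proj b : EuclideanSpace ℝ (Fin 2) →L[ℝ] ℝ).hasFDerivAt.sub_const _
      rw [partialDeriv, this.fderiv]
      simp [eq_comm]
    simp only [q]
    rw [partialDeriv_sum (F := fun b w => A z k b * (w b - z b)) fun b _ => (d b).const_mul _]
    simp [partialDeriv_const_mul _ (d _), d1]
  obtain ⟨y, hyz, he⟩ := H.einstein V subset_rfl H.base.isOpen q (fun k => (hq k).contDiffOn) z hz
    (fun k => by simp [q])
  subst hyz
  have H' := H.toAdaptedOn.gauge subset_rfl H.base.isOpen (q := q) (fun k => (hq k).contDiffOn)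
  have hA0 : A (baseProj y) - Matrix.of (fun k a => partialDeriv a (q k) (baseProj y)) = 0 := by
    ext k a
    simp [hdq]
  have hcurv : connCurvature G (fun z => A z - Matrix.of fun k a => partialDeriv a (q k) z)
      (baseProj y) = connCurvature G A (baseProj y) := by
    have d : ∀ k b c, partialDeriv b (fun z => A z k c - partialDeriv c (q k) z) (baseProj y)
        = partialDeriv b (fun z => A z k c) (baseProj y) := by
      intro k b c
      simp only [hdq]
      rw [partialDeriv_sub (differentiableAt_of_contDiffOn H.base.isOpen (H.smooth_conn k c) hz)
        (differentiableAt_const _)]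
      simp
    funext i
    ext b c
    simp only [connCurvature, Matrix.sub_apply, Matrix.of_apply, d]
  rw [H'.laplacian_sqrt_det_eq hz hA0, hcurv]
  simp only [he]
  simp only [hA0, adaptedMetric, Matrix.fromBlocks_apply₁₁]
  generalize baseProj y = z at *
  -- Each component matrix is a multiple of the standard skew matrix J, and g⁻¹Jg⁻¹J = -det(g⁻¹) · 1
  -- by symmetry of g⁻¹; the trace contributes the factor 2.
  have hskew : ∀ i, connCurvature G A z i = connCurvature G A z i 0 1 • !![0, 1; -1, 0] := by
    intro i
    have h0 : ∀ b c, connCurvature G A z i b c = - connCurvature G A z i c b := by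
      intro b c
      simp only [connCurvature, Matrix.of_apply, Matrix.mul_apply]
      rw [← mul_neg, ← Finset.sum_neg_distrib]
      congr 1
      exact Finset.sum_congr rfl fun k _ => by ring
    ext b c
    have h1 := h0 0 0
    have h2 := h0 1 1
    have h3 := h0 1 0
    fin_cases b <;> fin_cases c <;> simp <;> linarith
  have htr : ∀ i j, ((g z)⁻¹ * connCurvature G A z i * ((g z)⁻¹ * connCurvature G A z j)).trace
      = - (2 * (g z)⁻¹.det * (connCurvature G A z i 0 1 * connCurvature G A z j 0 1)) := by
    intro i j
    have hs := H.base.inv_symm hz 1 0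
    rw [hskew i, hskew j, Matrix.det_fin_two]
    simp [Matrix.trace_fin_two, Matrix.mul_apply, Fin.sum_univ_two, hs]
    ring
  have hcard : ∑ i, ∑ j, (G z)⁻¹ i j * (lam * G z j i) = Fintype.card κ * lam := by
    have h1 := congrArg Matrix.trace (Matrix.nonsing_inv_mul (G z) (H.det_ne_zero hz).isUnit)
    rw [Matrix.trace_one] at h1
    rw [← h1, mul_comm, Matrix.trace, Finset.mul_sum]
    refine Finset.sum_congr rfl fun i _ => ?_
    rw [Matrix.diag, Matrix.mul_apply, Finset.mul_sum]
    exact Finset.sum_congr rfl fun j _ => by ring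
  simp only [htr, mul_add, Finset.sum_add_distrib, hcard]
  have hF : ∑ i, ∑ j, (G z)⁻¹ i j * -(2 * (g z)⁻¹.det * (connCurvature G A z j 0 1
      * connCurvature G A z i 0 1)) = - (2 * (g z)⁻¹.det *
        ((fun i => connCurvature G A z i 0 1) ⬝ᵥ (G z)⁻¹ *ᵥ
          (fun i => connCurvature G A z i 0 1))) := by
    simp only [dotProduct, Matrix.mulVec, Finset.mul_sum, ← Finset.sum_neg_distrib]
    exact Finset.sum_congr rfl fun i _ => Finset.sum_congr rfl fun j _ => by ring
  rw [hF]
  ring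

theorem curvature_term_nonneg {z : EuclideanSpace ℝ (Fin 2)} (hz : z ∈ V) :
    0 ≤ 2 * (g z)⁻¹.det * ((fun i => connCurvature G A z i 0 1) ⬝ᵥ (G z)⁻¹ *ᵥ
          (fun i => connCurvature G A z i 0 1)) := by
  have h1 := (H.base_posDef z hz).inv.det_pos
  have h2 := (H.posDef z hz).inv.posSemidef.dotProduct_mulVec_nonneg
    (fun i => connCurvature G A z i 0 1)
  simp only [star_trivial] at h2
  positivity

theorem laplacian_nonneg (hlam : lam ≤ 0) {z : EuclideanSpace ℝ (Fin 2)} (hz : z ∈ V) :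
    0 ≤ coordLaplacian g (fun w => √(G w).det) z := by
  rw [H.laplacian_sqrt_det_surface hz]
  have h1 := H.curvature_term_nonneg hz
  have h2 : (Fintype.card κ : ℝ) * lam ≤ 0 := mul_nonpos_of_nonneg_of_nonpos (by positivity) hlam
  exact mul_nonneg (Real.sqrt_nonneg _) (by linarith)

/-- If `√det G` is harmonic, then the curvature of the connection and the Einstein constant
vanish. -/
theorem eq_zero_of_laplacian_eq_zero [Nonempty κ] (hlam : lam ≤ 0) {z : EuclideanSpace ℝ (Fin 2)}
    (hz : z ∈ V) (h : coordLaplacian g (fun w => √(G w).det) z = 0) :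
    lam = 0 ∧ ∀ k a b, partialDeriv a (fun w => A w k b) z = partialDeriv b (fun w => A w k a) z := by
  rw [H.laplacian_sqrt_det_surface hz] at h
  have h1 := H.curvature_term_nonneg hz
  have hc : (0 : ℝ) < Fintype.card κ := by exact_mod_cast Fintype.card_pos
  have h0 : 0 < √(G z).det := Real.sqrt_pos.2 (H.posDef z hz).det_pos
  have h3 := (mul_eq_zero.1 h).resolve_left h0.ne'
  have h2 : (Fintype.card κ : ℝ) * lam ≤ 0 := mul_nonpos_of_nonneg_of_nonpos hc.le hlam
  -- The vanishing factor `h3` is a sum of two nonnegative terms, so each of them is zero.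
  have h4 : (Fintype.card κ : ℝ) * lam = 0 := by linarith
  refine ⟨(mul_eq_zero.1 h4).resolve_left hc.ne', ?_⟩
  have h5 := (H.base_posDef z hz).inv.det_pos
  have h6 : ((fun i => connCurvature G A z i 0 1) ⬝ᵥ (G z)⁻¹ *ᵥ
          (fun i => connCurvature G A z i 0 1)) = 0 := by
    rw [h4] at h3
    simpa [(H.base_posDef z hz).det_pos.ne'] using h3
  have h7 : (fun i => connCurvature G A z i 0 1) = 0 := by
    by_contra hne
    have := (H.posDef z hz).inv.dotProduct_mulVec_pos hne
    simp only [star_trivial] at this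
    exact this.ne' h6
  let F : κ → ℝ := fun k =>
    partialDeriv 1 (fun z => A z k 0) z - partialDeriv 0 (fun z => A z k 1) z
  -- The vanishing vector is the curvature with its fiber index lowered by G; invertibility of G
  -- returns the curvature itself.
  have h8 : G z *ᵥ F = 0 := by
    funext i
    have := congrFun h7 i
    simpa [connCurvature, Matrix.mul_apply, Matrix.mulVec, dotProduct, F] using this
  have h9 : F = 0 := Matrix.eq_zero_of_mulVec_eq_zero (H.det_ne_zero hz) h8
  intro k a b
  have h10 := congrFun h9 k
  simp only [F, Pi.zero_apply] at h10
  fin_cases a <;> fin_cases b <;> simp <;> linarith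

/-- The Einstein equation in the direction of the base, if the connection is flat and
`det G` is constant. -/
theorem trace_eq_scalar (hlam : lam = 0)
    (hflat : ∀ z ∈ V, ∀ k a b,
      partialDeriv a (fun w => A w k b) z = partialDeriv b (fun w => A w k a) z)
    (hdet : ∀ z ∈ V, ∀ a, halfLogDeriv G a z = 0) {z : EuclideanSpace ℝ (Fin 2)} (hz : z ∈ V)
    (a b : Fin 2) :
    ((G z)⁻¹ * matPartial a G z * (G z)⁻¹ * matPartial b G z).trace
      = 2 * scalar g z * g z a b := by
  obtain ⟨r, hr, hball⟩ := Metric.isOpen_iff.1 H.base.isOpen z hz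
  -- The Poincaré lemma: each row of A is a closed one-form, hence exact on the convex ball. The
  -- primitive is smooth because its differential is.
  have hex : ∀ k, ∃ q : EuclideanSpace ℝ (Fin 2) → ℝ, ContDiffOn ℝ ∞ q (Metric.ball z r) ∧ q z = 0 ∧
      ∀ w ∈ Metric.ball z r, ∀ a, partialDeriv a q w = A w k a := by
    intro k
    let η : EuclideanSpace ℝ (Fin 2) → EuclideanSpace ℝ (Fin 2) →L[ℝ] ℝ := fun w =>
      ∑ a, A w k a • (EuclideanSpace.proj a : EuclideanSpace ℝ (Fin 2) →L[ℝ] ℝ)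
    have hη : ContDiffOn ℝ ∞ η (Metric.ball z r) :=
      ContDiffOn.sum fun a _ => ((H.smooth_conn k a).mono hball).smul contDiffOn_const
    have hηa : ∀ w a, η w (EuclideanSpace.single a 1) = A w k a := by
      intro w a
      fin_cases a <;> simp [η]
    have hηd : ∀ w ∈ Metric.ball z r, DifferentiableAt ℝ η w := fun w hw =>
      (hη.contDiffAt (Metric.isOpen_ball.mem_nhds hw)).differentiableAt (by simp)
    have hpd : ∀ w ∈ Metric.ball z r, ∀ a b, fderiv ℝ η w (EuclideanSpace.single a 1)
        (EuclideanSpace.single b 1) = partialDeriv a (fun w => A w k b) w := by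
      intro w hw a b
      rw [partialDeriv]
      simp only [← hηa]
      rw [fderiv_clm_apply (hηd w hw) (differentiableAt_const _)]
      simp
    obtain ⟨q, hq⟩ := (convex_ball z r).exists_forall_hasFDerivAt_of_fderiv_symmetric
      Metric.isOpen_ball (fun w hw => (hηd w hw).differentiableWithinAt) (by
        intro w hw v v'
        have hv : ∀ v : EuclideanSpace ℝ (Fin 2), v = ∑ a, v a • EuclideanSpace.single a (1 : ℝ) := by
          intro v
          ext i
          fin_cases i <;> simp
        rw [hv v, hv v']
        simp only [map_sum, map_smul, _root_.sum_apply, _root_.smul_apply, hpd w hw,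
          Finset.smul_sum]
        rw [Finset.sum_comm]
        refine Finset.sum_congr rfl fun a _ => Finset.sum_congr rfl fun b _ => ?_
        rw [hflat w (hball hw) k a b, smul_comm])
    have hqs : ContDiffOn ℝ ∞ q (Metric.ball z r) := by
      rw [contDiffOn_infty_iff_fderiv_of_isOpen Metric.isOpen_ball]
      exact ⟨fun w hw => (hq w hw).differentiableAt.differentiableWithinAt,
        hη.congr fun w hw => (hq w hw).fderiv⟩
    refine ⟨fun w => q w - q z, hqs.sub contDiffOn_const, sub_self _, fun w hw a => ?_⟩
    rw [partialDeriv, ((hq w hw).sub_const _).fderiv, hηa]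
  choose q hqs hq0 hqd using hex
  obtain ⟨y, hyz, he⟩ := H.einstein _ hball Metric.isOpen_ball q hqs z (Metric.mem_ball_self hr)
    hq0
  have H' := H.toAdaptedOn.gauge hball Metric.isOpen_ball hqs
  subst hyz
  -- In this gauge A - dq vanishes on the whole ball, not only at its center, as `ricci_base`
  -- requires.
  have hb := H'.ricci_base (Metric.mem_ball_self hr) (fun w hw => by
    ext k a
    simp [hqd k w hw a]) (fun w hw a => hdet w (hball hw) a) a b
  -- Since λ = 0, the base equation is 0 = (R/2) g - (1/4) tr, hence the constant 2R.
  rw [he, hlam, zero_mul, H.base.ricci_surface hz] at hb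
  linarith

end LocalEinstein
end Surface

/-! ### Canonical coordinates on an abelian Lie group. -/

section LieLog

variable {E : Type*} [NormedAddCommGroup E] [NormedSpace ℝ E]
variable {𝒢 : Type*} [AddCommGroup 𝒢] [TopologicalSpace 𝒢] [ChartedSpace E 𝒢]

/-- The difference of the group, read in the chart at zero. -/
def chartDiff (p : E × E) : E :=
  chartAt E (0 : 𝒢) ((chartAt E (0 : 𝒢)).symm p.2 - (chartAt E (0 : 𝒢)).symm p.1)

variable (𝒢) in
/-- The domain of `chartDiff`. -/
def chartDiffDomain : Set (E × E) :=
  ((chartAt E (0 : 𝒢)).target ×ˢ (chartAt E (0 : 𝒢)).target) ∩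
    (fun p : E × E => (chartAt E (0 : 𝒢)).symm p.2 - (chartAt E (0 : 𝒢)).symm p.1) ⁻¹'
      (chartAt E (0 : 𝒢)).source

variable (𝒢) in
/-- The invariant one-form of the group with values in the Lie algebra, read in the chart at
zero. -/
def invForm (u : E) : E →L[ℝ] E :=
  (fderiv ℝ (chartDiff (𝒢 := 𝒢) (E := E)) (u, u)).comp (ContinuousLinearMap.inr ℝ E E)

variable [LieAddGroup 𝓘(ℝ, E) ∞ 𝒢]

theorem contMDiffOn_symm_sub : ContMDiffOn 𝓘(ℝ, E × E) 𝓘(ℝ, E) ∞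
    (fun p : E × E => (chartAt E (0 : 𝒢)).symm p.2 - (chartAt E (0 : 𝒢)).symm p.1)
    ((chartAt E (0 : 𝒢)).target ×ˢ (chartAt E (0 : 𝒢)).target) := by
  have : IsManifold 𝓘(ℝ, E) ∞ 𝒢 := inferInstance
  have hc : ContMDiffOn 𝓘(ℝ, E) 𝓘(ℝ, E) ∞ (chartAt E (0 : 𝒢)).symm (chartAt E (0 : 𝒢)).target :=
    contMDiffOn_chart_symm
  exact (hc.comp (contDiff_snd (𝕜 := ℝ) (E := E) (F := E)).contMDiff.contMDiffOn
    fun p hp => hp.2).sub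
    (hc.comp (contDiff_fst (𝕜 := ℝ) (E := E) (F := E)).contMDiff.contMDiffOn fun p hp => hp.1)

theorem isOpen_chartDiffDomain : IsOpen (chartDiffDomain 𝒢 (E := E)) :=
  (contMDiffOn_symm_sub (E := E)).continuousOn.isOpen_inter_preimage
    ((chartAt E (0 : 𝒢)).open_target.prod (chartAt E (0 : 𝒢)).open_target)
    (chartAt E (0 : 𝒢)).open_source

theorem contDiffOn_chartDiff :
    ContDiffOn ℝ ∞ (chartDiff (𝒢 := 𝒢) (E := E)) (chartDiffDomain 𝒢) := by
  have : IsManifold 𝓘(ℝ, E) ∞ 𝒢 := inferInstance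
  rw [← contMDiffOn_iff_contDiffOn]
  exact (contMDiffOn_chart (x := (0 : 𝒢))).comp (contMDiffOn_symm_sub.mono Set.inter_subset_left)
    fun p hp => hp.2

theorem diag_mem {u : E} (hu : u ∈ (chartAt E (0 : 𝒢)).target) :
    (u, u) ∈ chartDiffDomain 𝒢 := by
  refine ⟨⟨hu, hu⟩, ?_⟩
  simp

theorem contDiffOn_invForm : ContDiffOn ℝ ∞ (invForm 𝒢 (E := E)) (chartAt E (0 : 𝒢)).target := by
  have h := (contDiffOn_chartDiff (𝒢 := 𝒢) (E := E)).fderiv_of_isOpen isOpen_chartDiffDomain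
    (m := ∞) (by simp)
  have h2 : ContDiffOn ℝ ∞ (fun u : E => (u, u)) (chartAt E (0 : 𝒢)).target :=
    contDiffOn_id.prodMk contDiffOn_id
  exact (h.comp h2 fun u hu => diag_mem hu).clm_comp contDiffOn_const

theorem differentiableAt_chartDiff {p : E × E} (hp : p ∈ chartDiffDomain 𝒢) :
    DifferentiableAt ℝ (chartDiff (𝒢 := 𝒢)) p :=
  (contDiffOn_chartDiff.contDiffAt (isOpen_chartDiffDomain.mem_nhds hp)).differentiableAt (by simp)

theorem hasFDerivAt_chartDiff_right {u : E} (hu : u ∈ (chartAt E (0 : 𝒢)).target) :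
    HasFDerivAt (fun v => chartDiff (𝒢 := 𝒢) (u, v)) (invForm 𝒢 u) u :=
  (differentiableAt_chartDiff (diag_mem hu)).hasFDerivAt.comp u (hasFDerivAt_prodMk_right u u)

omit [LieAddGroup 𝓘(ℝ, E) ∞ 𝒢] in
theorem zero_mem_target : chartAt E (0 : 𝒢) 0 ∈ (chartAt E (0 : 𝒢)).target :=
  mem_chart_target E 0

/-- With the first point at the zero of the group, `chartDiff` is the identity in its second
argument. -/
theorem invForm_zero : invForm 𝒢 (chartAt E (0 : 𝒢) 0) = ContinuousLinearMap.id ℝ E := by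
  refine (hasFDerivAt_chartDiff_right (𝒢 := 𝒢) zero_mem_target).unique ?_
  refine (hasFDerivAt_id _).congr_of_eventuallyEq ?_
  filter_upwards [(chartAt E (0 : 𝒢)).open_target.mem_nhds zero_mem_target] with v hv
  simp [chartDiff, (chartAt E (0 : 𝒢)).right_inv hv]

/-- The negation of the group, read in the chart at zero. -/
theorem hasFDerivAt_chartNeg :
    HasFDerivAt (fun w => chartAt E (0 : 𝒢) (-(chartAt E (0 : 𝒢)).symm w))
      (-ContinuousLinearMap.id ℝ E) (chartAt E (0 : 𝒢) 0) := by
  have : IsManifold 𝓘(ℝ, E) ∞ 𝒢 := inferInstance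
  set c := chartAt E (0 : 𝒢)
  set u₀ := c 0
  have hu : u₀ ∈ c.target := zero_mem_target
  have h0 : c.symm u₀ = 0 := c.left_inv (mem_chart_source E 0)
  have hd := (differentiableAt_chartDiff (𝒢 := 𝒢) (diag_mem hu)).hasFDerivAt
  have h1 : HasFDerivAt (fun v => chartDiff (𝒢 := 𝒢) (v, u₀))
      ((fderiv ℝ (chartDiff (𝒢 := 𝒢)) (u₀, u₀)).comp (ContinuousLinearMap.inl ℝ E E)) u₀ :=
    hd.comp (f := fun v => (v, u₀)) u₀ (hasFDerivAt_prodMk_left u₀ u₀)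
  have h2 : HasFDerivAt (fun v => chartDiff (𝒢 := 𝒢) (v, v))
      ((fderiv ℝ (chartDiff (𝒢 := 𝒢)) (u₀, u₀)).comp
        ((ContinuousLinearMap.id ℝ E).prod (ContinuousLinearMap.id ℝ E))) u₀ :=
    hd.comp (f := fun v => (v, v)) u₀ ((hasFDerivAt_id u₀).prodMk (hasFDerivAt_id u₀))
  -- The difference is constant on the diagonal, so its two partial derivatives there are opposite.
  -- The second is the identity by `invForm_zero`, and the first is the derivative of negation.
  have h3 : (fderiv ℝ (chartDiff (𝒢 := 𝒢)) (u₀, u₀)).comp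
        ((ContinuousLinearMap.id ℝ E).prod (ContinuousLinearMap.id ℝ E)) = 0 := by
    refine h2.unique ((hasFDerivAt_const (c 0) u₀).congr_of_eventuallyEq ?_)
    exact Filter.Eventually.of_forall fun v => by simp [chartDiff, c]
  have h4 := invForm_zero (E := E) (𝒢 := 𝒢)
  have h5 : (fderiv ℝ (chartDiff (𝒢 := 𝒢)) (u₀, u₀)).comp (ContinuousLinearMap.inl ℝ E E)
      = -ContinuousLinearMap.id ℝ E := by
    rw [← h4, invForm, eq_neg_iff_add_eq_zero, ← h3]
    ext v
    change fderiv ℝ (chartDiff (𝒢 := 𝒢)) (u₀, u₀) (v, 0)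
      + fderiv ℝ (chartDiff (𝒢 := 𝒢)) (u₀, u₀) (0, v)
      = fderiv ℝ (chartDiff (𝒢 := 𝒢)) (u₀, u₀) (v, v)
    rw [← map_add]
    simp
  rw [← h5]
  refine h1.congr_of_eventuallyEq (Filter.Eventually.of_forall fun v => ?_)
  simp only [chartDiff]
  change c _ = c (c.symm u₀ - c.symm v)
  rw [h0, zero_sub]

/-- The invariant one-form is closed. -/
theorem invForm_symm {u : E} (hu : u ∈ (chartAt E (0 : 𝒢)).target)
    (hinj : Function.Injective (invForm 𝒢 u)) (a b : E) :
    fderiv ℝ (invForm 𝒢) u a b = fderiv ℝ (invForm 𝒢) u b a := by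
  have : IsManifold 𝓘(ℝ, E) ∞ 𝒢 := inferInstance
  have : IsTopologicalAddGroup 𝒢 := topologicalAddGroup_of_lieAddGroup 𝓘(ℝ, E) ∞
  set c := chartAt E (0 : 𝒢) with hcdef
  -- The reflection x ↦ 2u - x of the group, read in the chart. It fixes u and, by commutativity,
  -- reverses differences, so it pulls the invariant form back to its negative; this is `key`.
  let r : E → E := fun x => c (c.symm u + c.symm u - c.symm x)
  let W : Set E := c.target ∩ (fun x => c.symm u + c.symm u - c.symm x) ⁻¹' c.source
  have hc : ContMDiffOn 𝓘(ℝ, E) 𝓘(ℝ, E) ∞ c.symm c.target := contMDiffOn_chart_symm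
  have hm : ContMDiffOn 𝓘(ℝ, E) 𝓘(ℝ, E) ∞ (fun x => c.symm u + c.symm u - c.symm x) c.target :=
    contMDiffOn_const.sub hc
  have hW : IsOpen W := hm.continuousOn.isOpen_inter_preimage c.open_target c.open_source
  have huW : u ∈ W := ⟨hu, by simpa using c.map_target hu⟩
  have hr : ContDiffOn ℝ ∞ r W := by
    rw [← contMDiffOn_iff_contDiffOn]
    exact (contMDiffOn_chart (x := (0 : 𝒢))).comp (hm.mono Set.inter_subset_left) fun p hp => hp.2
  have hrd : ∀ x ∈ W, DifferentiableAt ℝ r x := fun x hx =>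
    (hr.contDiffAt (hW.mem_nhds hx)).differentiableAt (by simp)
  have hru : r u = u := by simp [r, c.right_inv hu]
  have hrt : ∀ x ∈ W, r x ∈ c.target := fun x hx => c.map_source hx.2
  have key : ∀ x ∈ W, (invForm 𝒢 (r x)).comp (fderiv ℝ r x) = - invForm 𝒢 x := by
    intro x hx
    have e1 : HasFDerivAt (fun y => chartDiff (𝒢 := 𝒢) (r x, r y))
        ((invForm 𝒢 (r x)).comp (fderiv ℝ r x)) x :=
      (hasFDerivAt_chartDiff_right (hrt x hx)).comp x (hrd x hx).hasFDerivAt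
    have e2 : HasFDerivAt (fun y => c (-c.symm (chartDiff (𝒢 := 𝒢) (x, y))))
        ((-ContinuousLinearMap.id ℝ E).comp (invForm 𝒢 x)) x := by
      have h0 : chartDiff (𝒢 := 𝒢) (x, x) = c 0 := by simp [chartDiff, c]
      have h1 : HasFDerivAt (fun w => c (-c.symm w)) (-ContinuousLinearMap.id ℝ E)
          (chartDiff (𝒢 := 𝒢) (x, x)) := by
        rw [h0]; exact hasFDerivAt_chartNeg
      exact h1.comp x (hasFDerivAt_chartDiff_right hx.1)
    have e3 : (fun y => chartDiff (𝒢 := 𝒢) (r x, r y))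
        =ᶠ[𝓝 x] fun y => c (-c.symm (chartDiff (𝒢 := 𝒢) (x, y))) := by
      have hD : ∀ᶠ y in 𝓝 x, (x, y) ∈ chartDiffDomain 𝒢 :=
        (Continuous.prodMk_right x).continuousAt.eventually
          (isOpen_chartDiffDomain.mem_nhds (diag_mem hx.1))
      filter_upwards [hW.mem_nhds hx, hD] with y hy hyD
      have h1 : c.symm (chartDiff (𝒢 := 𝒢) (x, y)) = c.symm y - c.symm x := c.left_inv hyD.2
      rw [h1]
      simp only [chartDiff, r]
      rw [c.left_inv hx.2, c.left_inv hy.2]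
      rw [sub_sub_sub_cancel_left, neg_sub]
    rw [(e1.congr_of_eventuallyEq e3.symm).unique e2]
    ext v; simp
  have hru' : fderiv ℝ r u = -ContinuousLinearMap.id ℝ E := by
    have h1 := key u huW
    rw [hru] at h1
    ext v
    apply hinj
    have := DFunLike.congr_fun h1 v
    simpa using this
  have hd : ∀ x ∈ c.target, DifferentiableAt ℝ (invForm 𝒢 (E := E)) x := fun x hx =>
    (contDiffOn_invForm.contDiffAt (c.open_target.mem_nhds hx)).differentiableAt (by simp)
  have hr2 : DifferentiableAt ℝ (fderiv ℝ r) u :=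
    ((hr.fderiv_of_isOpen hW (m := ∞) (by simp)).contDiffAt (hW.mem_nhds huW)).differentiableAt
      (by simp)
  have hsym : ∀ a b, fderiv ℝ (fderiv ℝ r) u a b = fderiv ℝ (fderiv ℝ r) u b a :=
    ((hr.contDiffAt (hW.mem_nhds huW)).of_le
      (by norm_cast : (2 : ℕ∞ω) ≤ ∞)).isSymmSndFDerivAt (by simp)
  -- Differentiating `key` at u, where the reflection has derivative -1: the two signs cancel in the
  -- first term. Thus 2Dω(a,b) = -ω(D²r(a,b)), which is symmetric because second derivatives are.
  have hder : ∀ a b, fderiv ℝ (invForm 𝒢) u a b + invForm 𝒢 u (fderiv ℝ (fderiv ℝ r) u a b)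
      = - fderiv ℝ (invForm 𝒢) u a b := by
    intro a b
    have h1 : HasFDerivAt (fun x => invForm 𝒢 (r x)) ((fderiv ℝ (invForm 𝒢) u).comp (fderiv ℝ r u))
        u := by
      have h2 : HasFDerivAt (invForm 𝒢) (fderiv ℝ (invForm 𝒢) u) (r u) := by
        rw [hru]; exact (hd u hu).hasFDerivAt
      exact h2.comp u (hrd u huW).hasFDerivAt
    have h3 := h1.clm_comp hr2.hasFDerivAt
    have h4 : HasFDerivAt (fun x => - invForm 𝒢 (E := E) x) (- fderiv ℝ (invForm 𝒢) u) u :=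
      (hd u hu).hasFDerivAt.neg
    have h5 := h3.unique (h4.congr_of_eventuallyEq (by
      filter_upwards [hW.mem_nhds huW] with x hx using key x hx))
    have h6 := DFunLike.congr_fun (DFunLike.congr_fun h5 a) b
    rw [hru'] at h6
    simp [hru] at h6
    rw [add_comm]
    exact h6
  have h7 := hder a b
  have h8 := hder b a
  rw [hsym b a] at h8
  have h9 : (2 : ℝ) • fderiv ℝ (invForm 𝒢) u a b = (2 : ℝ) • fderiv ℝ (invForm 𝒢) u b a := by
    rw [two_smul, two_smul]
    have h10 := eq_neg_of_add_eq_zero_left (show fderiv ℝ (invForm 𝒢) u a b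
      + fderiv ℝ (invForm 𝒢) u a b + invForm 𝒢 u (fderiv ℝ (fderiv ℝ r) u a b) = 0 by
        rw [add_assoc, h7]; simp)
    have h11 := eq_neg_of_add_eq_zero_left (show fderiv ℝ (invForm 𝒢) u b a
      + fderiv ℝ (invForm 𝒢) u b a + invForm 𝒢 u (fderiv ℝ (fderiv ℝ r) u a b) = 0 by
        rw [add_assoc, h8]; simp)
    rw [h10, h11]
  exact smul_right_injective E (two_ne_zero' ℝ) h9

/-- Canonical coordinates on an abelian Lie group: a chart at zero with the property that all
translations have constant differential. -/
theorem exists_canonicalChart [CompleteSpace E] :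
    ∃ ψ : OpenPartialHomeomorph 𝒢 E, 0 ∈ ψ.source ∧ ψ 0 = 0 ∧
      ContMDiffOn 𝓘(ℝ, E) 𝓘(ℝ, E) ∞ ψ ψ.source ∧ ContMDiffOn 𝓘(ℝ, E) 𝓘(ℝ, E) ∞ ψ.symm ψ.target ∧
      (∀ v : E, (mfderiv 𝓘(ℝ, E) 𝓘(ℝ, E) ψ.symm 0 v : E) = v) ∧
      ∀ a ∈ ψ.source, HasFDerivAt (fun x => ψ (ψ.symm x + a)) (ContinuousLinearMap.id ℝ E) 0 := by
  have : IsManifold 𝓘(ℝ, E) ∞ 𝒢 := inferInstance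
  have : IsTopologicalAddGroup 𝒢 := topologicalAddGroup_of_lieAddGroup 𝓘(ℝ, E) ∞
  set c := chartAt E (0 : 𝒢) with hcdef
  set u₀ := c 0 with hu₀
  have hu : u₀ ∈ c.target := zero_mem_target
  have h0 : c.symm u₀ = 0 := c.left_inv (mem_chart_source E 0)
  have hcont : ContinuousAt (invForm 𝒢 (E := E)) u₀ :=
    contDiffOn_invForm.continuousOn.continuousAt (c.open_target.mem_nhds hu)
  -- The form is the identity at the zero of the group, so it stays invertible nearby. Invertibility
  -- serves both in `invForm_symm` and in the smoothness of the inverse chart.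
  have hnear : ∀ᶠ u in 𝓝 u₀, u ∈ c.target ∧
      invForm 𝒢 u ∈ Set.range (ContinuousLinearEquiv.toContinuousLinearMap :
        (E ≃L[ℝ] E) → E →L[ℝ] E) := by
    refine Filter.Eventually.and (c.open_target.mem_nhds hu) (hcont.eventually ?_)
    rw [invForm_zero]
    exact ContinuousLinearEquiv.nhds (ContinuousLinearEquiv.refl ℝ E)
  obtain ⟨ρ, hρ, hball⟩ := Metric.eventually_nhds_iff_ball.1 hnear
  have hsm : ContDiffOn ℝ ∞ (invForm 𝒢 (E := E)) (Metric.ball u₀ ρ) :=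
    contDiffOn_invForm.mono fun u hu => (hball u hu).1
  obtain ⟨Ψ₁, hΨ₁⟩ := (convex_ball u₀ ρ).exists_forall_hasFDerivAt_of_fderiv_symmetric
    Metric.isOpen_ball
    (fun u hu => ((hsm.contDiffAt (Metric.isOpen_ball.mem_nhds hu)).differentiableAt
      (by simp)).differentiableWithinAt) (fun u hu a b => by
        obtain ⟨L, hL⟩ := (hball u hu).2
        exact invForm_symm (hball u hu).1 (by rw [← hL]; exact L.injective) a b)
  let Ψ : E → E := fun u => Ψ₁ u - Ψ₁ u₀
  -- Ψ is a local logarithm: a primitive of the invariant form on the ball, normalized to vanish at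
  -- the zero of the group. It has derivative the identity there, so it is a local chart.
  have hΨ : ∀ u ∈ Metric.ball u₀ ρ, HasFDerivAt Ψ (invForm 𝒢 u) u := fun u hu =>
    (hΨ₁ u hu).sub_const _
  have hΨs : ContDiffOn ℝ ∞ Ψ (Metric.ball u₀ ρ) := by
    rw [contDiffOn_infty_iff_fderiv_of_isOpen Metric.isOpen_ball]
    exact ⟨fun w hw => (hΨ w hw).differentiableAt.differentiableWithinAt,
      hsm.congr fun w hw => (hΨ w hw).fderiv⟩
  have hmem : u₀ ∈ Metric.ball u₀ ρ := Metric.mem_ball_self hρ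
  have hΨ0 : HasFDerivAt Ψ ((ContinuousLinearEquiv.refl ℝ E : E ≃L[ℝ] E) : E →L[ℝ] E) u₀ := by
    have := hΨ u₀ hmem
    rwa [invForm_zero] at this
  have hca := hΨs.contDiffAt (Metric.isOpen_ball.mem_nhds hmem)
  -- The restriction to the ball keeps the derivative of Ψ invertible on the entire domain, so the
  -- inverse is smooth on the entire target.
  let e : OpenPartialHomeomorph E E := (hca.toOpenPartialHomeomorph Ψ hΨ0 (by simp)).restrOpen
    (Metric.ball u₀ ρ) Metric.isOpen_ball
  have heΨ : ∀ u, e u = Ψ u := fun u => rfl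
  have hes : e.source ⊆ Metric.ball u₀ ρ := fun u hu => hu.2
  have heu : u₀ ∈ e.source := ⟨hca.mem_toOpenPartialHomeomorph_source hΨ0 (by simp), hmem⟩
  have he0 : e u₀ = 0 := sub_self _
  have hesymm : ContDiffOn ℝ ∞ e.symm e.target := by
    intro w hw
    have hw' := hes (e.map_target hw)
    obtain ⟨L, hL⟩ := (hball _ hw').2
    refine (e.contDiffAt_symm (f₀' := L) hw ?_
      (hΨs.contDiffAt (Metric.isOpen_ball.mem_nhds hw'))).contDiffWithinAt
    rw [hL]
    exact hΨ _ hw'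
  have h0t : (0 : E) ∈ e.target := by rw [← he0]; exact e.map_source heu
  have hes0 : e.symm 0 = u₀ := by rw [← he0]; exact e.left_inv heu
  have hesd : HasFDerivAt e.symm (ContinuousLinearMap.id ℝ E) 0 := by
    refine e.hasFDerivAt_symm (f' := ContinuousLinearEquiv.refl ℝ E) h0t ?_
    rw [hes0]
    exact hΨ0
  let ψ : OpenPartialHomeomorph 𝒢 E := c.trans e
  have hψs : ∀ x, x ∈ ψ.source ↔ x ∈ c.source ∧ c x ∈ e.source := fun x => by simp [ψ]
  have hψt : ∀ w, w ∈ ψ.target ↔ w ∈ e.target ∧ e.symm w ∈ c.target := fun w => by simp [ψ]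
  have hψ0 : (0 : 𝒢) ∈ ψ.source := (hψs 0).2 ⟨mem_chart_source E 0, heu⟩
  have hψsymm0 : ψ.symm 0 = 0 := by
    change c.symm (e.symm 0) = 0
    rw [hes0, h0]
  refine ⟨ψ, hψ0, he0, ?_, ?_, ?_, ?_⟩
  · exact (contMDiffOn_iff_contDiffOn.2 hΨs).comp
      ((contMDiffOn_chart (x := (0 : 𝒢))).mono fun x hx => ((hψs x).1 hx).1)
      fun x hx => hes ((hψs x).1 hx).2
  · exact (contMDiffOn_chart_symm (x := (0 : 𝒢))).comp
      ((contMDiffOn_iff_contDiffOn.2 hesymm).mono fun x hx => ((hψt x).1 hx).1)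
      fun x hx => ((hψt x).1 hx).2
  · intro v
    have hm : MDifferentiableAt 𝓘(ℝ, E) 𝓘(ℝ, E) ψ.symm 0 := by
      have h1 : ContMDiffOn 𝓘(ℝ, E) 𝓘(ℝ, E) ∞ ψ.symm ψ.target :=
        (contMDiffOn_chart_symm (x := (0 : 𝒢))).comp
        ((contMDiffOn_iff_contDiffOn.2 hesymm).mono fun x hx => ((hψt x).1 hx).1)
        fun x hx => ((hψt x).1 hx).2
      have h2 : (0 : E) ∈ ψ.target := (hψt 0).2 ⟨h0t, by rw [hes0]; exact hu⟩
      exact (h1.contMDiffAt (ψ.open_target.mem_nhds h2)).mdifferentiableAt (by simp)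
    rw [hm.mfderiv]
    have h3 : HasFDerivAt (writtenInExtChartAt 𝓘(ℝ, E) 𝓘(ℝ, E) (0 : E) ψ.symm)
        (ContinuousLinearMap.id ℝ E) 0 := by
      refine hesd.congr_of_eventuallyEq ?_
      have h4 : ∀ᶠ w in 𝓝 (0 : E), w ∈ ψ.target :=
        ψ.open_target.mem_nhds ((hψt 0).2 ⟨h0t, by rw [hes0]; exact hu⟩)
      filter_upwards [h4] with w hw
      simp only [writtenInExtChartAt, hψsymm0, mfld_simps]
      change c (c.symm (e.symm w)) = _
      exact c.right_inv ((hψt w).1 hw).2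
    have h5 : fderivWithin ℝ (writtenInExtChartAt 𝓘(ℝ, E) 𝓘(ℝ, E) (0 : E) ψ.symm)
        (Set.range 𝓘(ℝ, E)) (extChartAt 𝓘(ℝ, E) (0 : E) 0) = ContinuousLinearMap.id ℝ E := by
      rw [ModelWithCorners.range_eq_univ, fderivWithin_univ]
      exact h3.fderiv
    exact DFunLike.congr_fun h5 v
  · intro a ha
    obtain ⟨ha1, ha2⟩ := (hψs a).1 ha
    let k : E → E := fun w => c (c.symm w + a)
    have hk0 : k u₀ = c a := by simp [k, h0]
    have hcm : ContMDiffOn 𝓘(ℝ, E) 𝓘(ℝ, E) ∞ (fun w => c.symm w + a) c.target :=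
      (contMDiffOn_chart_symm (x := (0 : 𝒢))).add contMDiffOn_const
    have hpre : ∀ᶠ w in 𝓝 u₀, w ∈ c.target ∧ c.symm w + a ∈ c.source :=
      (hcm.continuousOn.isOpen_inter_preimage c.open_target c.open_source).mem_nhds
        ⟨hu, by simpa [h0] using ha1⟩
    have hkd : DifferentiableAt ℝ k u₀ := by
      have h1 : ContMDiffAt 𝓘(ℝ, E) 𝓘(ℝ, E) ∞ (fun w => c.symm w + a) u₀ :=
        hcm.contMDiffAt (c.open_target.mem_nhds hu)
      have h2 : ContMDiffAt 𝓘(ℝ, E) 𝓘(ℝ, E) ∞ c (c.symm u₀ + a) :=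
        (contMDiffOn_chart (x := (0 : 𝒢))).contMDiffAt
          (c.open_source.mem_nhds (by rwa [h0, zero_add]))
      have h3 := h2.comp u₀ h1
      exact (contMDiffAt_iff_contDiffAt.1 h3).differentiableAt (by simp)
    -- Near the zero of the group, subtracting a from w + a returns w. Differentiated, this says
    -- that the form at a inverts the derivative of the translation; as DΨ is the form, Ψ composed
    -- with the translation has derivative the identity.
    have hcomp : (invForm 𝒢 (c a)).comp (fderiv ℝ k u₀) = ContinuousLinearMap.id ℝ E := by
      have h1 : HasFDerivAt (fun w => chartDiff (𝒢 := 𝒢) (c a, k w))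
          ((invForm 𝒢 (c a)).comp (fderiv ℝ k u₀)) u₀ := by
        have h2 := hasFDerivAt_chartDiff_right (𝒢 := 𝒢) (c.map_source ha1)
        rw [← hk0] at h2 ⊢
        exact h2.comp u₀ hkd.hasFDerivAt
      refine h1.unique ((hasFDerivAt_id u₀).congr_of_eventuallyEq ?_)
      filter_upwards [hpre] with w hw
      simp only [chartDiff, k]
      rw [← hcdef, c.left_inv ha1, c.left_inv hw.2, add_sub_cancel_right, c.right_inv hw.1]
      rfl
    have h1 : HasFDerivAt (fun w => Ψ (k w)) (ContinuousLinearMap.id ℝ E) u₀ := by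
      rw [← hcomp]
      have h2 := hΨ _ (hes ha2)
      rw [← hk0] at h2 ⊢
      exact h2.comp u₀ hkd.hasFDerivAt
    rw [← hes0] at h1
    have h2 := h1.comp (0 : E) hesd
    rw [ContinuousLinearMap.comp_id] at h2
    exact h2

end LieLog

/-! ### The matrix of a Riemannian metric in a chart. -/

section MetricMatrix

variable {ι : Type*} [Fintype ι] [DecidableEq ι]
variable {X : Type*} [TopologicalSpace X] [ChartedSpace (EuclideanSpace ℝ ι) X]
  [IsManifold 𝓘(ℝ, EuclideanSpace ℝ ι) ∞ X]
variable {φ : OpenPartialHomeomorph X (EuclideanSpace ℝ ι)} {y : EuclideanSpace ℝ ι}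

theorem euclidean_eq_sum (v : EuclideanSpace ℝ ι) :
    v = ∑ i, v i • EuclideanSpace.single i (1 : ℝ) := by
  simpa using ((EuclideanSpace.basisFun ι ℝ).sum_repr v).symm

theorem mdifferentiableAt_symm
    (hφ : φ ∈ IsManifold.maximalAtlas 𝓘(ℝ, EuclideanSpace ℝ ι) ∞ X) (hy : y ∈ φ.target) :
    MDifferentiableAt 𝓘(ℝ, EuclideanSpace ℝ ι) 𝓘(ℝ, EuclideanSpace ℝ ι) φ.symm y :=
  (contMDiffAt_symm_of_mem_maximalAtlas hφ hy).mdifferentiableAt (by simp)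

theorem mdifferentiableAt_chart
    (hφ : φ ∈ IsManifold.maximalAtlas 𝓘(ℝ, EuclideanSpace ℝ ι) ∞ X) (hy : y ∈ φ.target) :
    MDifferentiableAt 𝓘(ℝ, EuclideanSpace ℝ ι) 𝓘(ℝ, EuclideanSpace ℝ ι) φ (φ.symm y) :=
  (contMDiffAt_of_mem_maximalAtlas hφ (φ.map_target hy)).mdifferentiableAt (by simp)

theorem mfderiv_chart_mfderiv_symm
    (hφ : φ ∈ IsManifold.maximalAtlas 𝓘(ℝ, EuclideanSpace ℝ ι) ∞ X) (hy : y ∈ φ.target)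
    (v : EuclideanSpace ℝ ι) :
    (mfderiv 𝓘(ℝ, EuclideanSpace ℝ ι) 𝓘(ℝ, EuclideanSpace ℝ ι) φ (φ.symm y)
      (mfderiv 𝓘(ℝ, EuclideanSpace ℝ ι) 𝓘(ℝ, EuclideanSpace ℝ ι) φ.symm y v) :
        EuclideanSpace ℝ ι) = v := by
  have h := mfderiv_comp (x := y) (mdifferentiableAt_chart hφ hy) (mdifferentiableAt_symm hφ hy)
  have h2 : (φ ∘ φ.symm) =ᶠ[𝓝 y] id := by
    filter_upwards [φ.open_target.mem_nhds hy] with z hz using φ.right_inv hz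
  rw [h2.mfderiv_eq, mfderiv_id] at h
  exact (DFunLike.congr_fun h v).symm

theorem mfderiv_symm_mfderiv_chart
    (hφ : φ ∈ IsManifold.maximalAtlas 𝓘(ℝ, EuclideanSpace ℝ ι) ∞ X) (hy : y ∈ φ.target)
    (v : TangentSpace 𝓘(ℝ, EuclideanSpace ℝ ι) (φ.symm y)) :
    mfderiv 𝓘(ℝ, EuclideanSpace ℝ ι) 𝓘(ℝ, EuclideanSpace ℝ ι) φ.symm y
      (mfderiv 𝓘(ℝ, EuclideanSpace ℝ ι) 𝓘(ℝ, EuclideanSpace ℝ ι) φ (φ.symm y) v :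
        EuclideanSpace ℝ ι) = v := by
  have h1 := φ.right_inv hy
  have hs : MDifferentiableAt 𝓘(ℝ, EuclideanSpace ℝ ι) 𝓘(ℝ, EuclideanSpace ℝ ι) φ.symm
      (φ (φ.symm y)) := by rw [h1]; exact mdifferentiableAt_symm hφ hy
  have h := mfderiv_comp (x := φ.symm y) hs (mdifferentiableAt_chart hφ hy)
  have h2 : (φ.symm ∘ φ) =ᶠ[𝓝 (φ.symm y)] id := by
    filter_upwards [φ.open_source.mem_nhds (φ.map_target hy)] with z hz using φ.left_inv hz
  rw [h2.mfderiv_eq, mfderiv_id, h1] at h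
  exact (DFunLike.congr_fun h v).symm

theorem sum_coordVector (y : EuclideanSpace ℝ ι) (v : EuclideanSpace ℝ ι) :
    ∑ i, v i • coordVector φ y i
      = mfderiv 𝓘(ℝ, EuclideanSpace ℝ ι) 𝓘(ℝ, EuclideanSpace ℝ ι) φ.symm y v := by
  have hv := euclidean_eq_sum v
  simp only [coordVector]
  conv_rhs => rw [hv]
  exact (map_sum (mfderiv 𝓘(ℝ, EuclideanSpace ℝ ι) 𝓘(ℝ, EuclideanSpace ℝ ι) φ.symm y)
    (fun i => v i • EuclideanSpace.single i (1 : ℝ)) Finset.univ).symm ▸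
    Finset.sum_congr rfl fun i _ => (map_smul (mfderiv 𝓘(ℝ, EuclideanSpace ℝ ι)
      𝓘(ℝ, EuclideanSpace ℝ ι) φ.symm y) (v i) (EuclideanSpace.single i (1 : ℝ))).symm

theorem sum_coordVector_ne_zero
    (hφ : φ ∈ IsManifold.maximalAtlas 𝓘(ℝ, EuclideanSpace ℝ ι) ∞ X) (hy : y ∈ φ.target)
    {c : ι → ℝ} (hc : c ≠ 0) : ∑ i, c i • coordVector φ y i ≠ 0 := by
  intro h
  have h1 := (sum_coordVector (φ := φ) y (WithLp.toLp 2 c)).symm.trans h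
  have h2 := mfderiv_chart_mfderiv_symm hφ hy (WithLp.toLp 2 c)
  rw [h1] at h2
  apply hc
  have h3 : (WithLp.toLp 2 c : EuclideanSpace ℝ ι) = 0 := h2.symm.trans (map_zero _)
  simpa using h3

variable (g : RiemannianMetric ι X)

theorem inner_sum_sum {x : X} {α β : Type*} (s : Finset α) (s' : Finset β) (a : α → ℝ) (b : β → ℝ)
    (v : α → TangentSpace 𝓘(ℝ, EuclideanSpace ℝ ι) x)
    (w : β → TangentSpace 𝓘(ℝ, EuclideanSpace ℝ ι) x) :
    g.inner x (∑ i ∈ s, a i • v i) (∑ j ∈ s', b j • w j)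
      = ∑ i ∈ s, ∑ j ∈ s', a i * b j * g.inner x (v i) (w j) := by
  simp only [map_sum, map_smul, _root_.sum_apply, _root_.smul_apply, smul_eq_mul, Finset.mul_sum,
    mul_assoc]
  rw [Finset.sum_comm]
  exact Finset.sum_congr rfl fun i _ => Finset.sum_congr rfl fun j _ => by ring

theorem metricMatrix_symm (φ : OpenPartialHomeomorph X (EuclideanSpace ℝ ι))
    (y : EuclideanSpace ℝ ι) (i j : ι) : metricMatrix g φ y i j = metricMatrix g φ y j i :=
  g.symm _ _ _

theorem metricMatrix_posDef
    (hφ : φ ∈ IsManifold.maximalAtlas 𝓘(ℝ, EuclideanSpace ℝ ι) ∞ X) (hy : y ∈ φ.target) :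
    (metricMatrix g φ y).PosDef := by
  refine Matrix.PosDef.of_dotProduct_mulVec_pos ?_ ?_
  · ext i j
    simp only [Matrix.conjTranspose_apply, star_trivial]
    exact metricMatrix_symm g φ y j i
  · intro c hc
    have key : star c ⬝ᵥ (metricMatrix g φ y).mulVec c
        = g.inner (φ.symm y) (∑ i, c i • coordVector φ y i) (∑ i, c i • coordVector φ y i) := by
      rw [inner_sum_sum]
      simp only [dotProduct, Matrix.mulVec, metricMatrix, Matrix.of_apply, Finset.mul_sum,
        star_trivial]
      exact Finset.sum_congr rfl fun i _ => Finset.sum_congr rfl fun j _ => by ring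
    rw [key]
    exact g.pos _ _ (sum_coordVector_ne_zero hφ hy hc)

theorem contMDiffOn_coordVector
    (hφ : φ ∈ IsManifold.maximalAtlas 𝓘(ℝ, EuclideanSpace ℝ ι) ∞ X) (i : ι) :
    ContMDiffOn 𝓘(ℝ, EuclideanSpace ℝ ι) 𝓘(ℝ, EuclideanSpace ℝ ι).tangent ∞
      (fun y => (Bundle.TotalSpace.mk' (EuclideanSpace ℝ ι) (φ.symm y) (coordVector φ y i) :
        TangentBundle 𝓘(ℝ, EuclideanSpace ℝ ι) X)) φ.target := by
  have h1 := (contMDiffOn_symm_of_mem_maximalAtlas hφ).contMDiffOn_tangentMapWithin (m := ∞)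
    (by simp) φ.open_target.uniqueMDiffOn
  have h2 : ContMDiffOn 𝓘(ℝ, EuclideanSpace ℝ ι) 𝓘(ℝ, EuclideanSpace ℝ ι).tangent ∞
      (fun y => (Bundle.TotalSpace.mk' (EuclideanSpace ℝ ι) y
        (EuclideanSpace.single i (1 : ℝ) : EuclideanSpace ℝ ι) :
        TangentBundle 𝓘(ℝ, EuclideanSpace ℝ ι) (EuclideanSpace ℝ ι))) φ.target :=
    contMDiffOn_vectorSpace_iff_contDiffOn.2 contDiffOn_const
  refine (h1.comp h2 fun y hy => hy).congr fun y hy => ?_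
  simp only [Function.comp_apply, tangentMapWithin, coordVector]
  rw [mfderivWithin_of_isOpen φ.open_target hy]

theorem contDiffOn_metricMatrix
    (hφ : φ ∈ IsManifold.maximalAtlas 𝓘(ℝ, EuclideanSpace ℝ ι) ∞ X) (i j : ι) :
    ContDiffOn ℝ ∞ (fun y => metricMatrix g φ y i j) φ.target := by
  rw [← contMDiffOn_iff_contDiffOn]
  have h := ContMDiffOn.clm_bundle_apply₂ (𝕜 := ℝ) (F₁ := EuclideanSpace ℝ ι)
    (F₂ := EuclideanSpace ℝ ι) (F₃ := ℝ) (E₃ := Bundle.Trivial X ℝ) (s := φ.target) (n := ∞)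
    (b := φ.symm) (ψ := fun y => g.inner (φ.symm y))
    (g.contMDiff.comp_contMDiffOn (contMDiffOn_symm_of_mem_maximalAtlas hφ))
    (contMDiffOn_coordVector hφ i) (contMDiffOn_coordVector hφ j)
  intro y hy
  have h2 := h y hy
  rw [Bundle.contMDiffWithinAt_totalSpace] at h2
  exact h2.2

end MetricMatrix

/-! ### Pullbacks of a metric in terms of the model spaces. -/

section PullInner

variable {ι : Type*} [Fintype ι] [DecidableEq ι]
variable {X : Type*} [TopologicalSpace X] [ChartedSpace (EuclideanSpace ℝ ι) X]
  [IsManifold 𝓘(ℝ, EuclideanSpace ℝ ι) ∞ X]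
variable {E : Type*} [NormedAddCommGroup E] [NormedSpace ℝ E]
  {S : Type*} [TopologicalSpace S] [ChartedSpace E S]
  {E' : Type*} [NormedAddCommGroup E'] [NormedSpace ℝ E']
  {S' : Type*} [TopologicalSpace S'] [ChartedSpace E' S']

/-- The metric at `x` as a bilinear form on the model space. -/
def modelInner (g : RiemannianMetric ι X) (x : X) (v w : EuclideanSpace ℝ ι) : ℝ := g.inner x v w

/-- The derivative of a map between manifolds, as a map between the model spaces. -/
def modelDeriv (E' E : Type*) [NormedAddCommGroup E] [NormedSpace ℝ E]
    {S : Type*} [TopologicalSpace S] [ChartedSpace E S] [NormedAddCommGroup E'] [NormedSpace ℝ E']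
    {S' : Type*} [TopologicalSpace S'] [ChartedSpace E' S'] (F : S' → S) (s : S') : E' →L[ℝ] E :=
  mfderiv 𝓘(ℝ, E') 𝓘(ℝ, E) F s

theorem modelDeriv_congr {F F' : S' → S} {s : S'} (h : F =ᶠ[𝓝 s] F') :
    modelDeriv E' E F s = modelDeriv E' E F' s := h.mfderiv_eq

theorem modelDeriv_comp {E'' : Type*} [NormedAddCommGroup E''] [NormedSpace ℝ E'']
    {S'' : Type*} [TopologicalSpace S''] [ChartedSpace E'' S''] {F : S' → S} {K : S'' → S'} {s : S''}
    (hF : MDifferentiableAt 𝓘(ℝ, E') 𝓘(ℝ, E) F (K s))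
    (hK : MDifferentiableAt 𝓘(ℝ, E'') 𝓘(ℝ, E') K s) (v : E'') :
    modelDeriv E'' E (F ∘ K) s v
      = modelDeriv E' E F (K s) (modelDeriv E'' E' K s v) :=
  DFunLike.congr_fun (mfderiv_comp s hF hK) v

/-- The pullback of the metric under a map `F`, evaluated on vectors of the model space. -/
def pullInner (g : RiemannianMetric ι X) (F : S → X) (s : S) (v w : E) : ℝ :=
  modelInner g (F s) (modelDeriv E (EuclideanSpace ℝ ι) F s v) (modelDeriv E (EuclideanSpace ℝ ι) F s w)

variable (g : RiemannianMetric ι X)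

theorem pullInner_congr {F F' : S → X} {s : S} (h : F =ᶠ[𝓝 s] F') (v w : E) :
    pullInner g F s v w = pullInner g F' s v w := by
  simp only [pullInner, modelDeriv_congr h]
  rw [h.self_of_nhds]

/-- The chain rule by which reparametrizations of the source are handled: translations in canonical
coordinates, shears, and automorphisms of the group. -/
theorem pullInner_comp {F : S → X} {K : S' → S} {s : S'}
    (hF : MDifferentiableAt 𝓘(ℝ, E) 𝓘(ℝ, EuclideanSpace ℝ ι) F (K s))
    (hK : MDifferentiableAt 𝓘(ℝ, E') 𝓘(ℝ, E) K s) (v w : E') :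
    pullInner g (F ∘ K) s v w = pullInner g F (K s) (modelDeriv E' E K s v)
      (modelDeriv E' E K s w) := by
  simp only [pullInner, modelDeriv_comp hF hK, Function.comp_apply]

theorem modelInner_add_left (x : X) (u v w : EuclideanSpace ℝ ι) :
    modelInner g x (u + v) w = modelInner g x u w + modelInner g x v w :=
  DFunLike.congr_fun (map_add (g.inner x) u v) w

theorem modelInner_smul_left (x : X) (c : ℝ) (v w : EuclideanSpace ℝ ι) :
    modelInner g x (c • v) w = c * modelInner g x v w :=
  DFunLike.congr_fun (map_smul (g.inner x) c v) w

theorem pullInner_symm (F : S → X) (s : S) (v w : E) :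
    pullInner g F s v w = pullInner g F s w v := g.symm _ _ _

theorem pullInner_add_left (F : S → X) (s : S) (u v w : E) :
    pullInner g F s (u + v) w = pullInner g F s u w + pullInner g F s v w := by
  simp only [pullInner, map_add, modelInner_add_left]

theorem pullInner_smul_left (F : S → X) (s : S) (c : ℝ) (v w : E) :
    pullInner g F s (c • v) w = c * pullInner g F s v w := by
  simp only [pullInner, map_smul, modelInner_smul_left]

/-- The pulled back metric as a bilinear form. -/
def pullForm (F : S → X) (s : S) : LinearMap.BilinForm ℝ E :=
  LinearMap.mk₂ ℝ (pullInner g F s) (pullInner_add_left g F s) (pullInner_smul_left g F s)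
    (fun u v w => by
      rw [pullInner_symm, pullInner_add_left, pullInner_symm g F s v, pullInner_symm g F s w])
    (fun c v w => by rw [pullInner_symm, pullInner_smul_left, pullInner_symm g F s w, smul_eq_mul])

@[simp] theorem pullForm_apply (F : S → X) (s : S) (v w : E) :
    pullForm g F s v w = pullInner g F s v w := rfl

theorem metricMatrix_eq_pullInner (φ : OpenPartialHomeomorph X (EuclideanSpace ℝ ι))
    (y : EuclideanSpace ℝ ι) (i j : ι) :
    metricMatrix g φ y i j
      = pullInner g φ.symm y (EuclideanSpace.single i (1 : ℝ)) (EuclideanSpace.single j (1 : ℝ)) :=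
  rfl

end PullInner

/-! ### Splitting coordinates into fiber and base; shears. -/

section Splitting

variable {ι κ : Type*} [Fintype ι] [DecidableEq ι] [Fintype κ] [DecidableEq κ]

/-- The projection to the fiber coordinates. -/
def fiberProj : EuclideanSpace ℝ (κ ⊕ ι) →L[ℝ] EuclideanSpace ℝ κ :=
  LinearMap.toContinuousLinearMap
    { toFun := fun y => WithLp.toLp 2 fun i => y (Sum.inl i)
      map_add' := fun _ _ => rfl
      map_smul' := fun _ _ => rfl }

/-- The point with given fiber and base coordinates. -/
def joinCoord : EuclideanSpace ℝ κ × EuclideanSpace ℝ ι →L[ℝ] EuclideanSpace ℝ (κ ⊕ ι) :=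
  LinearMap.toContinuousLinearMap
    { toFun := fun p => WithLp.toLp 2 (Sum.elim p.1 p.2)
      map_add' := fun p q => by ext (i | i) <;> rfl
      map_smul' := fun c p => by ext (i | i) <;> rfl }

@[simp] theorem fiberProj_joinCoord (p : EuclideanSpace ℝ κ × EuclideanSpace ℝ ι) :
    fiberProj (joinCoord p) = p.1 := rfl

@[simp] theorem baseProj_joinCoord (p : EuclideanSpace ℝ κ × EuclideanSpace ℝ ι) :
    baseProj (joinCoord p) = p.2 := rfl

@[simp] theorem joinCoord_proj (y : EuclideanSpace ℝ (κ ⊕ ι)) :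
    joinCoord (fiberProj y, baseProj y) = y := by
  ext (i | i) <;> rfl

theorem joinCoord_single_left (i : κ) (c : ℝ) :
    joinCoord ((EuclideanSpace.single i c : EuclideanSpace ℝ κ), (0 : EuclideanSpace ℝ ι))
      = EuclideanSpace.single (Sum.inl i) c := by
  ext (j | j)
  · change (EuclideanSpace.single i c : EuclideanSpace ℝ κ) j = _
    simp
  · change (0 : EuclideanSpace ℝ ι) j = _
    simp

theorem joinCoord_left_eq_sum (x : EuclideanSpace ℝ κ) :
    joinCoord (x, (0 : EuclideanSpace ℝ ι)) = ∑ k, x k • EuclideanSpace.single (Sum.inl k) (1 : ℝ) := by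
  have hv := euclidean_eq_sum x
  have h : joinCoord (x, (0 : EuclideanSpace ℝ ι))
      = (joinCoord.comp (ContinuousLinearMap.inl ℝ (EuclideanSpace ℝ κ) (EuclideanSpace ℝ ι))) x :=
    rfl
  rw [h]
  conv_lhs => rw [hv]
  rw [map_sum]
  refine Finset.sum_congr rfl fun k _ => ?_
  rw [map_smul]
  exact congrArg _ (joinCoord_single_left k 1)

/-- The splitting of coordinates into base and fiber coordinates. -/
def splitHomeomorph : EuclideanSpace ℝ ι × EuclideanSpace ℝ κ ≃ₜ EuclideanSpace ℝ (κ ⊕ ι) where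
  toFun p := joinCoord (p.2, p.1)
  invFun y := (baseProj y, fiberProj y)
  left_inv _ := rfl
  right_inv y := joinCoord_proj y
  continuous_toFun := joinCoord.continuous.comp continuous_swap
  continuous_invFun := baseProj.continuous.prodMk fiberProj.continuous

variable {V : Set (EuclideanSpace ℝ ι)} {q : κ → EuclideanSpace ℝ ι → ℝ}

/-- Translation of the fiber coordinates by a function of the base coordinates. -/
def shear (q : κ → EuclideanSpace ℝ ι → ℝ) (y : EuclideanSpace ℝ (κ ⊕ ι)) :
    EuclideanSpace ℝ (κ ⊕ ι) :=
  y + joinCoord (WithLp.toLp 2 fun k => q k (baseProj y), 0)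

@[simp] theorem baseProj_shear (y : EuclideanSpace ℝ (κ ⊕ ι)) : baseProj (shear q y) = baseProj y := by
  simp [shear]

/-- The translation depends only on the base coordinates, which a shear does not move. -/
theorem shear_neg_shear (y : EuclideanSpace ℝ (κ ⊕ ι)) : shear (-q) (shear q y) = y := by
  rw [shear, baseProj_shear, shear]
  ext (i | i)
  · change y (Sum.inl i) + q i _ + -q i _ = _
    ring
  · change y (Sum.inr i) + 0 + 0 = _
    ring

theorem contDiffOn_shear (hq : ∀ k, ContDiffOn ℝ ∞ (q k) V) :
    ContDiffOn ℝ ∞ (shear (κ := κ) q) (baseProj ⁻¹' V) := by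
  have h1 : ContDiffOn ℝ ∞ (fun y : EuclideanSpace ℝ (κ ⊕ ι) =>
      (WithLp.toLp 2 fun k => q k (baseProj y) : EuclideanSpace ℝ κ)) (baseProj ⁻¹' V) := by
    rw [contDiffOn_euclidean]
    intro k
    exact (hq k).comp (ContinuousLinearMap.contDiff (n := ∞)
      (baseProj (κ := κ) (ι := ι))).contDiffOn fun _ h => h
  have h2 : ContDiffOn ℝ ∞ (fun y : EuclideanSpace ℝ (κ ⊕ ι) =>
      ((WithLp.toLp 2 fun k => q k (baseProj y) : EuclideanSpace ℝ κ), (0 : EuclideanSpace ℝ ι)))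
      (baseProj ⁻¹' V) := h1.prodMk contDiffOn_const
  exact contDiffOn_id.add ((ContinuousLinearMap.contDiff (n := ∞)
    (joinCoord (κ := κ) (ι := ι))).comp_contDiffOn h2)

/-- The shear as a chart of the model space. -/
def shearChart (hV : IsOpen V) (hq : ∀ k, ContDiffOn ℝ ∞ (q k) V) :
    OpenPartialHomeomorph (EuclideanSpace ℝ (κ ⊕ ι)) (EuclideanSpace ℝ (κ ⊕ ι)) where
  toFun := shear q
  invFun := shear (-q)
  source := baseProj ⁻¹' V
  target := baseProj ⁻¹' V
  map_source' y hy := by simpa using hy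
  map_target' y hy := by simpa using hy
  left_inv' y _ := shear_neg_shear y
  right_inv' y _ := by simpa using shear_neg_shear (q := -q) y
  open_source := hV.preimage baseProj.continuous
  open_target := hV.preimage baseProj.continuous
  continuousOn_toFun := (contDiffOn_shear hq).continuousOn
  continuousOn_invFun := (contDiffOn_shear fun k => (hq k).neg).continuousOn

theorem fderiv_shear (hV : IsOpen V) (hq : ∀ k, ContDiffOn ℝ ∞ (q k) V)
    {y : EuclideanSpace ℝ (κ ⊕ ι)} (hy : baseProj y ∈ V) (v : EuclideanSpace ℝ (κ ⊕ ι)) :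
    fderiv ℝ (shear q) y v
      = v + joinCoord (WithLp.toLp 2 fun k => fderiv ℝ (q k) (baseProj y) (baseProj v), 0) := by
  have h1 : HasFDerivAt (fun y : EuclideanSpace ℝ (κ ⊕ ι) =>
      (WithLp.toLp 2 fun k => q k (baseProj y) : EuclideanSpace ℝ κ))
      ((PiLp.continuousLinearEquiv 2 ℝ fun _ : κ => ℝ).symm.toContinuousLinearMap ∘L
        ContinuousLinearMap.pi fun k => (fderiv ℝ (q k) (baseProj y)).comp baseProj) y := by
    rw [← hasFDerivWithinAt_univ, hasFDerivWithinAt_euclidean]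
    intro k
    exact ((differentiableAt_of_contDiffOn hV (hq k) hy).hasFDerivAt.comp y
      baseProj.hasFDerivAt).hasFDerivWithinAt
  have h2 := (hasFDerivAt_id y).add (joinCoord.hasFDerivAt.comp y
    (h1.prodMk (hasFDerivAt_const (0 : EuclideanSpace ℝ ι) y)))
  have h3 : fderiv ℝ (shear q) y = _ := h2.fderiv
  rw [h3]
  rfl

end Splitting

/-! ### Adapted charts of the total space. -/

section AdaptedChart

variable {n N : ℕ}
variable {𝒢 : Type*} [AddCommGroup 𝒢] [TopologicalSpace 𝒢]
  [ChartedSpace (EuclideanSpace ℝ (Fin N)) 𝒢]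
variable {B : Type*} [TopologicalSpace B] [ChartedSpace (EuclideanSpace ℝ (Fin n)) B]
variable {M : Type*} [TopologicalSpace M] [ChartedSpace (EuclideanSpace ℝ (Fin N ⊕ Fin n)) M]

/-- A chart at the identity of an abelian Lie group with respect to which the translations have
derivative the identity at the origin. -/
structure IsCanonicalChart (ψ : OpenPartialHomeomorph 𝒢 (EuclideanSpace ℝ (Fin N))) : Prop where
  zero_mem : 0 ∈ ψ.source
  map_zero : ψ 0 = 0
  smooth : ContMDiffOn 𝓘(ℝ, EuclideanSpace ℝ (Fin N)) 𝓘(ℝ, EuclideanSpace ℝ (Fin N)) ∞ ψ ψ.source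
  smooth_symm : ContMDiffOn 𝓘(ℝ, EuclideanSpace ℝ (Fin N)) 𝓘(ℝ, EuclideanSpace ℝ (Fin N)) ∞
    ψ.symm ψ.target
  deriv_symm : ∀ v : EuclideanSpace ℝ (Fin N),
    modelDeriv (EuclideanSpace ℝ (Fin N)) (EuclideanSpace ℝ (Fin N)) ψ.symm 0 v = v
  translate : ∀ a ∈ ψ.source, HasFDerivAt (fun x => ψ (ψ.symm x + a))
    (ContinuousLinearMap.id ℝ (EuclideanSpace ℝ (Fin N))) 0

theorem exists_isCanonicalChart [LieAddGroup 𝓘(ℝ, EuclideanSpace ℝ (Fin N)) ∞ 𝒢] :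
    ∃ ψ : OpenPartialHomeomorph 𝒢 (EuclideanSpace ℝ (Fin N)), IsCanonicalChart ψ := by
  obtain ⟨ψ, h1, h2, h3, h4, h5, h6⟩ :=
    exists_canonicalChart (𝒢 := 𝒢) (E := EuclideanSpace ℝ (Fin N))
  exact ⟨ψ, h1, h2, h3, h4, h5, h6⟩

namespace IsCanonicalChart

variable {ψ : OpenPartialHomeomorph 𝒢 (EuclideanSpace ℝ (Fin N))} (hψ : IsCanonicalChart ψ)
include hψ

theorem zero_mem_target : 0 ∈ ψ.target := hψ.map_zero ▸ ψ.map_source hψ.zero_mem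

theorem symm_zero : ψ.symm 0 = 0 := hψ.map_zero ▸ ψ.left_inv hψ.zero_mem

end IsCanonicalChart

variable {P : TwistedBundle n N 𝒢 B M}

/-- The chart of the total space defined by a local trivialization, a chart of the base and a
chart of the structure group. -/
def adaptedChart (t : Bundle.Trivialization 𝒢 P.proj)
    (k : OpenPartialHomeomorph B (EuclideanSpace ℝ (Fin n)))
    (ψ : OpenPartialHomeomorph 𝒢 (EuclideanSpace ℝ (Fin N))) :
    OpenPartialHomeomorph M (EuclideanSpace ℝ (Fin N ⊕ Fin n)) :=
  (t.toOpenPartialHomeomorph.trans (k.prod ψ)).transHomeomorph splitHomeomorph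

/-- The domain in the coordinates of the base over which the adapted charts are defined. -/
def adaptedDomain (t : Bundle.Trivialization 𝒢 P.proj)
    (k : OpenPartialHomeomorph B (EuclideanSpace ℝ (Fin n))) : Set (EuclideanSpace ℝ (Fin n)) :=
  k.target ∩ k.symm ⁻¹' t.baseSet

variable {t : Bundle.Trivialization 𝒢 P.proj}
  {k : OpenPartialHomeomorph B (EuclideanSpace ℝ (Fin n))}
  {ψ : OpenPartialHomeomorph 𝒢 (EuclideanSpace ℝ (Fin N))}

theorem isOpen_adaptedDomain : IsOpen (adaptedDomain t k) :=
  k.isOpen_inter_preimage_symm t.open_baseSet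

theorem adaptedChart_symm_apply (y : EuclideanSpace ℝ (Fin N ⊕ Fin n)) :
    (adaptedChart t k ψ).symm y
      = t.toOpenPartialHomeomorph.symm (k.symm (baseProj y), ψ.symm (fiberProj y)) := rfl

theorem mem_adaptedChart_target {y : EuclideanSpace ℝ (Fin N ⊕ Fin n)} :
    y ∈ (adaptedChart t k ψ).target ↔ baseProj y ∈ adaptedDomain t k ∧ fiberProj y ∈ ψ.target := by
  have h : y ∈ (adaptedChart t k ψ).target ↔ (baseProj y ∈ k.target ∧ fiberProj y ∈ ψ.target) ∧
      (k.symm (baseProj y), ψ.symm (fiberProj y)) ∈ t.target := by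
    simp only [adaptedChart]
    rfl
  rw [h, t.target_eq]
  simp only [Set.mem_prod, Set.mem_univ, and_true, adaptedDomain, Set.mem_inter_iff,
    Set.mem_preimage]
  tauto

theorem proj_adaptedChart_symm {y : EuclideanSpace ℝ (Fin N ⊕ Fin n)}
    (hy : y ∈ (adaptedChart t k ψ).target) :
    P.proj ((adaptedChart t k ψ).symm y) = k.symm (baseProj y) :=
  t.proj_symm_apply (TwistedBundle.mem_target (mem_adaptedChart_target.1 hy).1.2 _)

variable [IsManifold 𝓘(ℝ, EuclideanSpace ℝ (Fin n)) ∞ B]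
  [IsManifold 𝓘(ℝ, EuclideanSpace ℝ (Fin N ⊕ Fin n)) ∞ M]

theorem adaptedChart_mem_maximalAtlas (ht : t ∈ P.atlas)
    (hk : k ∈ IsManifold.maximalAtlas 𝓘(ℝ, EuclideanSpace ℝ (Fin n)) ∞ B)
    (hψ : IsCanonicalChart ψ) :
    adaptedChart t k ψ
      ∈ IsManifold.maximalAtlas 𝓘(ℝ, EuclideanSpace ℝ (Fin N ⊕ Fin n)) ∞ M := by
  refine OpenPartialHomeomorph.mem_maximalAtlas_of_contMDiffOn _ ?_ ?_
  · have h0 : (adaptedChart t k ψ).source ⊆ t.source := fun m hm => hm.1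
    have h1 := (P.smooth_toFun t ht).mono h0
    have h2 : ContMDiffOn 𝓘(ℝ, EuclideanSpace ℝ (Fin N ⊕ Fin n)) 𝓘(ℝ, EuclideanSpace ℝ (Fin n)) ∞
        (fun m => k (t m).1) (adaptedChart t k ψ).source :=
      (contMDiffOn_of_mem_maximalAtlas hk).comp (fun m hm => (h1 m hm).fst) fun m hm => hm.2.1
    have h3 : ContMDiffOn 𝓘(ℝ, EuclideanSpace ℝ (Fin N ⊕ Fin n)) 𝓘(ℝ, EuclideanSpace ℝ (Fin N)) ∞
        (fun m => ψ (t m).2) (adaptedChart t k ψ).source :=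
      hψ.smooth.comp (fun m hm => (h1 m hm).snd) fun m hm => hm.2.2
    exact (ContinuousLinearMap.contMDiff (n := ∞)
      (joinCoord (κ := Fin N) (ι := Fin n))).comp_contMDiffOn (h3.prodMk_space h2)
  · have h1 : ContMDiffOn 𝓘(ℝ, EuclideanSpace ℝ (Fin N ⊕ Fin n)) 𝓘(ℝ, EuclideanSpace ℝ (Fin n)) ∞
        (fun y => k.symm (baseProj y)) (adaptedChart t k ψ).target :=
      (contMDiffOn_symm_of_mem_maximalAtlas hk).comp (ContinuousLinearMap.contMDiff (n := ∞)
        (baseProj (κ := Fin N) (ι := Fin n))).contMDiffOn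
        fun y hy => (mem_adaptedChart_target.1 hy).1.1
    have h2 : ContMDiffOn 𝓘(ℝ, EuclideanSpace ℝ (Fin N ⊕ Fin n)) 𝓘(ℝ, EuclideanSpace ℝ (Fin N)) ∞
        (fun y => ψ.symm (fiberProj y)) (adaptedChart t k ψ).target :=
      hψ.smooth_symm.comp (ContinuousLinearMap.contMDiff (n := ∞)
        (fiberProj (κ := Fin N) (ι := Fin n))).contMDiffOn
        fun y hy => (mem_adaptedChart_target.1 hy).2
    exact (P.smooth_invFun t ht).comp (h1.prodMk h2) fun y hy =>
      TwistedBundle.mem_target (mem_adaptedChart_target.1 hy).1.2 _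

variable (gbar : RiemannianMetric (Fin N ⊕ Fin n) M)

/-- The metric in an adapted chart, at the points of the zero section. -/
def baseForm (gbar : RiemannianMetric (Fin N ⊕ Fin n) M) (t : Bundle.Trivialization 𝒢 P.proj)
    (k : OpenPartialHomeomorph B (EuclideanSpace ℝ (Fin n)))
    (ψ : OpenPartialHomeomorph 𝒢 (EuclideanSpace ℝ (Fin N))) (z : EuclideanSpace ℝ (Fin n)) :
    LinearMap.BilinForm ℝ (EuclideanSpace ℝ (Fin N ⊕ Fin n)) :=
  pullForm gbar (adaptedChart t k ψ).symm (joinCoord (0, z))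

theorem pullInner_translate {E S : Type*} [NormedAddCommGroup E] [NormedSpace ℝ E]
    [TopologicalSpace S] [ChartedSpace E S] (hinv : P.IsInvariant gbar) (ht : t ∈ P.atlas) (a : 𝒢)
    {F : S → M} {y : S}
    (hF : MDifferentiableAt 𝓘(ℝ, E) 𝓘(ℝ, EuclideanSpace ℝ (Fin N ⊕ Fin n)) F y)
    (hy : F y ∈ t.source)
    (hT : MDifferentiableAt 𝓘(ℝ, EuclideanSpace ℝ (Fin N ⊕ Fin n))
      𝓘(ℝ, EuclideanSpace ℝ (Fin N ⊕ Fin n)) (TwistedBundle.translate t a) (F y)) (v w : E) :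
    pullInner gbar (TwistedBundle.translate t a ∘ F) y v w = pullInner gbar F y v w := by
  have h := hinv t ht a (F y) hy (modelDeriv E (EuclideanSpace ℝ (Fin N ⊕ Fin n)) F y v)
    (modelDeriv E (EuclideanSpace ℝ (Fin N ⊕ Fin n)) F y w)
  refine Eq.trans ?_ h
  simp only [pullInner]
  rw [modelDeriv_comp hT hF, modelDeriv_comp hT hF]
  rfl

theorem mdifferentiableAt_translate [LieAddGroup 𝓘(ℝ, EuclideanSpace ℝ (Fin N)) ∞ 𝒢]
    (ht : t ∈ P.atlas) (a : 𝒢) {m : M} (hm : m ∈ t.source) :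
    MDifferentiableAt 𝓘(ℝ, EuclideanSpace ℝ (Fin N ⊕ Fin n))
      𝓘(ℝ, EuclideanSpace ℝ (Fin N ⊕ Fin n)) (TwistedBundle.translate t a) m := by
  have h1 : ContMDiffAt 𝓘(ℝ, EuclideanSpace ℝ (Fin N ⊕ Fin n))
      (𝓘(ℝ, EuclideanSpace ℝ (Fin n)).prod 𝓘(ℝ, EuclideanSpace ℝ (Fin N))) ∞ t m :=
    (P.smooth_toFun t ht).contMDiffAt (t.open_source.mem_nhds hm)
  have h2 : ContMDiffAt 𝓘(ℝ, EuclideanSpace ℝ (Fin N ⊕ Fin n)) 𝓘(ℝ, EuclideanSpace ℝ (Fin N)) ∞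
      (fun m => (t m).2 + a) m := h1.snd.add contMDiffAt_const
  have hb : (t m).1 ∈ t.baseSet := by rw [t.coe_fst hm]; exact t.mem_source.1 hm
  have h3 : ContMDiffAt _ 𝓘(ℝ, EuclideanSpace ℝ (Fin N ⊕ Fin n)) ∞
      t.toOpenPartialHomeomorph.symm ((t m).1, (t m).2 + a) :=
    (P.smooth_invFun t ht).contMDiffAt (t.open_target.mem_nhds (TwistedBundle.mem_target hb _))
  exact (h3.comp m (h1.fst.prodMk h2)).mdifferentiableAt (by simp)

/-- In an adapted chart, the metric does not depend on the fiber coordinates. -/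
theorem pullInner_adaptedChart [LieAddGroup 𝓘(ℝ, EuclideanSpace ℝ (Fin N)) ∞ 𝒢]
    (hinv : P.IsInvariant gbar) (ht : t ∈ P.atlas)
    (hk : k ∈ IsManifold.maximalAtlas 𝓘(ℝ, EuclideanSpace ℝ (Fin n)) ∞ B)
    (hψ : IsCanonicalChart ψ) {y : EuclideanSpace ℝ (Fin N ⊕ Fin n)}
    (hy : y ∈ (adaptedChart t k ψ).target) (v w : EuclideanSpace ℝ (Fin N ⊕ Fin n)) :
    pullInner gbar (adaptedChart t k ψ).symm y v w = baseForm gbar t k ψ (baseProj y) v w := by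
  have : IsTopologicalAddGroup 𝒢 :=
    topologicalAddGroup_of_lieAddGroup 𝓘(ℝ, EuclideanSpace ℝ (Fin N)) ∞
  have hΦ := adaptedChart_mem_maximalAtlas ht hk hψ
  obtain ⟨hz, hx⟩ := mem_adaptedChart_target.1 hy
  set a := ψ.symm (fiberProj y) with ha
  have has : a ∈ ψ.source := ψ.map_target hx
  let y₀ : EuclideanSpace ℝ (Fin N ⊕ Fin n) := joinCoord (0, baseProj y)
  -- K is the fiber translation by a, read in coordinates. It sends the point of the zero section to
  -- y, and by the choice of ψ its derivative there is the identity.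
  let K : EuclideanSpace ℝ (Fin N ⊕ Fin n) → EuclideanSpace ℝ (Fin N ⊕ Fin n) :=
    fun y' => joinCoord (ψ (ψ.symm (fiberProj y') + a), baseProj y')
  have hy₀ : y₀ ∈ (adaptedChart t k ψ).target :=
    mem_adaptedChart_target.2 ⟨hz, hψ.zero_mem_target⟩
  have hK0 : K y₀ = y := by
    change joinCoord (ψ (ψ.symm 0 + a), baseProj y) = y
    rw [hψ.symm_zero, zero_add, ha, ψ.right_inv hx, joinCoord_proj]
  have hKd : HasFDerivAt K (ContinuousLinearMap.id ℝ _) y₀ := by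
    have h1 := (hψ.translate a has)
    have h2 : HasFDerivAt (fun y' : EuclideanSpace ℝ (Fin N ⊕ Fin n) =>
        ψ (ψ.symm (fiberProj y') + a)) ((ContinuousLinearMap.id ℝ _).comp fiberProj) y₀ :=
      HasFDerivAt.comp (f := fiberProj) y₀ h1 fiberProj.hasFDerivAt
    have h3 := joinCoord.hasFDerivAt.comp y₀ (h2.prodMk baseProj.hasFDerivAt)
    exact h3.congr_fderiv (ContinuousLinearMap.ext fun u => joinCoord_proj u)
  have hKm : MDifferentiableAt 𝓘(ℝ, EuclideanSpace ℝ (Fin N ⊕ Fin n))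
      𝓘(ℝ, EuclideanSpace ℝ (Fin N ⊕ Fin n)) K y₀ := hKd.differentiableAt.mdifferentiableAt
  have hKid : modelDeriv (EuclideanSpace ℝ (Fin N ⊕ Fin n)) (EuclideanSpace ℝ (Fin N ⊕ Fin n)) K y₀
      = ContinuousLinearMap.id ℝ _ := by
    rw [modelDeriv, mfderiv_eq_fderiv]
    exact hKd.fderiv
  -- The adapted chart intertwines K with the isometric local action, so the metric coefficients at
  -- y agree with those on the zero section.
  have hev : TwistedBundle.translate t a ∘ (adaptedChart t k ψ).symm
      =ᶠ[𝓝 y₀] (adaptedChart t k ψ).symm ∘ K := by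
    have h1 : ∀ᶠ y' in 𝓝 y₀, ψ.symm (fiberProj y') + a ∈ ψ.source := by
      have hc : ContinuousAt (fun y' : EuclideanSpace ℝ (Fin N ⊕ Fin n) =>
          ψ.symm (fiberProj y') + a) y₀ :=
        ((ψ.continuousAt_symm hψ.zero_mem_target).comp_of_eq
          (f := fiberProj (κ := Fin N) (ι := Fin n)) fiberProj.continuous.continuousAt rfl).add
          continuousAt_const
      refine hc.eventually (ψ.open_source.mem_nhds ?_)
      change ψ.symm 0 + a ∈ ψ.source
      rw [hψ.symm_zero, zero_add]
      exact has
    filter_upwards [h1, (adaptedChart t k ψ).open_target.mem_nhds hy₀] with y' h1 h2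
    obtain ⟨h3, h4⟩ := mem_adaptedChart_target.1 h2
    simp only [Function.comp_apply, adaptedChart_symm_apply, TwistedBundle.translate, K,
      fiberProj_joinCoord, baseProj_joinCoord, ψ.left_inv h1]
    rw [t.apply_symm_apply (TwistedBundle.mem_target h3.2 _)]
  have hs : (adaptedChart t k ψ).symm y₀ ∈ t.source := ((adaptedChart t k ψ).map_target hy₀).1
  have hFK : MDifferentiableAt 𝓘(ℝ, EuclideanSpace ℝ (Fin N ⊕ Fin n))
      𝓘(ℝ, EuclideanSpace ℝ (Fin N ⊕ Fin n)) (adaptedChart t k ψ).symm (K y₀) := by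
    rw [hK0]; exact mdifferentiableAt_symm hΦ hy
  have e1 := pullInner_translate gbar hinv ht a (mdifferentiableAt_symm hΦ hy₀) hs
    (mdifferentiableAt_translate ht a hs) v w
  rw [pullInner_congr gbar hev, pullInner_comp gbar hFK hKm, hKid, hK0] at e1
  exact e1

/-- As the inverse of ψ has derivative the identity at 0, the coordinate vectors along the fiber are
the standard basis of the Lie algebra, that is, a locally flat frame of `e`. -/
theorem baseForm_inl_inl (ht : t ∈ P.atlas)
    (hk : k ∈ IsManifold.maximalAtlas 𝓘(ℝ, EuclideanSpace ℝ (Fin n)) ∞ B)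
    (hψ : IsCanonicalChart ψ) {z : EuclideanSpace ℝ (Fin n)} (hz : z ∈ adaptedDomain t k)
    (I J : Fin N) :
    baseForm gbar t k ψ z (EuclideanSpace.single (Sum.inl I) 1) (EuclideanSpace.single (Sum.inl J) 1)
      = TwistedBundle.localG gbar t (k.symm z) I J := by
  have hΦ := adaptedChart_mem_maximalAtlas ht hk hψ
  let j : EuclideanSpace ℝ (Fin N) → EuclideanSpace ℝ (Fin N ⊕ Fin n) := fun x => joinCoord (x, z)
  have hy₀ : j 0 ∈ (adaptedChart t k ψ).target :=
    mem_adaptedChart_target.2 ⟨hz, hψ.zero_mem_target⟩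
  have hj : HasFDerivAt j (joinCoord.comp (ContinuousLinearMap.inl ℝ _ _)) 0 :=
    joinCoord.hasFDerivAt.comp 0 (hasFDerivAt_prodMk_left 0 z)
  have hjd : ∀ I : Fin N, modelDeriv (EuclideanSpace ℝ (Fin N))
      (EuclideanSpace ℝ (Fin N ⊕ Fin n)) j 0 (EuclideanSpace.single I 1)
      = EuclideanSpace.single (Sum.inl I) 1 := by
    intro I
    rw [modelDeriv, mfderiv_eq_fderiv, hj.fderiv]
    exact joinCoord_single_left I 1
  have e1 := pullInner_comp gbar (F := (adaptedChart t k ψ).symm) (K := j) (s := 0)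
    (mdifferentiableAt_symm hΦ hy₀) hj.differentiableAt.mdifferentiableAt
    (EuclideanSpace.single I 1) (EuclideanSpace.single J 1)
  rw [hjd, hjd] at e1
  have hψm : MDifferentiableAt 𝓘(ℝ, EuclideanSpace ℝ (Fin N)) 𝓘(ℝ, EuclideanSpace ℝ (Fin N))
      ψ.symm 0 := (hψ.smooth_symm.contMDiffAt
        (ψ.open_target.mem_nhds hψ.zero_mem_target)).mdifferentiableAt (by simp)
  have hF : MDifferentiableAt 𝓘(ℝ, EuclideanSpace ℝ (Fin N)) 𝓘(ℝ, EuclideanSpace ℝ (Fin N ⊕ Fin n))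
      (fun x : 𝒢 => t.toOpenPartialHomeomorph.symm (k.symm z, x)) (ψ.symm 0) :=
    (TwistedBundle.contMDiff_fiberIncl ht hz.2).mdifferentiable (by simp) _
  have e2 := pullInner_comp gbar (K := ψ.symm) (s := 0) hF hψm
    (EuclideanSpace.single I 1) (EuclideanSpace.single J 1)
  rw [hψ.deriv_symm, hψ.deriv_symm, hψ.symm_zero] at e2
  exact e1.symm.trans e2

theorem modelDeriv_proj_adaptedChart (ht : t ∈ P.atlas)
    (hk : k ∈ IsManifold.maximalAtlas 𝓘(ℝ, EuclideanSpace ℝ (Fin n)) ∞ B)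
    (hψ : IsCanonicalChart ψ) {y : EuclideanSpace ℝ (Fin N ⊕ Fin n)}
    (hy : y ∈ (adaptedChart t k ψ).target) (v : EuclideanSpace ℝ (Fin N ⊕ Fin n)) :
    P.dproj ((adaptedChart t k ψ).symm y) (modelDeriv (EuclideanSpace ℝ (Fin N ⊕ Fin n))
        (EuclideanSpace ℝ (Fin N ⊕ Fin n)) (adaptedChart t k ψ).symm y v)
      = modelDeriv (EuclideanSpace ℝ (Fin n)) (EuclideanSpace ℝ (Fin n)) k.symm (baseProj y)
        (baseProj v) := by
  have hΦ := adaptedChart_mem_maximalAtlas ht hk hψ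
  have hs : (adaptedChart t k ψ).symm y ∈ t.source := ((adaptedChart t k ψ).map_target hy).1
  have hproj : MDifferentiableAt 𝓘(ℝ, EuclideanSpace ℝ (Fin N ⊕ Fin n))
      𝓘(ℝ, EuclideanSpace ℝ (Fin n)) P.proj ((adaptedChart t k ψ).symm y) := by
    have h1 : ContMDiffAt 𝓘(ℝ, EuclideanSpace ℝ (Fin N ⊕ Fin n))
        (𝓘(ℝ, EuclideanSpace ℝ (Fin n)).prod 𝓘(ℝ, EuclideanSpace ℝ (Fin N))) ∞ t
        ((adaptedChart t k ψ).symm y) :=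
      (P.smooth_toFun t ht).contMDiffAt (t.open_source.mem_nhds hs)
    refine (h1.fst.congr_of_eventuallyEq ?_).mdifferentiableAt (by simp)
    filter_upwards [t.open_source.mem_nhds hs] with m hm using (t.coe_fst hm).symm
  have e1 := modelDeriv_comp hproj (mdifferentiableAt_symm hΦ hy) v
  refine e1.symm.trans ?_
  have hev : P.proj ∘ (adaptedChart t k ψ).symm =ᶠ[𝓝 y] k.symm ∘ baseProj := by
    filter_upwards [(adaptedChart t k ψ).open_target.mem_nhds hy] with y' hy'
    exact proj_adaptedChart_symm hy'
  rw [modelDeriv_congr hev, modelDeriv_comp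
    (mdifferentiableAt_symm hk (mem_adaptedChart_target.1 hy).1.1)
    (ContinuousLinearMap.differentiableAt _).mdifferentiableAt]
  congr 1
  rw [modelDeriv, mfderiv_eq_fderiv, ContinuousLinearMap.fderiv]

end AdaptedChart

/-! ### Linear shears of an adapted bilinear form. -/

section ShearForm

variable {κ ι : Type*} [Fintype κ] [DecidableEq κ] [Fintype ι] [DecidableEq ι]

/-- The images of the coordinate vectors under a linear shear. -/
def shearVector (c : Matrix κ ι ℝ) : κ ⊕ ι → EuclideanSpace ℝ (κ ⊕ ι) :=
  Sum.elim (fun k => EuclideanSpace.single (Sum.inl k) 1)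
    fun a => EuclideanSpace.single (Sum.inr a) 1 - ∑ k, c k a • EuclideanSpace.single (Sum.inl k) 1

/-- Subtracting vertical vectors with coefficients c from the base vectors subtracts c from A. It is
used with c = A to obtain horizontal vectors, and with c = dq for changes of gauge. -/
theorem bilinForm_shearVector (β : LinearMap.BilinForm ℝ (EuclideanSpace ℝ (κ ⊕ ι)))
    {G : Matrix κ κ ℝ} {A : Matrix κ ι ℝ} {g : Matrix ι ι ℝ}
    (h : ∀ i j, β (EuclideanSpace.single i 1) (EuclideanSpace.single j 1) = adaptedMetric G A g i j)
    (c : Matrix κ ι ℝ) (i j : κ ⊕ ι) :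
    β (shearVector c i) (shearVector c j) = adaptedMetric G (A - c) g i j := by
  rcases i with i | i <;> rcases j with j | j
  · exact h _ _
  · simp only [shearVector, Sum.elim_inl, Sum.elim_inr, map_sub, map_sum, map_smul, h, adaptedMetric,
      Matrix.fromBlocks_apply₁₁, Matrix.fromBlocks_apply₁₂, smul_eq_mul, Matrix.mul_sub,
      Matrix.sub_apply]
    congr 1
    rw [Matrix.mul_apply]
    exact Finset.sum_congr rfl fun k _ => mul_comm _ _
  · simp only [shearVector, Sum.elim_inl, Sum.elim_inr, map_sub, map_sum, map_smul, h, adaptedMetric,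
      Matrix.fromBlocks_apply₁₁, Matrix.fromBlocks_apply₂₁, smul_eq_mul, Matrix.transpose_sub,
      Matrix.sub_mul, Matrix.sub_apply, LinearMap.sub_apply, LinearMap.sum_apply,
      LinearMap.smul_apply]
    congr 1
  · have h1 : ∀ i j, ∑ k, c k j * (Aᵀ * G) i k = (Aᵀ * G * c) i j := fun i j => by
      rw [Matrix.mul_apply]
      exact Finset.sum_congr rfl fun k _ => mul_comm _ _
    have h2 : ∀ i j, ∑ k, c k i * (G * A) k j = (cᵀ * G * A) i j := fun i j => by
      rw [Matrix.mul_assoc, Matrix.mul_apply]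
      rfl
    have h3 : ∀ i j, ∑ l, c l j * ∑ k, c k i * G k l = (cᵀ * G * c) i j := fun i j => by
      rw [Matrix.mul_apply]
      exact Finset.sum_congr rfl fun k _ => mul_comm _ _
    simp only [shearVector, Sum.elim_inr, map_sub, map_sum, map_smul, h, adaptedMetric,
      Matrix.fromBlocks_apply₁₁, Matrix.fromBlocks_apply₂₁, Matrix.fromBlocks_apply₁₂,
      Matrix.fromBlocks_apply₂₂, smul_eq_mul, Matrix.transpose_sub, Finset.sum_sub_distrib, mul_sub,
      Matrix.sub_mul, Matrix.mul_sub, Matrix.sub_apply, Matrix.add_apply, LinearMap.sub_apply,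
      LinearMap.sum_apply, LinearMap.smul_apply, h1, h2, h3]
    ring

end ShearForm

/-! ### From the geometric hypotheses to the local Einstein system. -/

section LocalEinstein

variable {n N : ℕ}
variable {𝒢 : Type*} [AddCommGroup 𝒢] [TopologicalSpace 𝒢]
  [ChartedSpace (EuclideanSpace ℝ (Fin N)) 𝒢] [LieAddGroup 𝓘(ℝ, EuclideanSpace ℝ (Fin N)) ∞ 𝒢]
variable {B : Type*} [TopologicalSpace B] [ChartedSpace (EuclideanSpace ℝ (Fin n)) B]
variable {M : Type*} [TopologicalSpace M] [ChartedSpace (EuclideanSpace ℝ (Fin N ⊕ Fin n)) M]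
  [IsManifold 𝓘(ℝ, EuclideanSpace ℝ (Fin n)) ∞ B]
  [IsManifold 𝓘(ℝ, EuclideanSpace ℝ (Fin N ⊕ Fin n)) ∞ M]
variable {P : TwistedBundle n N 𝒢 B M}
variable {t : Bundle.Trivialization 𝒢 P.proj}
  {k : OpenPartialHomeomorph B (EuclideanSpace ℝ (Fin n))}
  {ψ : OpenPartialHomeomorph 𝒢 (EuclideanSpace ℝ (Fin N))}
variable {gbar : RiemannianMetric (Fin N ⊕ Fin n) M} {g : RiemannianMetric (Fin n) B}

/-- The mixed components of the metric in an adapted chart. -/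
def mixedMatrix (gbar : RiemannianMetric (Fin N ⊕ Fin n) M) (t : Bundle.Trivialization 𝒢 P.proj)
    (k : OpenPartialHomeomorph B (EuclideanSpace ℝ (Fin n)))
    (ψ : OpenPartialHomeomorph 𝒢 (EuclideanSpace ℝ (Fin N))) (z : EuclideanSpace ℝ (Fin n)) :
    Matrix (Fin N) (Fin n) ℝ :=
  Matrix.of fun I a => baseForm gbar t k ψ z (EuclideanSpace.single (Sum.inl I) 1)
    (EuclideanSpace.single (Sum.inr a) 1)

/-- The connection form in an adapted chart. -/
def connMatrix (gbar : RiemannianMetric (Fin N ⊕ Fin n) M) (t : Bundle.Trivialization 𝒢 P.proj)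
    (k : OpenPartialHomeomorph B (EuclideanSpace ℝ (Fin n)))
    (ψ : OpenPartialHomeomorph 𝒢 (EuclideanSpace ℝ (Fin N))) (z : EuclideanSpace ℝ (Fin n)) :
    Matrix (Fin N) (Fin n) ℝ :=
  (TwistedBundle.localG gbar t (k.symm z))⁻¹ * mixedMatrix gbar t k ψ z

variable (ht : t ∈ P.atlas) (hk : k ∈ IsManifold.maximalAtlas 𝓘(ℝ, EuclideanSpace ℝ (Fin n)) ∞ B)
  (hψ : IsCanonicalChart ψ)
include ht hk hψ

theorem joinCoord_mem_target {z : EuclideanSpace ℝ (Fin n)} (hz : z ∈ adaptedDomain t k) :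
    joinCoord (0, z) ∈ (adaptedChart t k ψ).target :=
  mem_adaptedChart_target.2 ⟨hz, hψ.zero_mem_target⟩

theorem localG_posDef {z : EuclideanSpace ℝ (Fin n)} (hz : z ∈ adaptedDomain t k) :
    (TwistedBundle.localG gbar t (k.symm z)).PosDef := by
  have h := (metricMatrix_posDef gbar (adaptedChart_mem_maximalAtlas ht hk hψ)
    (joinCoord_mem_target ht hk hψ hz)).submatrix (e := Sum.inl) Sum.inl_injective
  convert h using 1
  ext I J
  exact (baseForm_inl_inl gbar ht hk hψ hz I J).symm

/-- Completing the square in the fiber directions. The remainder is the metric evaluated on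
horizontal lifts of the base coordinate vectors, which `IsBaseMetric` identifies with `g`. -/
theorem baseForm_eq_adaptedMetric (hbase : P.IsBaseMetric gbar g)
    {z : EuclideanSpace ℝ (Fin n)} (hz : z ∈ adaptedDomain t k) (i j : Fin N ⊕ Fin n) :
    baseForm gbar t k ψ z (EuclideanSpace.single i 1) (EuclideanSpace.single j 1)
      = adaptedMetric (TwistedBundle.localG gbar t (k.symm z)) (connMatrix gbar t k ψ z)
        (metricMatrix g k z) i j := by
  set G := TwistedBundle.localG gbar t (k.symm z) with hG
  set A := connMatrix gbar t k ψ z with hA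
  set β := baseForm gbar t k ψ z with hβ
  have hy := joinCoord_mem_target ht hk hψ hz
  have hΦ := adaptedChart_mem_maximalAtlas ht hk hψ
  have hGpos : G.PosDef := localG_posDef ht hk hψ hz
  have hGA : G * A = mixedMatrix gbar t k ψ z := by
    rw [hA, connMatrix, ← Matrix.mul_assoc, Matrix.mul_nonsing_inv _ hGpos.det_pos.ne'.isUnit,
      Matrix.one_mul]
  have hsymm : ∀ v w, β v w = β w v := fun v w => pullInner_symm gbar _ _ v w
  have hGsymm : Gᵀ = G := by simpa using hGpos.1.eq
  -- The candidate base metric is defined as the remainder after completing the square, so `h1`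
  -- holds by construction; what has to be shown is `hgg`.
  set g' : Matrix (Fin n) (Fin n) ℝ := Matrix.of (fun a b => β (EuclideanSpace.single (Sum.inr a) 1)
    (EuclideanSpace.single (Sum.inr b) 1)) - Aᵀ * G * A with hg'
  have h1 : ∀ i j, β (EuclideanSpace.single i 1) (EuclideanSpace.single j 1)
      = adaptedMetric G A g' i j := by
    rintro (i | i) (j | j)
    · exact baseForm_inl_inl gbar ht hk hψ hz i j
    · exact (congrFun (congrFun hGA i) j).symm
    · rw [hsymm]
      have := congrFun (congrFun hGA j) i
      rw [← Matrix.transpose_apply (G * A), Matrix.transpose_mul, hGsymm] at this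
      exact this.symm
    · simp [adaptedMetric, hg']
  -- With c = A the off-diagonal blocks vanish: the sheared base vectors are orthogonal to the
  -- fiber.
  have h2 := bilinForm_shearVector β h1 A
  rw [sub_self] at h2
  -- The kernel of the projection is spanned by the fiber coordinate vectors, so orthogonality to
  -- those is horizontality in the sense of `IsBaseMetric`.
  have hker : ∀ u, P.dproj ((adaptedChart t k ψ).symm (joinCoord (0, z))) u = 0 →
      ∃ c : Fin N → ℝ, u = modelDeriv (EuclideanSpace ℝ (Fin N ⊕ Fin n))
        (EuclideanSpace ℝ (Fin N ⊕ Fin n)) (adaptedChart t k ψ).symm (joinCoord (0, z))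
        (∑ I, c I • EuclideanSpace.single (Sum.inl I) 1) := by
    intro u hu
    set w : EuclideanSpace ℝ (Fin N ⊕ Fin n) := mfderiv 𝓘(ℝ, EuclideanSpace ℝ (Fin N ⊕ Fin n))
      𝓘(ℝ, EuclideanSpace ℝ (Fin N ⊕ Fin n)) (adaptedChart t k ψ) _ u
    have hw : u = modelDeriv (EuclideanSpace ℝ (Fin N ⊕ Fin n))
        (EuclideanSpace ℝ (Fin N ⊕ Fin n)) (adaptedChart t k ψ).symm (joinCoord (0, z)) w :=
      (mfderiv_symm_mfderiv_chart hΦ hy u).symm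
    have h3 := modelDeriv_proj_adaptedChart ht hk hψ hy w
    rw [← hw] at h3
    have h4 := mfderiv_chart_mfderiv_symm hk hz.1 (baseProj w)
    have h5 : modelDeriv (EuclideanSpace ℝ (Fin n)) (EuclideanSpace ℝ (Fin n)) k.symm z (baseProj w)
        = 0 := h3.symm.trans hu
    have h6 : baseProj w = 0 := by
      refine h4.symm.trans ?_
      exact (congrArg (mfderiv 𝓘(ℝ, EuclideanSpace ℝ (Fin n)) 𝓘(ℝ, EuclideanSpace ℝ (Fin n)) k
        (k.symm z)) h5).trans (map_zero _)
    refine ⟨fun I => fiberProj w I, ?_⟩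
    rw [← joinCoord_left_eq_sum, ← h6, joinCoord_proj]
    exact hw
  have hhor : ∀ a u, P.dproj ((adaptedChart t k ψ).symm (joinCoord (0, z))) u = 0 →
      gbar.inner ((adaptedChart t k ψ).symm (joinCoord (0, z)))
        (modelDeriv (EuclideanSpace ℝ (Fin N ⊕ Fin n)) (EuclideanSpace ℝ (Fin N ⊕ Fin n))
          (adaptedChart t k ψ).symm (joinCoord (0, z)) (shearVector A (Sum.inr a))) u = 0 := by
    intro a u hu
    obtain ⟨c, rfl⟩ := hker u hu
    change β (shearVector A (Sum.inr a)) _ = 0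
    rw [map_sum]
    refine Finset.sum_eq_zero fun I _ => ?_
    rw [map_smul]
    have := h2 (Sum.inr a) (Sum.inl I)
    simp only [adaptedMetric, Matrix.fromBlocks_apply₂₁, Matrix.transpose_zero, Matrix.zero_mul,
      Matrix.zero_apply] at this
    exact (congrArg _ this).trans (smul_zero _)
  have hbp : ∀ a, baseProj (shearVector A (Sum.inr a)) = EuclideanSpace.single a (1 : ℝ) := by
    intro a
    simp [shearVector]
  have hgg : g' = metricMatrix g k z := by
    ext a b
    have h3 := h2 (Sum.inr a) (Sum.inr b)
    simp only [adaptedMetric, Matrix.fromBlocks_apply₂₂, Matrix.transpose_zero, Matrix.zero_mul,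
      add_zero] at h3
    rw [← h3]
    refine (hbase _ _ _ (hhor a) (hhor b)).trans ?_
    have h4 : ∀ a, P.dproj ((adaptedChart t k ψ).symm (joinCoord (0, z)))
        (modelDeriv (EuclideanSpace ℝ (Fin N ⊕ Fin n)) (EuclideanSpace ℝ (Fin N ⊕ Fin n))
          (adaptedChart t k ψ).symm (joinCoord (0, z)) (shearVector A (Sum.inr a)))
        = modelDeriv (EuclideanSpace ℝ (Fin n)) (EuclideanSpace ℝ (Fin n)) k.symm z
          (EuclideanSpace.single a 1) := fun a => by
      rw [modelDeriv_proj_adaptedChart ht hk hψ hy, hbp]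
      rfl
    rw [h4, h4]
    change modelInner g _ _ _ = modelInner g _ _ _
    rw [proj_adaptedChart_symm hy]
    rfl
  rw [h1, hgg]

theorem contDiffOn_baseForm (i j : Fin N ⊕ Fin n) :
    ContDiffOn ℝ ∞ (fun z => baseForm gbar t k ψ z (EuclideanSpace.single i 1)
      (EuclideanSpace.single j 1)) (adaptedDomain t k) := by
  have h := contDiffOn_metricMatrix gbar (adaptedChart_mem_maximalAtlas ht hk hψ) i j
  have h2 : ContDiffOn ℝ ∞ (fun z : EuclideanSpace ℝ (Fin n) =>
      joinCoord ((0 : EuclideanSpace ℝ (Fin N)), z)) (adaptedDomain t k) :=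
    ((ContinuousLinearMap.contDiff (n := ∞) (joinCoord (κ := Fin N) (ι := Fin n))).comp
      (contDiff_prodMk_right 0)).contDiffOn
  exact h.comp h2 fun z hz => joinCoord_mem_target ht hk hψ hz

theorem contDiffOn_localG (I J : Fin N) :
    ContDiffOn ℝ ∞ (fun z => TwistedBundle.localG gbar t (k.symm z) I J) (adaptedDomain t k) :=
  (contDiffOn_baseForm ht hk hψ (Sum.inl I) (Sum.inl J)).congr fun _ hz =>
    (baseForm_inl_inl gbar ht hk hψ hz I J).symm

theorem adaptedOn_connMatrix :
    AdaptedOn (fun z => TwistedBundle.localG gbar t (k.symm z)) (connMatrix gbar t k ψ)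
      (metricMatrix g k) (adaptedDomain t k) where
  base :=
    { isOpen := isOpen_adaptedDomain
      contDiffOn := fun i j => (contDiffOn_metricMatrix g hk i j).mono Set.inter_subset_left
      symm := fun z _ => metricMatrix_symm g k z
      det_ne_zero := fun _ hz => (metricMatrix_posDef g hk hz.1).det_pos.ne' }
  smooth_fiber := contDiffOn_localG ht hk hψ
  smooth_conn := contDiffOn_matrix_mul
    (contDiffOn_matrix_inv (contDiffOn_localG ht hk hψ) fun _ hz =>
      (localG_posDef ht hk hψ hz).det_pos.ne')
    fun I a => contDiffOn_baseForm ht hk hψ (Sum.inl I) (Sum.inr a)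
  posDef _ hz := localG_posDef ht hk hψ hz

/-- The coefficients of an invariant Einstein metric on a twisted principal bundle. -/
theorem localEinstein_connMatrix {lam : ℝ} (hinv : P.IsInvariant gbar)
    (hbase : P.IsBaseMetric gbar g) (hE : IsEinstein gbar lam) :
    LocalEinstein (fun z => TwistedBundle.localG gbar t (k.symm z)) (connMatrix gbar t k ψ)
      (metricMatrix g k) (adaptedDomain t k) lam where
  toAdaptedOn := adaptedOn_connMatrix ht hk hψ
  base_posDef _ hz := metricMatrix_posDef g hk hz.1
  einstein V' hV'V hV' q hq z hz hqz := by
    have hΦ := adaptedChart_mem_maximalAtlas ht hk hψ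
    set σ := shearChart hV' hq with hσ
    -- The sheared chart again belongs to the maximal atlas, so the Einstein equation may be read in
    -- it; this is the gauge change by q.
    set Φ := (adaptedChart t k ψ).trans σ with hΦdef
    have hσ1 := contDiffOn_shear (κ := Fin N) hq
    have hσ2 : ContDiffOn ℝ ∞ (shear (κ := Fin N) (-q)) (baseProj ⁻¹' V') :=
      contDiffOn_shear fun k => (hq k).neg
    have hmem : Φ ∈ IsManifold.maximalAtlas 𝓘(ℝ, EuclideanSpace ℝ (Fin N ⊕ Fin n)) ∞ M := by
      refine OpenPartialHomeomorph.mem_maximalAtlas_of_contMDiffOn _ ?_ ?_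
      · exact hσ1.contMDiffOn.comp ((contMDiffOn_of_mem_maximalAtlas hΦ).mono fun m hm => hm.1)
          fun m hm => hm.2
      · exact (contMDiffOn_symm_of_mem_maximalAtlas hΦ).comp
          (hσ2.contMDiffOn.mono fun y hy => hy.1) fun y hy => hy.2
    have htarget : ∀ y ∈ Φ.target, baseProj y ∈ V' ∧ shear (-q) y ∈ (adaptedChart t k ψ).target :=
      fun y hy => hy
    have hmatrix : ∀ y ∈ Φ.target, metricMatrix gbar Φ y
        = adaptedMetric (TwistedBundle.localG gbar t (k.symm (baseProj y)))
          (connMatrix gbar t k ψ (baseProj y)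
            - Matrix.of fun k a => partialDeriv a (q k) (baseProj y))
          (metricMatrix g k (baseProj y)) := by
      intro y hy
      obtain ⟨hy1, hy2⟩ := htarget y hy
      have hd : DifferentiableAt ℝ (shear (-q)) y :=
        (hσ2.contDiffAt ((hV'.preimage baseProj.continuous).mem_nhds hy1)).differentiableAt (by simp)
      -- The metric is pulled back by the inverse shear, whose derivative subtracts dq from the base
      -- vectors; hence c = dq.
      have hvec : ∀ i, modelDeriv (EuclideanSpace ℝ (Fin N ⊕ Fin n))
          (EuclideanSpace ℝ (Fin N ⊕ Fin n)) (shear (-q)) y (EuclideanSpace.single i 1)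
          = shearVector (Matrix.of fun k a => partialDeriv a (q k) (baseProj y)) i := by
        intro i
        rw [modelDeriv, mfderiv_eq_fderiv]
        refine (fderiv_shear hV' (q := -q) (fun k => (hq k).neg) hy1 _).trans ?_
        rcases i with i | i
        · have : (WithLp.toLp 2 fun k => fderiv ℝ ((-q) k) (baseProj y)
              (baseProj (EuclideanSpace.single (Sum.inl i : Fin N ⊕ Fin n) (1 : ℝ))) :
              EuclideanSpace ℝ (Fin N)) = 0 := by
            ext k
            simp
          rw [this]
          exact (congrArg _ (map_zero joinCoord)).trans (add_zero _)
        · rw [joinCoord_left_eq_sum, baseProj_single_inr]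
          simp only [shearVector, Sum.elim_inr, sub_eq_add_neg, ← Finset.sum_neg_distrib]
          congr 1
          refine Finset.sum_congr rfl fun k _ => ?_
          rw [← neg_smul]
          congr 1
          have h : (-q) k = fun w => -(q k w) := rfl
          change fderiv ℝ ((-q) k) (baseProj y) _ = _
          rw [h, fderiv_fun_neg]
          rfl
      ext i j
      rw [← bilinForm_shearVector (baseForm gbar t k ψ (baseProj y))
        (baseForm_eq_adaptedMetric ht hk hψ hbase (hV'V hy1)), metricMatrix_eq_pullInner]
      refine (pullInner_comp gbar (mdifferentiableAt_symm hΦ hy2) hd.mdifferentiableAt _ _).trans ?_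
      rw [hvec, hvec]
      refine (pullInner_adaptedChart gbar hinv ht hk hψ hy2 _ _).trans ?_
      rw [baseProj_shear]
    -- The fiber coordinates range only over a neighborhood of 0. Since q vanishes at z, the shear
    -- fixes this point of the zero section, which therefore stays in the chart.
    have hy : joinCoord (0, z) ∈ Φ.target := by
      refine ⟨hz, ?_⟩
      have h : shear (-q) (joinCoord ((0 : EuclideanSpace ℝ (Fin N)), z)) = joinCoord (0, z) := by
        have : (WithLp.toLp 2 fun k => (-q) k z : EuclideanSpace ℝ (Fin N)) = 0 := by
          ext k
          simp [hqz]
        rw [shear, baseProj_joinCoord, this]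
        exact (congrArg _ (map_zero joinCoord)).trans (add_zero _)
      change shear (-q) (joinCoord (0, z)) ∈ (adaptedChart t k ψ).target
      rw [h]
      exact joinCoord_mem_target ht hk hψ (hV'V hz)
    refine ⟨joinCoord (0, z), rfl, fun i j => ?_⟩
    have h := hE Φ hmem _ hy i j
    rw [hmatrix _ hy] at h
    rw [← ricci_congr (g := metricMatrix gbar Φ)]
    · exact h
    · filter_upwards [Φ.open_target.mem_nhds hy] with y' hy' using hmatrix y' hy'

end LocalEinstein

/-! ### The inner product on the flat bundle and its matrix in parallel frames. -/

section FlatBundle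

variable {n N : ℕ}
variable {𝒢 : Type*} [AddCommGroup 𝒢] [TopologicalSpace 𝒢]
  [ChartedSpace (EuclideanSpace ℝ (Fin N)) 𝒢] [LieAddGroup 𝓘(ℝ, EuclideanSpace ℝ (Fin N)) ∞ 𝒢]
variable {B : Type*} [TopologicalSpace B] [ChartedSpace (EuclideanSpace ℝ (Fin n)) B]
variable {M : Type*} [TopologicalSpace M] [ChartedSpace (EuclideanSpace ℝ (Fin N ⊕ Fin n)) M]
  [IsManifold 𝓘(ℝ, EuclideanSpace ℝ (Fin n)) ∞ B]
  [IsManifold 𝓘(ℝ, EuclideanSpace ℝ (Fin N ⊕ Fin n)) ∞ M]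
variable {P : TwistedBundle n N 𝒢 B M}
variable {t t' : Bundle.Trivialization 𝒢 P.proj}
variable {gbar : RiemannianMetric (Fin N ⊕ Fin n) M}

/-- The inner product on the flat bundle does not depend on the trivialization. -/
theorem fiberInner_coordChange (hinv : P.IsInvariant gbar) (ht : t ∈ P.atlas) (ht' : t' ∈ P.atlas)
    {b : B} (hb : b ∈ t.baseSet) (hb' : b ∈ t'.baseSet) (ξ η : TwistedBundle.LieAlg N 𝒢) :
    TwistedBundle.fiberInner gbar t' b (TwistedBundle.coordChange t t' b ξ)
        (TwistedBundle.coordChange t t' b η)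
      = TwistedBundle.fiberInner gbar t b ξ η := by
  obtain ⟨φ, hφ⟩ := P.transition t ht t' ht' b ⟨hb, hb'⟩
  obtain ⟨s, hs⟩ := hφ.self_of_nhds
  set F : 𝒢 → M := fun x => t'.toOpenPartialHomeomorph.symm (b, x) with hF
  have hFd : MDifferentiable 𝓘(ℝ, EuclideanSpace ℝ (Fin N)) 𝓘(ℝ, EuclideanSpace ℝ (Fin N ⊕ Fin n))
      F := (TwistedBundle.contMDiff_fiberIncl ht' hb').mdifferentiable (by simp)
  have hFs : ∀ x, F x ∈ t'.source := fun x =>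
    t'.toOpenPartialHomeomorph.map_target (TwistedBundle.mem_target hb' x)
  have hφd : MDifferentiable 𝓘(ℝ, EuclideanSpace ℝ (Fin N)) 𝓘(ℝ, EuclideanSpace ℝ (Fin N)) φ := by
    have h := (TwistedBundle.contMDiff_fiberTransition ht ht' hb hb').sub
      (contMDiff_const (c := s) (I := 𝓘(ℝ, EuclideanSpace ℝ (Fin N))))
    have e : (fun x : 𝒢 => (t' (t.toOpenPartialHomeomorph.symm (b, x))).2 - s) = φ := by
      funext x; simp [hs]
    rw [e] at h
    exact h.mdifferentiable (by simp)
  -- The two inclusions of the fiber differ by the automorphism φ and the translation by s. The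
  -- translation is isometric, so only the differential of φ remains, and that is the coordinate
  -- change of `e`.
  have hcomp : (fun x : 𝒢 => t.toOpenPartialHomeomorph.symm (b, x))
      = (TwistedBundle.translate t' s ∘ F) ∘ φ := by
    funext x
    have h1 : t.toOpenPartialHomeomorph.symm (b, x) ∈ t'.source := by
      rw [t'.mem_source, t.proj_symm_apply (TwistedBundle.mem_target hb x)]
      exact hb'
    have h2 := t'.toOpenPartialHomeomorph.left_inv h1
    have h3 : t'.toOpenPartialHomeomorph (t.toOpenPartialHomeomorph.symm (b, x)) = (b, s + φ x) :=
      hs x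
    rw [h3] at h2
    simp only [Function.comp_apply, TwistedBundle.translate, hF]
    rw [t'.apply_symm_apply (TwistedBundle.mem_target hb' _), add_comm, h2]
  have hT := mdifferentiableAt_translate ht' s (hFs (φ 0))
  have key : ∀ v w : EuclideanSpace ℝ (Fin N),
      pullInner gbar F 0 (modelDeriv (EuclideanSpace ℝ (Fin N)) (EuclideanSpace ℝ (Fin N)) φ 0 v) (modelDeriv (EuclideanSpace ℝ (Fin N)) (EuclideanSpace ℝ (Fin N)) φ 0 w)
        = pullInner gbar (fun x : 𝒢 => t.toOpenPartialHomeomorph.symm (b, x)) 0 v w := by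
    intro v w
    rw [hcomp, pullInner_comp gbar (hT.comp (φ 0) (hFd _)) (hφd 0),
      pullInner_translate gbar hinv ht' s (hFd _) (hFs _) hT, map_zero]
  rw [TwistedBundle.coordChange_eq hs]
  exact key ξ η

namespace TwistedBundle.ParallelFrame

variable {Y : Type*} [TopologicalSpace Y] {p : Y → B} (τ : P.ParallelFrame p)

/-- The matrix of a parallel frame in a trivialization. -/
def frameMatrix (t : Bundle.Trivialization 𝒢 P.proj) (y : Y) : Matrix (Fin N) (Fin N) ℝ :=
  Matrix.of fun i I => WithLp.ofLp (p := 2) (V := Fin N → ℝ) (τ.frame t y I) i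

theorem eventually_frameMatrix_eq (ht : t ∈ P.atlas) {y : Y} (hy : p y ∈ t.baseSet) :
    ∀ᶠ y' in 𝓝 y, τ.frameMatrix t y' = τ.frameMatrix t y := by
  filter_upwards [τ.locallyConstant t ht y hy] with y' h
  simp only [frameMatrix, h]

theorem gram_eq (hinv : P.IsInvariant gbar) (ht : t ∈ P.atlas) {y : Y} (hy : p y ∈ t.baseSet) :
    τ.gram gbar y
      = (τ.frameMatrix t y)ᵀ * TwistedBundle.localG gbar t (p y) * τ.frameMatrix t y := by
  have h1 : ∀ I, (τ.frame t y I : TwistedBundle.LieAlg N 𝒢)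
      = ∑ i, τ.frameMatrix t y i I • (EuclideanSpace.single i (1 : ℝ) : EuclideanSpace ℝ (Fin N)) := by
    intro I
    exact euclidean_eq_sum (ι := Fin N) _
  ext I J
  have h2 : τ.gram gbar y I J
      = TwistedBundle.fiberInner gbar t (p y) (τ.frame t y I) (τ.frame t y J) := by
    have hc := τ.compatible _ (P.trivAt_mem (p y)) t ht y ⟨P.mem_baseSet_trivAt (p y), hy⟩
    rw [hc, hc, fiberInner_coordChange hinv (P.trivAt_mem (p y)) ht (P.mem_baseSet_trivAt (p y)) hy]
    rfl
  rw [h2, h1 I, h1 J]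
  refine (TwistedBundle.fiberInner_comb gbar t (p y) _ _ _ _).trans ?_
  simp only [Matrix.mul_apply, Matrix.transpose_apply, Finset.sum_mul]
  rw [Finset.sum_comm]
  exact Finset.sum_congr rfl fun i _ => Finset.sum_congr rfl fun j _ => by
    simp only [TwistedBundle.localG, Matrix.of_apply]
    ring

theorem det_gram_eq (hinv : P.IsInvariant gbar) (ht : t ∈ P.atlas) {y : Y} (hy : p y ∈ t.baseSet) :
    (τ.gram gbar y).det
      = (τ.frameMatrix t y).det ^ 2 * (TwistedBundle.localG gbar t (p y)).det := by
  rw [τ.gram_eq hinv ht hy, Matrix.det_mul, Matrix.det_mul, Matrix.det_transpose]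
  ring

theorem det_frameMatrix_ne_zero (hinv : P.IsInvariant gbar) (ht : t ∈ P.atlas) {y : Y}
    (hy : p y ∈ t.baseSet) : (τ.frameMatrix t y).det ≠ 0 := by
  intro h
  have h1 := (τ.gram_posDef gbar y).det_pos
  rw [τ.det_gram_eq hinv ht hy, h] at h1
  simp at h1

/-- Congruence by the holonomy multiplies the determinant by the square of ±1, so det G descends to
the base. -/
theorem det_gram_congr [NeZero N] (hhol : τ.HasUnimodularHolonomy) {y y' : Y} (h : p y = p y') :
    (τ.gram gbar y').det = (τ.gram gbar y).det := by
  rw [τ.gram_equivariant gbar h, Matrix.det_mul, Matrix.det_mul, Matrix.det_transpose]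
  rcases hhol y y' h with h | h <;> rw [h] <;> ring

end TwistedBundle.ParallelFrame

end FlatBundle

/-! ### Elementary properties of the Laplacian. -/

section Laplacian

variable {ι : Type*} [Fintype ι] [DecidableEq ι]
variable {g : EuclideanSpace ℝ ι → Matrix ι ι ℝ} {f f' : EuclideanSpace ℝ ι → ℝ}
  {y : EuclideanSpace ℝ ι}

theorem coordLaplacian_congr (h : f =ᶠ[𝓝 y] f') :
    coordLaplacian g f y = coordLaplacian g f' y := by
  simp only [coordLaplacian, partialDeriv_congr h]
  simp only [partialDeriv_congr (eventuallyEq_partialDeriv h _)]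

theorem coordLaplacian_const (c : ℝ) : coordLaplacian g (fun _ => c) y = 0 := by
  have h : ∀ j, partialDeriv (ι := ι) j (fun _ => c) = fun _ => 0 :=
    fun j => funext fun z => partialDeriv_const c j
  simp [coordLaplacian, h]

theorem coordLaplacian_const_mul {V : Set (EuclideanSpace ℝ ι)} (hV : IsOpen V)
    (hf : ContDiffOn ℝ ∞ f V) (hy : y ∈ V) (c : ℝ) :
    coordLaplacian g (fun z => c * f z) y = c * coordLaplacian g f y := by
  have h1 : ∀ j, partialDeriv j (fun z => c * f z) =ᶠ[𝓝 y] fun z => c * partialDeriv j f z := by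
    intro j
    filter_upwards [hV.mem_nhds hy] with z hz
    exact partialDeriv_const_mul c (differentiableAt_of_contDiffOn hV hf hz) j
  have h2 : ∀ i j, partialDeriv i (partialDeriv j (fun z => c * f z)) y
      = c * partialDeriv i (partialDeriv j f) y := fun i j => by
    rw [partialDeriv_congr (h1 j)]
    exact partialDeriv_const_mul c
      (differentiableAt_of_contDiffOn hV (contDiffOn_partialDeriv hV hf j) hy) i
  have h3 : ∀ k, partialDeriv k (fun z => c * f z) y = c * partialDeriv k f y :=
    fun k => (h1 k).self_of_nhds
  simp only [coordLaplacian, h2, h3, Finset.mul_sum]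
  refine Finset.sum_congr rfl fun i _ => Finset.sum_congr rfl fun j _ => ?_
  have h4 : ∀ k, christoffel g k i j y * (c * partialDeriv k f y)
      = c * (christoffel g k i j y * partialDeriv k f y) := fun k => by ring
  simp only [h4, ← Finset.mul_sum]
  ring

variable {X : Type*} [TopologicalSpace X] [ChartedSpace (EuclideanSpace ℝ ι) X]
  [IsManifold 𝓘(ℝ, EuclideanSpace ℝ ι) ∞ X]

theorem contMDiffAt_of_contDiffAt_symm {k : OpenPartialHomeomorph X (EuclideanSpace ℝ ι)}
    (hk : k ∈ IsManifold.maximalAtlas 𝓘(ℝ, EuclideanSpace ℝ ι) ∞ X) {x : X} (hx : x ∈ k.source)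
    {f : X → ℝ} (hf : ContDiffAt ℝ ∞ (f ∘ k.symm) (k x)) :
    ContMDiffAt 𝓘(ℝ, EuclideanSpace ℝ ι) 𝓘(ℝ, ℝ) ∞ f x := by
  refine (hf.contMDiffAt.comp x (contMDiffAt_of_mem_maximalAtlas hk hx)).congr_of_eventuallyEq ?_
  filter_upwards [k.open_source.mem_nhds hx] with x' hx'
  simp [k.left_inv hx']

end Laplacian

/-! ### The volume density of the fibers as a function on the base. -/

section VolumeDensity

variable {n N : ℕ} [NeZero N]
variable {𝒢 : Type*} [AddCommGroup 𝒢] [TopologicalSpace 𝒢]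
  [ChartedSpace (EuclideanSpace ℝ (Fin N)) 𝒢] [LieAddGroup 𝓘(ℝ, EuclideanSpace ℝ (Fin N)) ∞ 𝒢]
variable {B : Type*} [TopologicalSpace B] [ChartedSpace (EuclideanSpace ℝ (Fin n)) B]
variable {M : Type*} [TopologicalSpace M] [ChartedSpace (EuclideanSpace ℝ (Fin N ⊕ Fin n)) M]
  [IsManifold 𝓘(ℝ, EuclideanSpace ℝ (Fin n)) ∞ B]
  [IsManifold 𝓘(ℝ, EuclideanSpace ℝ (Fin N ⊕ Fin n)) ∞ M]
variable {P : TwistedBundle n N 𝒢 B M} {t : Bundle.Trivialization 𝒢 P.proj}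
  {k : OpenPartialHomeomorph B (EuclideanSpace ℝ (Fin n))}
variable {gbar : RiemannianMetric (Fin N ⊕ Fin n) M} {g : RiemannianMetric (Fin n) B}
variable {Y : Type*} [TopologicalSpace Y] {p : Y → B} {τ : P.ParallelFrame p}

/-- The volume density `√(det G)` of the fibers, as a function on the base. -/
def volumeDensity (gbar : RiemannianMetric (Fin N ⊕ Fin n) M) (τ : P.ParallelFrame p)
    (hsurj : Function.Surjective p) (b : B) : ℝ :=
  √(τ.gram gbar (Function.surjInv hsurj b)).det

variable (hsurj : Function.Surjective p) (hhol : τ.HasUnimodularHolonomy)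
include hhol

theorem volumeDensity_proj (y : Y) :
    volumeDensity gbar τ hsurj (p y) = √(τ.gram gbar y).det := by
  rw [volumeDensity, τ.det_gram_congr hhol (Function.surjInv_eq hsurj (p y)).symm]

variable (hp : IsLocalHomeomorph p) (hinv : P.IsInvariant gbar) (ht : t ∈ P.atlas)
include hp hinv ht

/-- A parallel frame has a locally constant matrix in a trivialization, so the global density is
locally a positive constant times the √det G of that trivialization. Such a factor affects neither
the sign of the Laplacian nor local constancy. -/
theorem exists_volumeDensity_eq {b : B} (hb : b ∈ t.baseSet) :
    ∃ c : ℝ, 0 < c ∧ ∀ᶠ b' in 𝓝 b, volumeDensity gbar τ hsurj b'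
      = c * √(TwistedBundle.localG gbar t b').det := by
  obtain ⟨y, rfl⟩ := hsurj b
  refine ⟨|(τ.frameMatrix t y).det|, abs_pos.2 (τ.det_frameMatrix_ne_zero hinv ht hb), ?_⟩
  rw [← hp.map_nhds_eq y, Filter.eventually_map]
  filter_upwards [τ.eventually_frameMatrix_eq ht hb,
    hp.continuous.continuousAt.eventually (t.open_baseSet.mem_nhds hb)] with y' h1 h2
  rw [volumeDensity_proj hsurj hhol, τ.det_gram_eq hinv ht h2, h1, Real.sqrt_mul (sq_nonneg _),
    Real.sqrt_sq_eq_abs]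

theorem exists_volumeDensity_chart_eq {z : EuclideanSpace ℝ (Fin n)}
    (hz : z ∈ adaptedDomain t k) :
    ∃ c : ℝ, 0 < c ∧ volumeDensity gbar τ hsurj ∘ k.symm
      =ᶠ[𝓝 z] fun w => c * √(TwistedBundle.localG gbar t (k.symm w)).det := by
  obtain ⟨c, hc, h⟩ := exists_volumeDensity_eq (gbar := gbar) hsurj hhol hp hinv ht hz.2
  exact ⟨c, hc, (k.continuousAt_symm hz.1).eventually h⟩

end VolumeDensity

/-! ### Constancy of the volume density and its consequences. -/

section Surface

variable {N : ℕ} [NeZero N]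
variable {𝒢 : Type*} [AddCommGroup 𝒢] [TopologicalSpace 𝒢]
  [ChartedSpace (EuclideanSpace ℝ (Fin N)) 𝒢] [LieAddGroup 𝓘(ℝ, EuclideanSpace ℝ (Fin N)) ∞ 𝒢]
variable {B : Type*} [TopologicalSpace B] [ChartedSpace (EuclideanSpace ℝ (Fin 2)) B]
variable {M : Type*} [TopologicalSpace M] [ChartedSpace (EuclideanSpace ℝ (Fin N ⊕ Fin 2)) M]
  [IsManifold 𝓘(ℝ, EuclideanSpace ℝ (Fin 2)) ∞ B]
  [IsManifold 𝓘(ℝ, EuclideanSpace ℝ (Fin N ⊕ Fin 2)) ∞ M]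
variable {P : TwistedBundle 2 N 𝒢 B M}
variable {gbar : RiemannianMetric (Fin N ⊕ Fin 2) M} {g : RiemannianMetric (Fin 2) B}
variable {Y : Type*} [TopologicalSpace Y] {p : Y → B} {τ : P.ParallelFrame p} {lam : ℝ}
variable (hsurj : Function.Surjective p) (hhol : τ.HasUnimodularHolonomy)
  (hp : IsLocalHomeomorph p) (hinv : P.IsInvariant gbar) (hbase : P.IsBaseMetric gbar g)
  (hE : IsEinstein gbar lam) (hlam : lam ≤ 0)

theorem mem_adaptedDomain {n : ℕ} {B : Type*} [TopologicalSpace B]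
    [ChartedSpace (EuclideanSpace ℝ (Fin n)) B]
    {M : Type*} [TopologicalSpace M] [ChartedSpace (EuclideanSpace ℝ (Fin N ⊕ Fin n)) M]
    {P : TwistedBundle n N 𝒢 B M} {t : Bundle.Trivialization 𝒢 P.proj}
    {k : OpenPartialHomeomorph B (EuclideanSpace ℝ (Fin n))} {b : B} (hb : b ∈ t.baseSet)
    (hk : b ∈ k.source) : k b ∈ adaptedDomain t k :=
  ⟨k.map_source hk, by rw [Set.mem_preimage, k.left_inv hk]; exact hb⟩

include hhol hp hinv in
theorem contMDiff_volumeDensity :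
    ContMDiff 𝓘(ℝ, EuclideanSpace ℝ (Fin 2)) 𝓘(ℝ, ℝ) ∞ (volumeDensity gbar τ hsurj) := by
  intro b
  obtain ⟨ψ, hψ⟩ := exists_isCanonicalChart (N := N) (𝒢 := 𝒢)
  have hk := IsManifold.chart_mem_maximalAtlas (I := 𝓘(ℝ, EuclideanSpace ℝ (Fin 2))) (n := ∞) b
  have hbk := mem_chart_source (EuclideanSpace ℝ (Fin 2)) b
  have hz := mem_adaptedDomain (P.mem_baseSet_trivAt b) hbk
  refine contMDiffAt_of_contDiffAt_symm hk hbk ?_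
  obtain ⟨c, -, h⟩ := exists_volumeDensity_chart_eq (gbar := gbar) hsurj hhol hp hinv
    (P.trivAt_mem b) hz
  have hs := (contDiffOn_det (contDiffOn_localG (gbar := gbar) (P.trivAt_mem b) hk hψ)).sqrt
    fun _ hz => (localG_posDef (P.trivAt_mem b) hk hψ hz).det_pos.ne'
  exact (contDiffAt_const.mul (hs.contDiffAt
    (isOpen_adaptedDomain.mem_nhds hz))).congr_of_eventuallyEq h

include hhol hp hinv hbase hE hlam in
theorem laplacian_volumeDensity_nonneg (b : B) :
    0 ≤ laplacian g (volumeDensity gbar τ hsurj) b := by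
  obtain ⟨ψ, hψ⟩ := exists_isCanonicalChart (N := N) (𝒢 := 𝒢)
  have hk := IsManifold.chart_mem_maximalAtlas (I := 𝓘(ℝ, EuclideanSpace ℝ (Fin 2))) (n := ∞) b
  have hz := mem_adaptedDomain (P.mem_baseSet_trivAt b)
    (mem_chart_source (EuclideanSpace ℝ (Fin 2)) b)
  obtain ⟨c, hc, h⟩ := exists_volumeDensity_chart_eq (gbar := gbar) hsurj hhol hp hinv
    (P.trivAt_mem b) hz
  have H := localEinstein_connMatrix (P.trivAt_mem b) hk hψ hinv hbase hE
  rw [laplacian, coordLaplacian_congr h, coordLaplacian_const_mul isOpen_adaptedDomain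
    H.contDiffOn_sqrt_det hz]
  exact mul_nonneg hc.le (H.laplacian_nonneg hlam hz)

-- The density is smooth, nonnegative, subharmonic, and bounded by the square root of the bound for
-- det G, so parabolicity applies.
include hhol hp hinv hbase hE hlam in
theorem exists_volumeDensity_eq_const (hpar : IsParabolic g)
    (hdet : BddAbove (Set.range fun y => (τ.gram gbar y).det)) :
    ∃ c, ∀ b, volumeDensity gbar τ hsurj b = c := by
  refine hpar _ ((contMDiff_volumeDensity hsurj hhol hp hinv).of_le (WithTop.coe_le_coe.2 (le_top (a := (2 : ℕ∞)))))
    (fun b => Real.sqrt_nonneg _) ?_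
    (laplacian_volumeDensity_nonneg hsurj hhol hp hinv hbase hE hlam)
  obtain ⟨C, hC⟩ := hdet
  refine ⟨√C, ?_⟩
  rintro _ ⟨b, rfl⟩
  exact Real.sqrt_le_sqrt (hC ⟨_, rfl⟩)

include hhol hp hinv hbase hE hlam in
/-- If the fibers have constant volume density, then the metric of the flat bundle satisfies the
harmonic map type equation with the scalar curvature of the base. -/
theorem trace_localG_eq {c : ℝ} (hconst : ∀ b, volumeDensity gbar τ hsurj b = c)
    {t : Bundle.Trivialization 𝒢 P.proj} {k : OpenPartialHomeomorph B (EuclideanSpace ℝ (Fin 2))}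
    (ht : t ∈ P.atlas) (hk : k ∈ IsManifold.maximalAtlas 𝓘(ℝ, EuclideanSpace ℝ (Fin 2)) ∞ B)
    {z : EuclideanSpace ℝ (Fin 2)} (hz : z ∈ adaptedDomain t k) (a b : Fin 2) :
    ((TwistedBundle.localG gbar t (k.symm z))⁻¹
        * matPartial a (fun z => TwistedBundle.localG gbar t (k.symm z)) z
        * (TwistedBundle.localG gbar t (k.symm z))⁻¹
        * matPartial b (fun z => TwistedBundle.localG gbar t (k.symm z)) z).trace
      = 2 * scalar (metricMatrix g k) z * metricMatrix g k z a b := by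
  obtain ⟨ψ, hψ⟩ := exists_isCanonicalChart (N := N) (𝒢 := 𝒢)
  have H := localEinstein_connMatrix ht hk hψ hinv hbase hE
  -- A constant global density makes √det G locally constant in each trivialization; its Laplacian
  -- and its logarithmic derivatives then vanish.
  have hloc : ∀ z ∈ adaptedDomain t k, ∃ d : ℝ,
      (fun w => √(TwistedBundle.localG gbar t (k.symm w)).det) =ᶠ[𝓝 z] fun _ => d := by
    intro z hz
    obtain ⟨d, hd, h⟩ := exists_volumeDensity_chart_eq (gbar := gbar) hsurj hhol hp hinv ht hz
    refine ⟨c / d, h.mono fun w hw => ?_⟩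
    rw [Function.comp_apply, hconst] at hw
    rw [hw]
    field_simp
  have hlap : ∀ z ∈ adaptedDomain t k, coordLaplacian (metricMatrix g k)
      (fun w => √(TwistedBundle.localG gbar t (k.symm w)).det) z = 0 := by
    intro z hz
    obtain ⟨d, h⟩ := hloc z hz
    rw [coordLaplacian_congr h, coordLaplacian_const]
  have hlog : ∀ z ∈ adaptedDomain t k, ∀ a,
      halfLogDeriv (fun w => TwistedBundle.localG gbar t (k.symm w)) a z = 0 := by
    intro z hz a
    obtain ⟨d, h⟩ := hloc z hz
    have h1 := H.partialDeriv_sqrt_det hz a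
    rw [partialDeriv_congr h, partialDeriv_const] at h1
    exact (mul_eq_zero.1 h1.symm).resolve_left (Real.sqrt_pos.2 (H.posDef z hz).det_pos).ne'
  have : Nonempty (Fin N) := ⟨0⟩
  exact H.trace_eq_scalar (H.eq_zero_of_laplacian_eq_zero hlam hz (hlap z hz)).1
    (fun w hw => (H.eq_zero_of_laplacian_eq_zero hlam hw (hlap w hw)).2) hlog hz a b

end Surface

/-! ### Invariance and positivity of the metric of the symmetric space. -/

section SymMetric

variable {N : ℕ}

/-- The trace formula is invariant under every invertible congruence, not only those of determinant
one, so frame changes and scalings are covered alike. -/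
theorem symMetric_congruence {G C : Matrix (Fin N) (Fin N) ℝ} (hC : C.det ≠ 0)
    (S T : Matrix (Fin N) (Fin N) ℝ) :
    symMetric (Cᵀ * G * C) (Cᵀ * S * C) (Cᵀ * T * C) = symMetric G S T := by
  have h1 : C * C⁻¹ = 1 := Matrix.mul_nonsing_inv C hC.isUnit
  have h2 : Cᵀ⁻¹ * Cᵀ = 1 :=
    Matrix.nonsing_inv_mul _ (by rw [Matrix.det_transpose]; exact hC.isUnit)
  have h3 : (Cᵀ * G * C)⁻¹ * (Cᵀ * S * C) * (Cᵀ * G * C)⁻¹ * (Cᵀ * T * C)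
      = C⁻¹ * (G⁻¹ * ((Cᵀ⁻¹ * Cᵀ) * S * (C * C⁻¹)) * G⁻¹ * ((Cᵀ⁻¹ * Cᵀ) * T)) * C := by
    rw [Matrix.mul_inv_rev, Matrix.mul_inv_rev]
    simp only [Matrix.mul_assoc]
  rw [symMetric, h3, h1, h2, Matrix.trace_mul_comm, ← Matrix.mul_assoc, h1]
  simp [symMetric, Matrix.mul_assoc]

-- Writing G⁻¹ = DᴴD turns the trace into the squared Frobenius norm of the symmetric matrix DSDᴴ.
open scoped MatrixOrder in
theorem symMetric_self_nonneg {G S : Matrix (Fin N) (Fin N) ℝ} (hG : G.PosDef) (hS : Sᵀ = S) :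
    0 ≤ symMetric G S S := by
  obtain ⟨D, hD⟩ := CStarAlgebra.nonneg_iff_eq_star_mul_self.mp hG.inv.posSemidef.nonneg
  rw [Matrix.star_eq_conjTranspose] at hD
  have h1 : symMetric G S S = ((D * S * Dᴴ) * (D * S * Dᴴ)ᴴ).trace := by
    have h2 : (D * S * Dᴴ)ᴴ = D * S * Dᴴ := by
      rw [Matrix.conjTranspose_mul, Matrix.conjTranspose_mul, Matrix.conjTranspose_conjTranspose,
        Matrix.conjTranspose_eq_transpose_of_trivial S, hS, Matrix.mul_assoc]
    rw [h2, symMetric, hD]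
    have h3 : Dᴴ * D * S * (Dᴴ * D) * S = Dᴴ * (D * S * Dᴴ * D * S) := by
      simp only [Matrix.mul_assoc]
    rw [h3, Matrix.trace_mul_comm]
    simp only [Matrix.mul_assoc]
  rw [h1]
  exact (Matrix.posSemidef_self_mul_conjTranspose _).trace_nonneg

theorem symMetric_sum_sum {α β : Type*} [Fintype α] [Fintype β] (G : Matrix (Fin N) (Fin N) ℝ)
    (a : α → ℝ) (b : β → ℝ) (S : α → Matrix (Fin N) (Fin N) ℝ) (T : β → Matrix (Fin N) (Fin N) ℝ) :
    symMetric G (∑ i, a i • S i) (∑ j, b j • T j)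
      = ∑ i, ∑ j, a i * b j * symMetric G (S i) (T j) := by
  simp only [symMetric, Matrix.trace_sum, Matrix.mul_smul,
    Matrix.smul_mul, Matrix.trace_smul, smul_eq_mul, Finset.mul_sum, Finset.sum_mul]
  rw [Finset.sum_comm]
  exact Finset.sum_congr rfl fun i _ => Finset.sum_congr rfl fun j _ => by ring

end SymMetric

/-! ### Metrics and derivatives expressed in a chart. -/

section ChartDeriv

variable {ι : Type*} [Fintype ι] [DecidableEq ι]
variable {X : Type*} [TopologicalSpace X] [ChartedSpace (EuclideanSpace ℝ ι) X]
  [IsManifold 𝓘(ℝ, EuclideanSpace ℝ ι) ∞ X]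
variable {k : OpenPartialHomeomorph X (EuclideanSpace ℝ ι)}

theorem inner_eq_sum_metricMatrix (g : RiemannianMetric ι X)
    (hk : k ∈ IsManifold.maximalAtlas 𝓘(ℝ, EuclideanSpace ℝ ι) ∞ X) {x : X} (hx : x ∈ k.source)
    (v w : EuclideanSpace ℝ ι) :
    modelInner g x v w = ∑ a, ∑ b, modelDeriv (EuclideanSpace ℝ ι) (EuclideanSpace ℝ ι) k x v a
      * modelDeriv (EuclideanSpace ℝ ι) (EuclideanSpace ℝ ι) k x w b
      * metricMatrix g k (k x) a b := by
  have h1 : pullInner g (k.symm ∘ k) x v w = modelInner g x v w := by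
    have h : k.symm ∘ k =ᶠ[𝓝 x] id := by
      filter_upwards [k.open_source.mem_nhds hx] with x' hx' using k.left_inv hx'
    rw [pullInner_congr g h, pullInner, modelDeriv, mfderiv_id]
    rfl
  rw [← h1, pullInner_comp g (mdifferentiableAt_symm hk (k.map_source hx))
    ((contMDiffAt_of_mem_maximalAtlas hk hx).mdifferentiableAt (by simp)), ← pullForm_apply]
  conv_lhs => rw [euclidean_eq_sum (modelDeriv _ _ k x v), euclidean_eq_sum (modelDeriv _ _ k x w)]
  simp only [map_sum, map_smul, LinearMap.sum_apply, LinearMap.smul_apply, smul_eq_mul,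
    Finset.mul_sum, pullForm_apply, metricMatrix_eq_pullInner]
  rw [Finset.sum_comm]
  exact Finset.sum_congr rfl fun i _ => Finset.sum_congr rfl fun j _ => by ring

theorem matrixDeriv_eq_sum_matPartial {N : ℕ} {F : X → Matrix (Fin N) (Fin N) ℝ}
    (hk : k ∈ IsManifold.maximalAtlas 𝓘(ℝ, EuclideanSpace ℝ ι) ∞ X) {x : X} (hx : x ∈ k.source)
    (hF : ∀ I J, ContDiffAt ℝ ∞ (fun z => F (k.symm z) I J) (k x)) (v : EuclideanSpace ℝ ι) :
    matrixDeriv F x v = ∑ a, modelDeriv (EuclideanSpace ℝ ι) (EuclideanSpace ℝ ι) k x v a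
      • matPartial a (fun z => F (k.symm z)) (k x) := by
  ext I J
  have h1 : (fun x' => F x' I J) =ᶠ[𝓝 x] (fun z => F (k.symm z) I J) ∘ k := by
    filter_upwards [k.open_source.mem_nhds hx] with x' hx'
    simp [k.left_inv hx']
  have hd : DifferentiableAt ℝ (fun z => F (k.symm z) I J) (k x) :=
    (hF I J).differentiableAt (by simp)
  have h2 : matrixDeriv F x v I J
      = modelDeriv (EuclideanSpace ℝ ι) ℝ (fun x' => F x' I J) x v := rfl
  rw [h2, modelDeriv_congr h1, modelDeriv_comp hd.mdifferentiableAt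
    ((contMDiffAt_of_mem_maximalAtlas hk hx).mdifferentiableAt (by simp))]
  have h3 : modelDeriv (EuclideanSpace ℝ ι) ℝ (fun z => F (k.symm z) I J) (k x)
      = fderiv ℝ (fun z => F (k.symm z) I J) (k x) := mfderiv_eq_fderiv
  rw [h3]
  conv_lhs => rw [euclidean_eq_sum (modelDeriv _ _ k x v), map_sum]
  rw [Matrix.sum_apply]
  refine Finset.sum_congr rfl fun a _ => ?_
  rw [map_smul]
  rfl

theorem modelDeriv_sum_mul {α : Type*} (s : Finset α) (c : α → ℝ) {f : α → X → ℝ} {x : X}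
    (hf : ∀ i, MDifferentiableAt 𝓘(ℝ, EuclideanSpace ℝ ι) 𝓘(ℝ, ℝ) (f i) x)
    (v : EuclideanSpace ℝ ι) :
    modelDeriv (EuclideanSpace ℝ ι) ℝ (fun x' => ∑ i ∈ s, c i * f i x') x v
      = ∑ i ∈ s, c i * modelDeriv (EuclideanSpace ℝ ι) ℝ (f i) x v := by
  have h : HasMFDerivAt 𝓘(ℝ, EuclideanSpace ℝ ι) 𝓘(ℝ, ℝ) (fun x' => ∑ i ∈ s, c i * f i x') x
      (∑ i ∈ s, c i • modelDeriv (EuclideanSpace ℝ ι) ℝ (f i) x : EuclideanSpace ℝ ι →L[ℝ] ℝ) := by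
    classical
    induction s using Finset.induction_on with
    | empty =>
      simp only [Finset.sum_empty]
      exact hasMFDerivAt_const (0 : ℝ) x
    | insert i s hi ih =>
      have h1 : (fun x' => ∑ i ∈ insert i s, c i * f i x')
          = c i • f i + fun x' => ∑ i ∈ s, c i * f i x' :=
        funext fun x' => Finset.sum_insert hi
      rw [h1, Finset.sum_insert hi]
      exact ((hf i).hasMFDerivAt.const_smul (c i)).add ih
  have h1 : modelDeriv (EuclideanSpace ℝ ι) ℝ (fun x' => ∑ i ∈ s, c i * f i x') x = _ := h.mfderiv
  rw [h1]
  simp [_root_.sum_apply]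

end ChartDeriv

/-! ### Consequences of the scalar curvature equation on the base. -/

section Conformal

variable {N : ℕ}

theorem matrix_congruence_apply (C G : Matrix (Fin N) (Fin N) ℝ) (I J : Fin N) :
    (Cᵀ * G * C) I J = ∑ q : Fin N × Fin N, (C q.1 I * C q.2 J) * G q.1 q.2 := by
  simp only [Matrix.mul_apply, Matrix.transpose_apply, Finset.sum_mul, Fintype.sum_prod_type]
  rw [Finset.sum_comm]
  exact Finset.sum_congr rfl fun i _ => Finset.sum_congr rfl fun j _ => by ring

variable [NeZero N]
variable {𝒢 : Type*} [AddCommGroup 𝒢] [TopologicalSpace 𝒢]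
  [ChartedSpace (EuclideanSpace ℝ (Fin N)) 𝒢] [LieAddGroup 𝓘(ℝ, EuclideanSpace ℝ (Fin N)) ∞ 𝒢]
variable {B : Type*} [TopologicalSpace B] [ChartedSpace (EuclideanSpace ℝ (Fin 2)) B]
variable {M : Type*} [TopologicalSpace M] [ChartedSpace (EuclideanSpace ℝ (Fin N ⊕ Fin 2)) M]
  [IsManifold 𝓘(ℝ, EuclideanSpace ℝ (Fin 2)) ∞ B]
  [IsManifold 𝓘(ℝ, EuclideanSpace ℝ (Fin N ⊕ Fin 2)) ∞ M]
variable {P : TwistedBundle 2 N 𝒢 B M}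
variable {gbar : RiemannianMetric (Fin N ⊕ Fin 2) M} {g : RiemannianMetric (Fin 2) B}
variable {t : Bundle.Trivialization 𝒢 P.proj}
  {k : OpenPartialHomeomorph B (EuclideanSpace ℝ (Fin 2))} {b : B}

theorem contDiffAt_localG_symm (gbar : RiemannianMetric (Fin N ⊕ Fin 2) M) (ht : t ∈ P.atlas)
    (hk : k ∈ IsManifold.maximalAtlas 𝓘(ℝ, EuclideanSpace ℝ (Fin 2)) ∞ B) (hb : b ∈ t.baseSet)
    (hbk : b ∈ k.source) (I J : Fin N) :
    ContDiffAt ℝ ∞ (fun z => TwistedBundle.localG gbar t (k.symm z) I J) (k b) := by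
  obtain ⟨ψ, hψ⟩ := exists_isCanonicalChart (N := N) (𝒢 := 𝒢)
  exact (contDiffOn_localG ht hk hψ I J).contDiffAt
    (isOpen_adaptedDomain.mem_nhds (mem_adaptedDomain hb hbk))

theorem contMDiffAt_localG (gbar : RiemannianMetric (Fin N ⊕ Fin 2) M) (ht : t ∈ P.atlas)
    (hb : b ∈ t.baseSet) (I J : Fin N) :
    ContMDiffAt 𝓘(ℝ, EuclideanSpace ℝ (Fin 2)) 𝓘(ℝ, ℝ) ∞
      (fun b => TwistedBundle.localG gbar t b I J) b :=
  contMDiffAt_of_contDiffAt_symm (IsManifold.chart_mem_maximalAtlas b) (mem_chart_source _ b)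
    (contDiffAt_localG_symm gbar ht (IsManifold.chart_mem_maximalAtlas b) hb
      (mem_chart_source _ b) I J)

theorem posDef_localG (gbar : RiemannianMetric (Fin N ⊕ Fin 2) M) (ht : t ∈ P.atlas)
    (hb : b ∈ t.baseSet) : (TwistedBundle.localG gbar t b).PosDef := by
  obtain ⟨ψ, hψ⟩ := exists_isCanonicalChart (N := N) (𝒢 := 𝒢)
  have hbk := mem_chart_source (EuclideanSpace ℝ (Fin 2)) b
  have h := localG_posDef (gbar := gbar) ht (IsManifold.chart_mem_maximalAtlas b) hψ
    (mem_adaptedDomain hb hbk)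
  rwa [(chartAt (EuclideanSpace ℝ (Fin 2)) b).left_inv hbk] at h

/-- The equation `G^{IJ} G_{JK,α} G^{KL} G_{LI,β} = 2 R g_{αβ}` in all coordinates. -/
def HasScalarEquation (P : TwistedBundle 2 N 𝒢 B M) (gbar : RiemannianMetric (Fin N ⊕ Fin 2) M)
    (g : RiemannianMetric (Fin 2) B) : Prop :=
  ∀ t ∈ P.atlas, ∀ k ∈ IsManifold.maximalAtlas 𝓘(ℝ, EuclideanSpace ℝ (Fin 2)) ∞ B,
    ∀ z ∈ adaptedDomain t k, ∀ a b : Fin 2,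
      ((TwistedBundle.localG gbar t (k.symm z))⁻¹
        * matPartial a (fun z => TwistedBundle.localG gbar t (k.symm z)) z
        * (TwistedBundle.localG gbar t (k.symm z))⁻¹
        * matPartial b (fun z => TwistedBundle.localG gbar t (k.symm z)) z).trace
      = 2 * scalar (metricMatrix g k) z * metricMatrix g k z a b

theorem modelInner_pos (g : RiemannianMetric (Fin 2) B) (b : B) :
    0 < modelInner g b (EuclideanSpace.single 0 1) (EuclideanSpace.single 0 1) :=
  g.pos b _ fun h => by
    have h1 := congrArg (fun v : EuclideanSpace ℝ (Fin 2) => v 0)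
      (show (EuclideanSpace.single 0 1 : EuclideanSpace ℝ (Fin 2)) = 0 from h)
    simp at h1

variable (hS : HasScalarEquation P gbar g)
include hS

theorem symMetric_localG_chart (ht : t ∈ P.atlas)
    (hk : k ∈ IsManifold.maximalAtlas 𝓘(ℝ, EuclideanSpace ℝ (Fin 2)) ∞ B) (hb : b ∈ t.baseSet)
    (hbk : b ∈ k.source) (v w : EuclideanSpace ℝ (Fin 2)) :
    symMetric (TwistedBundle.localG gbar t b) (matrixDeriv (TwistedBundle.localG gbar t) b v)
        (matrixDeriv (TwistedBundle.localG gbar t) b w)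
      = 2 * scalar (metricMatrix g k) (k b) * modelInner g b v w := by
  have h := hS t ht k hk (k b) (mem_adaptedDomain hb hbk)
  rw [k.left_inv hbk] at h
  rw [matrixDeriv_eq_sum_matPartial hk hbk (contDiffAt_localG_symm gbar ht hk hb hbk),
    matrixDeriv_eq_sum_matPartial hk hbk (contDiffAt_localG_symm gbar ht hk hb hbk),
    symMetric_sum_sum, inner_eq_sum_metricMatrix g hk hbk, Finset.mul_sum]
  refine Finset.sum_congr rfl fun i _ => ?_
  rw [Finset.mul_sum]
  refine Finset.sum_congr rfl fun j _ => ?_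
  rw [symMetric, h i j]
  ring

theorem symMetric_localG (ht : t ∈ P.atlas) (hb : b ∈ t.baseSet) (v w : EuclideanSpace ℝ (Fin 2)) :
    symMetric (TwistedBundle.localG gbar t b) (matrixDeriv (TwistedBundle.localG gbar t) b v)
        (matrixDeriv (TwistedBundle.localG gbar t) b w)
      = 2 * scalarCurvature g b * modelInner g b v w :=
  symMetric_localG_chart hS ht (IsManifold.chart_mem_maximalAtlas b) hb (mem_chart_source _ b) v w

/-- Chart independence comes from the equation itself: its left side is intrinsic, and so is the
positive factor multiplying the scalar curvature. -/
theorem scalar_eq_scalarCurvature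
    (hk : k ∈ IsManifold.maximalAtlas 𝓘(ℝ, EuclideanSpace ℝ (Fin 2)) ∞ B) (hbk : b ∈ k.source) :
    scalar (metricMatrix g k) (k b) = scalarCurvature g b := by
  have h1 := symMetric_localG_chart hS (P.trivAt_mem b) hk (P.mem_baseSet_trivAt b) hbk
    (EuclideanSpace.single 0 1) (EuclideanSpace.single 0 1)
  rw [symMetric_localG hS (P.trivAt_mem b) (P.mem_baseSet_trivAt b)] at h1
  have h2 := mul_right_cancel₀ (modelInner_pos g b).ne' h1
  linarith

/-- For v = w the left side of the equation is a squared norm, and `g` is positive on a nonzero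
vector. -/
theorem scalarCurvature_nonneg (b : B) : 0 ≤ scalarCurvature g b := by
  have hG := posDef_localG gbar (P.trivAt_mem b) (P.mem_baseSet_trivAt b)
  have h1 := symMetric_localG hS (P.trivAt_mem b) (P.mem_baseSet_trivAt b)
    (EuclideanSpace.single 0 1) (EuclideanSpace.single 0 1)
  have h2 := symMetric_self_nonneg hG (S := matrixDeriv (TwistedBundle.localG gbar (P.trivAt b)) b
    (EuclideanSpace.single 0 1 : EuclideanSpace ℝ (Fin 2))) (by
      ext I J
      have h3 : (fun b' => TwistedBundle.localG gbar (P.trivAt b) b' J I)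
          = fun b' => TwistedBundle.localG gbar (P.trivAt b) b' I J :=
        funext fun b' => gbar.symm _ _ _
      change modelDeriv (EuclideanSpace ℝ (Fin 2)) ℝ
        (fun b' => TwistedBundle.localG gbar (P.trivAt b) b' J I) b _ = _
      rw [h3]
      rfl)
  rw [h1] at h2
  have h3 := nonneg_of_mul_nonneg_left h2 (modelInner_pos g b)
  linarith

/-- `scalarCurvature` is defined with a chart that varies with the point. In one fixed chart it
equals the trace in direction 0 divided by 2g₀₀, a smooth quotient with positive denominator. -/
theorem contMDiff_scalarCurvature :
    ContMDiff 𝓘(ℝ, EuclideanSpace ℝ (Fin 2)) 𝓘(ℝ, ℝ) ∞ (scalarCurvature g) := by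
  intro b
  obtain ⟨ψ, hψ⟩ := exists_isCanonicalChart (N := N) (𝒢 := 𝒢)
  have hk := IsManifold.chart_mem_maximalAtlas (I := 𝓘(ℝ, EuclideanSpace ℝ (Fin 2))) (n := ∞) b
  have hbk := mem_chart_source (EuclideanSpace ℝ (Fin 2)) b
  set k := chartAt (EuclideanSpace ℝ (Fin 2)) b
  set t := P.trivAt b
  have ht : t ∈ P.atlas := P.trivAt_mem b
  have hz := mem_adaptedDomain (P.mem_baseSet_trivAt b) hbk
  refine contMDiffAt_of_contDiffAt_symm hk hbk ?_
  have hG := contDiffOn_localG (gbar := gbar) ht hk hψ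
  have hinv := contDiffOn_matrix_inv hG fun z hz => (localG_posDef ht hk hψ hz).det_pos.ne'
  have hd : ∀ I J, ContDiffOn ℝ ∞
      (fun z => matPartial 0 (fun z => TwistedBundle.localG gbar t (k.symm z)) z I J)
      (adaptedDomain t k) := fun I J => contDiffOn_partialDeriv isOpen_adaptedDomain (hG I J) 0
  have htr : ContDiffOn ℝ ∞ (fun z => ((TwistedBundle.localG gbar t (k.symm z))⁻¹
        * matPartial 0 (fun z => TwistedBundle.localG gbar t (k.symm z)) z
        * (TwistedBundle.localG gbar t (k.symm z))⁻¹
        * matPartial 0 (fun z => TwistedBundle.localG gbar t (k.symm z)) z).trace)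
      (adaptedDomain t k) :=
    ContDiffOn.sum fun I _ => contDiffOn_matrix_mul (contDiffOn_matrix_mul
      (contDiffOn_matrix_mul hinv hd) hinv) hd I I
  have hpos : ∀ z ∈ adaptedDomain t k, 0 < metricMatrix g k z 0 0 := fun z hz => by
    have := (metricMatrix_posDef g hk hz.1).diag_pos (i := 0)
    exact this
  have hmet := (contDiffOn_metricMatrix g hk 0 0).mono
    (Set.inter_subset_left : adaptedDomain t k ⊆ k.target)
  refine (((htr.div (contDiffOn_const.mul hmet) (g := fun z => 2 * metricMatrix g k z 0 0)
    fun z hz => (mul_pos two_pos (hpos z hz)).ne').contDiffAt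
      (isOpen_adaptedDomain.mem_nhds hz))).congr_of_eventuallyEq ?_
  filter_upwards [isOpen_adaptedDomain.mem_nhds hz] with z hz
  rw [Pi.div_apply, hS t ht k hk z hz 0 0, Function.comp_apply,
    ← scalar_eq_scalarCurvature hS hk (k.map_target hz.1), k.right_inv hz.1]
  have := (hpos z hz).ne'
  field_simp

end Conformal

/-! ### The developing map when det G is constant. -/

section DevelopingMap

variable {N : ℕ} [NeZero N]
variable {𝒢 : Type*} [AddCommGroup 𝒢] [TopologicalSpace 𝒢]
  [ChartedSpace (EuclideanSpace ℝ (Fin N)) 𝒢] [LieAddGroup 𝓘(ℝ, EuclideanSpace ℝ (Fin N)) ∞ 𝒢]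
variable {B : Type*} [TopologicalSpace B] [ChartedSpace (EuclideanSpace ℝ (Fin 2)) B]
variable {M : Type*} [TopologicalSpace M] [ChartedSpace (EuclideanSpace ℝ (Fin N ⊕ Fin 2)) M]
  [IsManifold 𝓘(ℝ, EuclideanSpace ℝ (Fin 2)) ∞ B]
  [IsManifold 𝓘(ℝ, EuclideanSpace ℝ (Fin N ⊕ Fin 2)) ∞ M]
variable {P : TwistedBundle 2 N 𝒢 B M}
variable {gbar : RiemannianMetric (Fin N ⊕ Fin 2) M} {g : RiemannianMetric (Fin 2) B}
variable {Y : Type*} [TopologicalSpace Y] [ChartedSpace (EuclideanSpace ℝ (Fin 2)) Y]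
  [IsManifold 𝓘(ℝ, EuclideanSpace ℝ (Fin 2)) ∞ Y] {p : Y → B} {τ : P.ParallelFrame p}
  (hinv : P.IsInvariant gbar) {d : ℝ} (hdet : ∀ y, (τ.gram gbar y).det = d)
  (hp : ContMDiff 𝓘(ℝ, EuclideanSpace ℝ (Fin 2)) 𝓘(ℝ, EuclideanSpace ℝ (Fin 2)) ∞ p)
include hinv hdet hp

/-- If `det G` is constant, then the developing map is locally the matrix of `G` in a
trivialization, in a fixed basis of the Lie algebra. -/
theorem exists_developingMap_eq (y : Y) : ∃ C : Matrix (Fin N) (Fin N) ℝ, C.det ≠ 0 ∧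
    ∀ᶠ y' in 𝓝 y, (symSpaceEquiv (τ.developingMap gbar y')).1
      = Cᵀ * TwistedBundle.localG gbar (P.trivAt (p y)) (p y') * C := by
  have hb := P.mem_baseSet_trivAt (p y)
  have ht := P.trivAt_mem (p y)
  have hd : 0 < d := hdet y ▸ (τ.gram_posDef gbar y).det_pos
  have hr : 0 < d ^ (-(1 / N : ℝ)) := Real.rpow_pos_of_pos hd _
  set r := d ^ (-(1 / N : ℝ)) with hrdef
  -- The normalizing factor r multiplies G once while C enters the congruence twice, hence the
  -- square root.
  refine ⟨√r • τ.frameMatrix (P.trivAt (p y)) y, ?_, ?_⟩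
  · rw [Matrix.det_smul]
    exact mul_ne_zero (pow_ne_zero _ (Real.sqrt_pos.2 hr).ne') (τ.det_frameMatrix_ne_zero hinv ht hb)
  · filter_upwards [τ.eventually_frameMatrix_eq ht hb,
      hp.continuous.continuousAt.eventually ((P.trivAt (p y)).open_baseSet.mem_nhds hb)] with y' h1 h2
    rw [TwistedBundle.ParallelFrame.developingMap, Equiv.apply_symm_apply]
    change ((τ.gram gbar y').det ^ (-(1 / N : ℝ))) • τ.gram gbar y' = _
    rw [hdet, ← hrdef, τ.gram_eq hinv ht h2, h1, Matrix.transpose_smul, Matrix.smul_mul,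
      Matrix.smul_mul, Matrix.mul_smul, smul_smul, Real.mul_self_sqrt hr.le]

theorem isSmoothToSymSpace_developingMap :
    IsSmoothToSymSpace (ι := Fin 2) (τ.developingMap gbar) := by
  intro I J y
  obtain ⟨C, -, hC⟩ := exists_developingMap_eq hinv hdet hp y
  have h : (fun y' => (symSpaceEquiv (τ.developingMap gbar y')).1 I J) =ᶠ[𝓝 y]
      fun y' => ∑ q : Fin N × Fin N, (C q.1 I * C q.2 J)
        * TwistedBundle.localG gbar (P.trivAt (p y)) (p y') q.1 q.2 := by
    filter_upwards [hC] with y' hy'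
    rw [hy', matrix_congruence_apply]
  refine ContMDiffAt.congr_of_eventuallyEq ?_ h
  refine ContMDiffAt.sum fun q _ => contMDiffAt_const.mul ?_
  exact (contMDiffAt_localG gbar (P.trivAt_mem (p y)) (P.mem_baseSet_trivAt (p y)) q.1 q.2).comp y
    (hp y)

/-- Near y the developing map is a congruence, by a constant matrix C, of the local matrix of G
composed with p. C passes through the derivative, and `symMetric_congruence` removes it. -/
theorem pullbackSymMetric_developingMap (hS : HasScalarEquation P gbar g) (y : Y)
    (v w : EuclideanSpace ℝ (Fin 2)) :
    pullbackSymMetric (τ.developingMap gbar) y v w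
      = 2 * scalarCurvature g (p y) * pullInner g p y v w := by
  obtain ⟨C, hC0, hC⟩ := exists_developingMap_eq hinv hdet hp y
  have hb := P.mem_baseSet_trivAt (p y)
  have ht := P.trivAt_mem (p y)
  have hpd : MDifferentiableAt 𝓘(ℝ, EuclideanSpace ℝ (Fin 2)) 𝓘(ℝ, EuclideanSpace ℝ (Fin 2)) p y :=
    (hp y).mdifferentiableAt (by simp)
  have hGd : ∀ q : Fin N × Fin N, MDifferentiableAt 𝓘(ℝ, EuclideanSpace ℝ (Fin 2)) 𝓘(ℝ, ℝ)
      (fun b => TwistedBundle.localG gbar (P.trivAt (p y)) b q.1 q.2) (p y) := fun q =>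
    (contMDiffAt_localG gbar ht hb q.1 q.2).mdifferentiableAt (by simp)
  have hder : ∀ v : EuclideanSpace ℝ (Fin 2),
      matrixDeriv (fun y' => (symSpaceEquiv (τ.developingMap gbar y')).1) y v
        = Cᵀ * matrixDeriv (TwistedBundle.localG gbar (P.trivAt (p y))) (p y)
          (modelDeriv (EuclideanSpace ℝ (Fin 2)) (EuclideanSpace ℝ (Fin 2)) p y v) * C := by
    intro v
    ext I J
    have h : (fun y' => (symSpaceEquiv (τ.developingMap gbar y')).1 I J) =ᶠ[𝓝 y]
        fun y' => ∑ q : Fin N × Fin N, (C q.1 I * C q.2 J)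
          * TwistedBundle.localG gbar (P.trivAt (p y)) (p y') q.1 q.2 := by
      filter_upwards [hC] with y' hy'
      rw [hy', matrix_congruence_apply]
    have h1 : matrixDeriv (fun y' => (symSpaceEquiv (τ.developingMap gbar y')).1) y v I J
        = modelDeriv (EuclideanSpace ℝ (Fin 2)) ℝ
          (fun y' => (symSpaceEquiv (τ.developingMap gbar y')).1 I J) y v := rfl
    rw [h1, modelDeriv_congr h, modelDeriv_sum_mul, matrix_congruence_apply]
    · refine Finset.sum_congr rfl fun q _ => congrArg _ ?_
      exact modelDeriv_comp (hGd q) hpd v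
    · exact fun q => (hGd q).comp y hpd
  change symMetric _ (matrixDeriv _ y v) (matrixDeriv _ y w) = _
  rw [hder, hder, hC.self_of_nhds, symMetric_congruence hC0,
    symMetric_localG hS ht hb]
  rfl

end DevelopingMap

end EinsteinCollapse

/-! ### The theorem. -/

open EinsteinCollapse in
theorem proposition2p17
    (N : ℕ) [NeZero N]
    -- the structure group: an `N`-dimensional connected abelian Lie group
    {𝒢 : Type*} [AddCommGroup 𝒢] [TopologicalSpace 𝒢] [ConnectedSpace 𝒢] [T2Space 𝒢]
    [ChartedSpace (EuclideanSpace ℝ (Fin N)) 𝒢] [LieAddGroup 𝓘(ℝ, EuclideanSpace ℝ (Fin N)) ∞ 𝒢]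
    -- the base: a connected smooth surface
    {B : Type*} [TopologicalSpace B] [ConnectedSpace B] [T2Space B] [SecondCountableTopology B]
    [ChartedSpace (EuclideanSpace ℝ (Fin 2)) B] [IsManifold 𝓘(ℝ, EuclideanSpace ℝ (Fin 2)) ∞ B]
    -- the total space
    {M : Type*} [TopologicalSpace M] [ChartedSpace (EuclideanSpace ℝ (Fin N ⊕ Fin 2)) M]
    [IsManifold 𝓘(ℝ, EuclideanSpace ℝ (Fin N ⊕ Fin 2)) ∞ M]
    (P : TwistedBundle 2 N 𝒢 B M)
    -- the invariant Einstein metric on the total space, and the induced metric on the base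
    (gbar : RiemannianMetric (Fin N ⊕ Fin 2) M) (g : RiemannianMetric (Fin 2) B)
    (hinv : P.IsInvariant gbar) (hbase : P.IsBaseMetric gbar g)
    (lam : ℝ) (hEinstein : IsEinstein gbar lam)
    -- the universal cover of the base, with a flat frame of the pullback of the flat bundle `e`
    {Btilde : Type*} [TopologicalSpace Btilde] [ChartedSpace (EuclideanSpace ℝ (Fin 2)) Btilde]
    [IsManifold 𝓘(ℝ, EuclideanSpace ℝ (Fin 2)) ∞ Btilde]
    (p : Btilde → B) (hp : IsUniversalCover (ι := Fin 2) p)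
    (τ : P.ParallelFrame p) (hhol : τ.HasUnimodularHolonomy)
    -- `B` is parabolic, `lam ≤ 0`, and `det G` is bounded above
    (hpar : IsParabolic g) (hlam : lam ≤ 0)
    (hdet : BddAbove (Set.range fun y => (τ.gram gbar y).det)) :
    -- the pullback under the developing map of the metric of the symmetric space is the pullback
    -- from `B` of a function times `g`
    IsSmoothToSymSpace (ι := Fin 2) (τ.developingMap gbar) ∧
    (∃ f : B → ℝ, ContMDiff 𝓘(ℝ, EuclideanSpace ℝ (Fin 2)) 𝓘(ℝ, ℝ) ∞ f ∧ (∀ b, 0 ≤ f b) ∧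
      ∀ (y : Btilde) (v w : TangentSpace 𝓘(ℝ, EuclideanSpace ℝ (Fin 2)) y),
        pullbackSymMetric (τ.developingMap gbar) y v w
          = f (p y) * g.inner (p y)
            (mfderiv 𝓘(ℝ, EuclideanSpace ℝ (Fin 2)) 𝓘(ℝ, EuclideanSpace ℝ (Fin 2)) p y v)
            (mfderiv 𝓘(ℝ, EuclideanSpace ℝ (Fin 2)) 𝓘(ℝ, EuclideanSpace ℝ (Fin 2)) p y w)) ∧
    -- `G^{IJ} G_{JK,α} G^{KL} G_{LI,β} = 2 R g_{αβ}`
    (∀ t ∈ P.atlas, ∀ b ∈ t.baseSet,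
      ∀ v w : TangentSpace 𝓘(ℝ, EuclideanSpace ℝ (Fin 2)) b,
        ((TwistedBundle.localG gbar t b)⁻¹ * matrixDeriv (TwistedBundle.localG gbar t) b v
          * (TwistedBundle.localG gbar t b)⁻¹
          * matrixDeriv (TwistedBundle.localG gbar t) b w).trace
        = 2 * scalarCurvature g b * g.inner b v w) := by
  have hlocal : IsLocalHomeomorph p := hp.isCoveringMap.isLocalHomeomorph
  obtain ⟨c, hc⟩ := exists_volumeDensity_eq_const hp.surjective hhol hlocal hinv hbase hEinstein
    hlam hpar hdet
  have hS : HasScalarEquation P gbar g := fun t ht k hk z hz a b =>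
    trace_localG_eq hp.surjective hhol hlocal hinv hbase hEinstein hlam hc ht hk hz a b
  -- The constant c is the value of √det G, so det G itself is its square.
  have hd : ∀ y, (τ.gram gbar y).det = c ^ 2 := fun y => by
    rw [← hc (p y), volumeDensity_proj hp.surjective hhol,
      Real.sq_sqrt (τ.gram_posDef gbar y).det_pos.le]
  have hsmooth := hp.isLocalDiffeomorph.contMDiff
  -- The conformal factor is f = 2R.
  refine ⟨isSmoothToSymSpace_developingMap hinv hd hsmooth, ⟨fun b => 2 * scalarCurvature g b,
    contMDiff_const.mul (contMDiff_scalarCurvature hS),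
    fun b => mul_nonneg two_pos.le (scalarCurvature_nonneg hS b), fun y v w =>
      pullbackSymMetric_developingMap hinv hd hsmooth hS y v w⟩, fun t ht b hb v w =>
      symMetric_localG hS ht hb v w⟩
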